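/- **Setting.** Let $m,n\ge 1$, $d=mn$, $A\in\mathbb R^{n\times n}$, $B\in\mathbb R^{n\times m}$, with $(A,B)$ stabilizable, $Q\succeq 0$, $R\succ 0$, $(A,Q^{1/2})$ detectable. Let $\mathcal D$ be a probability distribution on $\mathbb R^n$ with $\mathbb E[v]=0$, $\mathbb E[vv^\top]=I_n$ and $\|v\|_2^2\le C_m$ a.s. for $v\sim\mathcal D$, where $C_m>0$. For $K\in\mathbb R^{m\times n}$ let $x_{t+1}=Ax_t+Bu_t$, $u_t=-Kx_t$, $c_t=x_t^\top Qx_t+u_t^\top Ru_t$; let $\mathcal J(K;x_0)=\sum_{t\ge0}c_t$, $\mathcal J_\delta(K;x_0)=\sum_{t=0}^{T_\delta-1}c_t$, $\mathcal J(K)=\mathbb E_{x_0\sim\mathcal D}[\mathcal J(K;x_0)]$, and let $\mathcal K_{st}=\{K:\rho(A-BK)<1\}$ ($\mathcal J(K)=\infty$ off $\mathcal K_{st}$). Then $\mathcal J$ has a minimizer $K^*$ over $\mathcal K_{st}$. Fix $K_0\in\mathcal K_{st}$, $\Delta_0=\mathcal J(K_0)-\mathcal J(K^*)$, $\mathcal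 G^0=\{K\in\mathcal K_{st}:\mathcal J(K)-\mathcal J(K^*)\le10\Delta_0\}$. **Constants.** There are a number $\mu>0$ with $\mu(\mathcal J(K)-\mathcal J(K^*))\le\|\nabla\mathcal J(K)\|_F^2$ on $\mathcal K_{st}$, and positive numbers $\lambda_K,\widetilde\lambda_K,\zeta_K,\phi_K,\beta_K$ for $K\in\mathcal G^0$, such that: if $\|K'-K\|_F\le\zeta_K$, then $K'\in\mathcal K_{st}$ and $|\mathcal J(K')-\mathcal J(K)|\le\lambda_K\|K'-K\|_F$; for a.e. $x_0\sim\mathcal D$, $|\mathcal J(K';x_0)-\mathcal J(K'';x_0)|\le\widetilde\lambda_K\|K'-K''\|_F$ for all $K',K''$ within $\zeta_K$ of $K$; if $\|K'-K\|_F\le\beta_K$, then $K'\in\mathcal K_{st}$ and $\|\nabla\mathcal J(K')-\nabla\mathcal J(K)\|_F\le\phi_K\|K'-K\|_F$; and such that $\lambda_0=\sup_{\mathcal G^0}\lambda_K$, $\widetilde\lambda_0=\sup_{\mathcal G^0}\widetilde\lambda_K$, $\phi_0=\sup_{\mathcal G^0}\phi_K$ are finite and $\rho_0=\inf_{\mathcal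 G^0}\min\{\beta_K,\zeta_K\}>0$. Fix any such choice and put $\theta_0=\min\{1/(2\phi_0),\rho_0/\lambda_0\}$. For every $0<r\le\rho_0$ there are $M>0$, $\gamma\in(0,1)$ with $\|x_t\|_2^2\le M\gamma^{2t}\|x_0\|_2^2$ for all $t$, $x_0$ and all policies $K$ in the closed $r$-neighborhood $\mathcal G^0_r$ of $\mathcal G^0$ (Frobenius norm). Fix any such $M,\gamma$ and put $\beta=\max_{K\in\mathcal G^0_r}\|Q+K^\top RK\|_2$. **Algorithm.** Draw independently $x_0^{(s)}\sim\mathcal D$ and $D_s$ uniform on $\{\|D\|_F=1\}$, $s=0,1,\dots$, and iterate from $K_0$: $K_{s+1}=K_s-\eta\,\widehat G(K_s)$, where $\widehat G$ is obtained from the one-point estimate $G(K)=\mathcal J(K+rD;x_0)\frac dr D$ or the two-point estimate $G(K)=[\mathcal J(K+rD;x_0)-\mathcal J(K-rD;x_0)]\frac d{2r}D$ by replacing $\mathcal J(\cdot;x_0)$ with $\mathcal J_\delta(\cdot;x_0)$. **Parameters.** Let $\epsilon,\eta,r>0$, $\epsilon\log(120\Delta_0/\epsilon)<12\Delta_0$,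 $\delta=\min\{\frac{\mu\theta_0}{16}\sqrt{\epsilon/15},\frac12\sqrt{\mu\epsilon/30}\}$, $T_s=\lceil\frac4{\eta\mu}\log(120\Delta_0/\epsilon)\rceil$ (read as $0$ if this is negative), $r\le\min\{\frac{\mu\theta_0}{16\phi_0}\sqrt{\epsilon/15},\frac1{4\phi_0}\sqrt{\mu\epsilon/15},\rho_0\}$, and - one-point: also $r\le10\mathcal J(K_0)/\lambda_0$, and $\eta\le\min\{\frac{\mu r^2\epsilon}{480\phi_0[20C_m\mathcal J(K_0)d]^2},\frac1{4\phi_0},\frac{\rho_0r}{20C_m\mathcal J(K_0)d+\delta r}\}$; - two-point: $\eta\le\min\{\frac{\mu\epsilon}{480\phi_0d\widetilde\lambda_0^2},\frac1{4\phi_0},\frac{\rho_0}{d\widetilde\lambda_0+\delta}\}$. Suppose that for almost every $x_0\sim\mathcal D$ $$T_\delta\ge\frac1{2(1-\gamma)}\max\Big\{\log\Big[\frac{16\sqrt{15}\,M\beta d\|x_0\|_2^2}{(1-\gamma^2)r\mu\theta_0\sqrt\epsilon}\Big],\ \log\Big[\frac{2\sqrt{30}\,M\beta d\|x_0\|_2^2}{(1-\gamma^2)r\sqrt{\mu\epsilon}}\Big]\Big\}.$$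 **Conclusion.** The iteration has the form $K_{s+1}=K_s-\eta G(K_s)+\eta E_s$, where almost surely $\|E_s\|_F\le\delta$ for all $s$ with $K_s\in\mathcal G^0$; and with probability at least $3/4$, $K_{T_s}\in\mathcal K_{st}$ and $\mathcal J(K_{T_s})-\mathcal J(K^*)<\epsilon$. -/

import Mathlib

open MeasureTheory ProbabilityTheory
open scoped Matrix

noncomputable section

/-- States `x ∈ ℝⁿ`, with the Euclidean norm. -/
abbrev State (n : ℕ) : Type := EuclideanSpace ℝ (Fin n)

/-- Policies `K ∈ ℝ^{m × n}`, stored as the Euclidean space of their entries, so that the norm is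
the Frobenius norm and the inner product is the Frobenius inner product. -/
abbrev Policy (m n : ℕ) : Type := EuclideanSpace ℝ (Fin m × Fin n)

/-- The matrix of a policy. -/
def Policy.mat {m n : ℕ} (K : Policy m n) : Matrix (Fin m) (Fin n) ℝ :=
  Matrix.of fun i j => K (i, j)

/-- The uniform distribution on the unit Frobenius sphere of `ℝ^{m × n}`: the normalized surface
measure, seen as a measure on the whole space. -/
def unifSphere (m n : ℕ) : Measure (Policy m n) :=
  (((volume : Measure (Policy m n)).toSphere Set.univ)⁻¹ •
    (volume : Measure (Policy m n)).toSphere).map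
      (fun D : Metric.sphere (0 : Policy m n) 1 => (D : Policy m n))

/-- The spectral radius of a real square matrix (over its complex eigenvalues) is less than one. -/
def SchurStable {n : ℕ} (A : Matrix (Fin n) (Fin n) ℝ) : Prop :=
  spectralRadius ℂ (A.map (algebraMap ℝ ℂ)) < 1

/-- The spectral (`ℓ²` operator) norm of a square matrix. -/
def specNorm {n : ℕ} (A : Matrix (Fin n) (Fin n) ℝ) : ℝ :=
  ‖Matrix.toEuclideanCLM (n := Fin n) (𝕜 := ℝ) A‖

/-- The data of an LQR problem with `n` states and `m` inputs: system matrices, cost matrices and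
the distribution of the initial state. -/
structure LQR (m n : ℕ) where
  A : Matrix (Fin n) (Fin n) ℝ
  B : Matrix (Fin n) (Fin m) ℝ
  Q : Matrix (Fin n) (Fin n) ℝ
  R : Matrix (Fin m) (Fin m) ℝ
  D : Measure (State n)

/-- Whether gradients are estimated from one or from two cost values. -/
inductive Setting
  | onePoint
  | twoPoint

namespace LQR

variable {m n : ℕ}

/-- `(A, B)` is stabilizable. -/
def Stabilizable (S : LQR m n) : Prop :=
  ∃ F : Matrix (Fin m) (Fin n) ℝ, SchurStable (S.A - S.B * F)

/-- `(A, Q^{1/2})` is detectable, where `Q^{1/2}` is the positive semidefinite square root. -/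
def Detectable (S : LQR m n) : Prop :=
  ∃ H : Matrix (Fin n) (Fin n) ℝ, H.PosSemidef ∧ H * H = S.Q ∧
    ∃ L : Matrix (Fin n) (Fin n) ℝ, SchurStable (S.A - L * H)

/-- The standing assumptions on the matrices and on the distribution of the initial state. -/
structure Standing (S : LQR m n) (Cm : ℝ) : Prop where
  stabilizable : S.Stabilizable
  Q_posSemidef : S.Q.PosSemidef
  R_posDef : S.R.PosDef
  detectable : S.Detectable
  prob : IsProbabilityMeasure S.D
  mean_zero : ∀ i, ∫ x, x i ∂S.D = 0
  cov_one : ∀ i j, ∫ x, x i * x j ∂S.D = (1 : Matrix (Fin n) (Fin n) ℝ) i j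
  Cm_pos : 0 < Cm
  bounded : ∀ᵐ x ∂S.D, ‖x‖ ^ 2 ≤ Cm

/-- The stabilizing policies. -/
def stab (S : LQR m n) : Set (Policy m n) :=
  {K | SchurStable (S.A - S.B * K.mat)}

/-- The state `x_t` of `x_{t+1} = A x_t + B u_t` under `u_t = - K x_t`, started at `x`. -/
def traj (S : LQR m n) (K : Policy m n) (x : State n) : ℕ → State n
  | 0 => x
  | t + 1 => WithLp.toLp 2 (S.A *ᵥ (traj S K x t).ofLp +
      S.B *ᵥ (-(K.mat *ᵥ (traj S K x t).ofLp)))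

/-- The stage cost `c_t(x_t, u_t) = x_tᵀ Q x_t + u_tᵀ R u_t` under `u_t = - K x_t`. -/
def stageCost (S : LQR m n) (K : Policy m n) (x : State n) (t : ℕ) : ℝ :=
  (S.traj K x t).ofLp ⬝ᵥ (S.Q *ᵥ (S.traj K x t).ofLp) +
    (-(K.mat *ᵥ (S.traj K x t).ofLp)) ⬝ᵥ (S.R *ᵥ (-(K.mat *ᵥ (S.traj K x t).ofLp)))

/-- The infinite-horizon cost `𝒥(K; x)`. It is used for stabilizing `K` only, where the series
converges. -/
def costFrom (S : LQR m n) (K : Policy m n) (x : State n) : ℝ :=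
  ∑' t, S.stageCost K x t

/-- The finite-horizon cost `𝒥_δ(K; x)` of rollout length `T`. -/
def truncCost (S : LQR m n) (T : ℕ) (K : Policy m n) (x : State n) : ℝ :=
  ∑ t ∈ Finset.range T, S.stageCost K x t

/-- The cost `𝒥(K) = 𝔼 𝒥(K; x₀)`, used for stabilizing `K` only. -/
def cost (S : LQR m n) (K : Policy m n) : ℝ :=
  ∫ x, S.costFrom K x ∂S.D

/-- `Kstar` solves `min 𝒥(K)` over the stabilizing policies. -/
def IsOptimal (S : LQR m n) (Kstar : Policy m n) : Prop :=
  Kstar ∈ S.stab ∧ ∀ K ∈ S.stab, S.cost Kstar ≤ S.cost K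

/-- The initial gap `Δ₀ = 𝒥(K₀) - 𝒥(K*)`. -/
def gap (S : LQR m n) (Kstar K0 : Policy m n) : ℝ :=
  S.cost K0 - S.cost Kstar

/-- The sublevel set `𝒢⁰ = {K | 𝒥(K) - 𝒥(K*) ≤ 10 Δ₀}` (the cost of a policy that is not
stabilizing counts as infinite). -/
def sublevel (S : LQR m n) (Kstar K0 : Policy m n) : Set (Policy m n) :=
  {K | K ∈ S.stab ∧ S.cost K - S.cost Kstar ≤ 10 * S.gap Kstar K0}

/-- The closed `r`-neighborhood of `𝒢⁰`. It contains the policies `K ± r D` with `K ∈ 𝒢⁰` and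
`‖D‖ = 1` whose costs are rolled out. -/
def rolloutSet (S : LQR m n) (Kstar K0 : Policy m n) (r : ℝ) : Set (Policy m n) :=
  {K' | ∃ K ∈ S.sublevel Kstar K0, ‖K' - K‖ ≤ r}

end LQR

/-- The one-point or two-point gradient estimate, built from a cost oracle `J K x`; here
`d = m n`. -/
def gradEst {m n : ℕ} (σ : Setting) (J : Policy m n → State n → ℝ) (r : ℝ)
    (K D : Policy m n) (x : State n) : Policy m n :=
  match σ with
  | .onePoint => (J (K + r • D) x * ((m * n : ℝ) / r)) • D
  | .twoPoint => ((J (K + r • D) x - J (K - r • D) x) * ((m * n : ℝ) / (2 * r))) • D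

/-- A choice of the scalars `λ_K, λ̃_K, ζ_K, φ_K, β_K` (local Lipschitz constants of the cost, of
the cost from a given initial state, with their common radius; local Lipschitz constant of the gradient,
with its radius) and of the Polyak-Lojasiewicz constant `μ`. -/
structure LocalConstants (m n : ℕ) where
  lam : Policy m n → ℝ
  lamT : Policy m n → ℝ
  zeta : Policy m n → ℝ
  phi : Policy m n → ℝ
  beta : Policy m n → ℝ
  mu : ℝ

namespace LocalConstants

variable {m n : ℕ}

/-- `φ₀ = sup φ_K` over `G`. -/
def phi0 (c : LocalConstants m n) (G : Set (Policy m n)) : ℝ := sSup (c.phi '' G)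

/-- `λ₀ = sup λ_K` over `G`. -/
def lam0 (c : LocalConstants m n) (G : Set (Policy m n)) : ℝ := sSup (c.lam '' G)

/-- `λ̃₀ = sup λ̃_K` over `G`. -/
def lamT0 (c : LocalConstants m n) (G : Set (Policy m n)) : ℝ := sSup (c.lamT '' G)

/-- `ρ₀ = inf ρ_K` over `G`, where `ρ_K = min {β_K, ζ_K}`. -/
def rho0 (c : LocalConstants m n) (G : Set (Policy m n)) : ℝ :=
  sInf ((fun K => min (c.beta K) (c.zeta K)) '' G)

/-- `θ₀ = min {1 / (2 φ₀), ρ₀ / λ₀}`. -/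
def theta0 (c : LocalConstants m n) (G : Set (Policy m n)) : ℝ :=
  min (1 / (2 * c.phi0 G)) (c.rho0 G / c.lam0 G)

/-- The scalars do what they are named for at every policy of `G = 𝒢⁰`, and their suprema and
infimum over `𝒢⁰` are finite and positive. Closeness to `K` includes that `K'` is stabilizing,
since the cost is infinite otherwise. -/
structure Admissible (c : LocalConstants m n) (S : LQR m n) (Kstar K0 : Policy m n) : Prop where
  lam_pos : ∀ K ∈ S.sublevel Kstar K0, 0 < c.lam K
  lamT_pos : ∀ K ∈ S.sublevel Kstar K0, 0 < c.lamT K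
  zeta_pos : ∀ K ∈ S.sublevel Kstar K0, 0 < c.zeta K
  phi_pos : ∀ K ∈ S.sublevel Kstar K0, 0 < c.phi K
  beta_pos : ∀ K ∈ S.sublevel Kstar K0, 0 < c.beta K
  mu_pos : 0 < c.mu
  cost_lip : ∀ K ∈ S.sublevel Kstar K0, ∀ K', ‖K' - K‖ ≤ c.zeta K →
    K' ∈ S.stab ∧ |S.cost K' - S.cost K| ≤ c.lam K * ‖K' - K‖
  costFrom_lip : ∀ K ∈ S.sublevel Kstar K0, ∀ᵐ x ∂S.D, ∀ K' K'',
    ‖K' - K‖ ≤ c.zeta K → ‖K'' - K‖ ≤ c.zeta K →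
    |S.costFrom K' x - S.costFrom K'' x| ≤ c.lamT K * ‖K' - K''‖
  grad_lip : ∀ K ∈ S.sublevel Kstar K0, ∀ K', ‖K' - K‖ ≤ c.beta K →
    K' ∈ S.stab ∧ ‖gradient S.cost K' - gradient S.cost K‖ ≤ c.phi K * ‖K' - K‖
  pl : ∀ K ∈ S.stab, c.mu * (S.cost K - S.cost Kstar) ≤ ‖gradient S.cost K‖ ^ 2
  lam_bdd : BddAbove (c.lam '' S.sublevel Kstar K0)
  lamT_bdd : BddAbove (c.lamT '' S.sublevel Kstar K0)
  phi_bdd : BddAbove (c.phi '' S.sublevel Kstar K0)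
  rho0_pos : 0 < c.rho0 (S.sublevel Kstar K0)

/-- The perturbation bound `δ = min {(μ θ₀ / 16) √(ε / 15), (1 / 2) √(μ ε / 30)}`. -/
def pertBound (c : LocalConstants m n) (G : Set (Policy m n)) (ε : ℝ) : ℝ :=
  min (c.mu * c.theta0 G / 16 * √(ε / 15)) (1 / 2 * √(c.mu * ε / 30))

/-- The requirement on the smoothing radius `r`. -/
def RadiusCond (c : LocalConstants m n) (S : LQR m n) (Kstar K0 : Policy m n) (σ : Setting)
    (ε r : ℝ) : Prop :=
  let G := S.sublevel Kstar K0
  r ≤ c.mu * c.theta0 G / (16 * c.phi0 G) * √(ε / 15) ∧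
  r ≤ 1 / (4 * c.phi0 G) * √(c.mu * ε / 15) ∧
  r ≤ c.rho0 G ∧
  match σ with
  | .onePoint => r ≤ 10 * S.cost K0 / c.lam0 G
  | .twoPoint => True

/-- The requirement on the stepsize `η`. -/
def StepCond (c : LocalConstants m n) (S : LQR m n) (Kstar K0 : Policy m n) (σ : Setting)
    (Cm ε r η : ℝ) : Prop :=
  let G := S.sublevel Kstar K0
  let d : ℝ := m * n
  let δ := c.pertBound G ε
  η ≤ 1 / (4 * c.phi0 G) ∧
  match σ with
  | .onePoint =>
      η ≤ c.mu * r ^ 2 * ε / (480 * c.phi0 G * (20 * Cm * S.cost K0 * d) ^ 2) ∧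
      η ≤ c.rho0 G * r / (20 * Cm * S.cost K0 * d + δ * r)
  | .twoPoint =>
      η ≤ c.mu * ε / (480 * c.phi0 G * d * c.lamT0 G ^ 2) ∧
      η ≤ c.rho0 G / (d * c.lamT0 G + δ)

end LocalConstants

namespace LQR

variable {m n : ℕ}

/-- `M > 0` and `γ ∈ (0, 1)` are such that `‖x_t‖² ≤ M γ^{2t} ‖x₀‖²` under every policy of
`rolloutSet`. -/
def DecayConstants (S : LQR m n) (Kstar K0 : Policy m n) (r M γ : ℝ) : Prop :=
  0 < M ∧ 0 < γ ∧ γ < 1 ∧ ∀ K ∈ S.rolloutSet Kstar K0 r, ∀ (x : State n) (t : ℕ),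
    ‖S.traj K x t‖ ^ 2 ≤ M * γ ^ (2 * t) * ‖x‖ ^ 2

/-- `β = max ‖Q + Kᵀ R K‖₂` over the policies of `rolloutSet`. -/
def costBound (S : LQR m n) (Kstar K0 : Policy m n) (r : ℝ) : ℝ :=
  sSup ((fun K => specNorm (S.Q + K.matᵀ * S.R * K.mat)) '' S.rolloutSet Kstar K0 r)

/-- The lower bound on the rollout length for the initial state `x`. -/
def rolloutBound (S : LQR m n) (c : LocalConstants m n) (Kstar K0 : Policy m n)
    (ε r M γ : ℝ) (x : State n) : ℝ :=
  let G := S.sublevel Kstar K0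
  let β := S.costBound Kstar K0 r
  let d : ℝ := m * n
  1 / (2 * (1 - γ)) * max
    (Real.log (16 * √15 * M * β * d * ‖x‖ ^ 2 / ((1 - γ ^ 2) * r * c.mu * c.theta0 G * √ε)))
    (Real.log (2 * √30 * M * β * d * ‖x‖ ^ 2 / ((1 - γ ^ 2) * r * √(c.mu * ε))))

/-- The iteration number `T_s = (4 / (η μ)) log (120 Δ₀ / ε)`, rounded up. -/
def iterNum (S : LQR m n) (Kstar K0 : Policy m n) (μ ε η : ℝ) : ℕ :=
  ⌈4 / (η * μ) * Real.log (120 * S.gap Kstar K0 / ε)⌉₊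

end LQR

end

/-!
For a stabilizing policy the cost from an initial state is a quadratic form, given by the solution of
a discrete Lyapunov equation. The Lyapunov operator is invertible (`PowDecay.isUnit_lyapOp`), and
inversion is smooth, so the cost is a smooth function on the open set of stabilizing policies. By
detectability and positivity of `R`, a bound on the cost bounds the policy and the energy of its
trajectories, so sublevel sets are compact (`LQR.Standing.isCompact_sublevel`). A minimizer, uniform
local constants and a uniform decay rate exist by compactness. Gradient dominance
(`LQR.Standing.exists_pl`) comes from telescoping the one-step advantages along the trajectory of the
other policy.

In one iteration from a policy `K` of the sublevel set, the gradient estimate differs from `∇𝒥(K)` in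
mean by at most `φ₀ r + δ`. The first term is the bias of smoothing: by the divergence theorem on the
ball, `d` times the average of `f(u) u` over the unit sphere is the average of `∇f` over the ball
(`abs_average_sphere_sub_le`). The second is the error of finite rollouts, which is small by the
geometric decay of the trajectories (`LQR.Standing.norm_gradEst_sub_le_pertBound`). The admissible
step in the two-point setting is proportional to `1 / d`, for which the almost sure bound `d λ̃₀` on
the estimate is not enough: one needs a second moment of order `d λ̃₀²`. It follows from a Poincaré
inequality for odd functions on the sphere (`lintegral_sphere_sq_le_of_odd`). To prove that, one
extends the function homogeneously of degree one and averages the one-dimensional Wirtinger inequality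
for antiperiodic functions over the curves `cos θ X + sin θ Y`, where `X` and `Y` are independent
standard Gaussian vectors; position and velocity at each `θ` are again independent and Gaussian.

The almost sure bound also keeps one step within the radius `ρ₀`, where the gradient is Lipschitz, so
the quadratic upper bound on the cost applies. Taking expectations and using gradient dominance
(`LQR.RunAssumptions.lintegral_step_le`), the expected gap grows by at most `η μ ε / 80` in one step,
and it also contracts by the factor `1 - η μ / 2` up to `η μ ε / 50`. The iterates form a Markov chain,
which is stopped when it leaves the sublevel set. The drift bounds the probability of leaving before
the last iteration by `1 / 5` (`mul_measure_stay_compl_le`). On the event of staying, the contraction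
makes the expected final gap at most `ε / 20` (`setLIntegral_stay_le`), and Markov's inequality bounds
the probability of a final gap of at least `ε` by `1 / 20`.

Two points need care. The rounding in the number of iterations costs one extra step of drift, which is
harmless since `μ ≤ 2 φ₀` (`LQR.Standing.mu_le`) forces `η μ ≤ 1 / 2`. And if `ε` exceeds the level
`10 Δ₀`, staying in the sublevel set already gives the claim
(`LQR.RunAssumptions.measureReal_failure_le`).
-/

noncomputable section

open Filter Topology

/-! ### Schur stability and powers of matrices -/

section Schur

attribute [local instance] Matrix.linftyOpNormedRing Matrix.linftyOpNormedAlgebra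

variable {n : ℕ}

theorem norm_map_algebraMap_complex (F : Matrix (Fin n) (Fin n) ℝ) :
    ‖F.map (algebraMap ℝ ℂ)‖ = ‖F‖ := by
  simp [Matrix.linfty_opNorm_def]

theorem map_algebraMap_complex_pow (F : Matrix (Fin n) (Fin n) ℝ) (t : ℕ) :
    (F ^ t).map (algebraMap ℝ ℂ) = F.map (algebraMap ℝ ℂ) ^ t :=
  map_pow (algebraMap ℝ ℂ).mapMatrix F t

/-- The spectral radius is at most `‖Fᵏ‖ ^ (1 / k)` for every `k`. The norm is the `ℓ^∞` operator
norm, for which complexification is isometric. -/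
theorem schurStable_of_norm_pow_lt_one {F : Matrix (Fin n) (Fin n) ℝ} {k : ℕ}
    (h : ‖F ^ (k + 1)‖ < 1) : SchurStable F := by
  have h1 : ‖(1 : Matrix (Fin n) (Fin n) ℂ)‖₊ ≤ 1 := by
    rw [Matrix.linfty_opNNNorm_def]
    refine Finset.sup_le fun i _ => ?_
    rw [Finset.sum_eq_single i] <;> simp +contextual [eq_comm]
  have h2 : ‖F.map (algebraMap ℝ ℂ) ^ (k + 1)‖₊ < 1 := by
    rw [← map_algebraMap_complex_pow, ← NNReal.coe_lt_coe, coe_nnnorm, norm_map_algebraMap_complex]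
    exact h
  have h3 : (0 : ℝ) < 1 / (k + 1) := by positivity
  calc spectralRadius ℂ (F.map (algebraMap ℝ ℂ))
      ≤ _ := spectrum.spectralRadius_le_pow_nnnorm_pow_one_div ℂ _ k
    _ ≤ (‖F.map (algebraMap ℝ ℂ) ^ (k + 1)‖₊ : ENNReal) ^ (1 / (k + 1) : ℝ) * 1 := by
      gcongr
      exact ENNReal.rpow_le_one (by exact_mod_cast h1) h3.le
    _ < 1 := by
      rw [mul_one]
      exact ENNReal.rpow_lt_one (by exact_mod_cast h2) h3

/-- Geometric decay of the powers of a Schur stable matrix, by Gelfand's formula. -/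
theorem SchurStable.exists_norm_pow_le {F : Matrix (Fin n) (Fin n) ℝ} (h : SchurStable F) :
    ∃ C q : ℝ, 0 ≤ C ∧ 0 < q ∧ q < 1 ∧ ∀ t, ‖F ^ t‖ ≤ C * q ^ t := by
  obtain ⟨q, hq1, hq2⟩ := exists_between h
  lift q to NNReal using (hq2.trans ENNReal.one_lt_top).ne
  have hq0 : 0 < q := by
    rcases eq_or_ne q 0 with rfl | h0
    · simp at hq1
    · exact pos_iff_ne_zero.2 h0
  have hev := (spectrum.pow_nnnorm_pow_one_div_tendsto_nhds_spectralRadius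
    (F.map (algebraMap ℝ ℂ))).eventually_lt_const hq1
  obtain ⟨N, hN⟩ := eventually_atTop.1 (hev.and (eventually_gt_atTop 0))
  have hq0' : (0 : ℝ) < q := hq0
  refine ⟨1 + ∑ t ∈ Finset.range N, ‖F ^ t‖ / (q : ℝ) ^ t, q, by positivity, hq0,
    by exact_mod_cast hq2, fun t => ?_⟩
  have hS : 0 ≤ ∑ t ∈ Finset.range N, ‖F ^ t‖ / (q : ℝ) ^ t := by positivity
  have hqt : 0 < (q : ℝ) ^ t := by positivity
  rcases lt_or_ge t N with ht | ht
  · have : ‖F ^ t‖ / (q : ℝ) ^ t ≤ ∑ t ∈ Finset.range N, ‖F ^ t‖ / (q : ℝ) ^ t :=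
      Finset.single_le_sum (f := fun t => ‖F ^ t‖ / (q : ℝ) ^ t) (fun _ _ => by positivity)
        (Finset.mem_range.2 ht)
    rw [div_le_iff₀ hqt] at this
    nlinarith
  · obtain ⟨h1, h2⟩ := hN t ht
    have h3 : (‖F.map (algebraMap ℝ ℂ) ^ t‖₊ : ENNReal) ≤ (q : ENNReal) ^ t := by
      have := ENNReal.rpow_le_rpow h1.le (z := (t : ℝ)) (by positivity)
      rwa [← ENNReal.rpow_mul, one_div_mul_cancel (by positivity), ENNReal.rpow_one,
        ENNReal.rpow_natCast] at this
    have h4 : ‖F ^ t‖ ≤ (q : ℝ) ^ t := by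
      rw [← norm_map_algebraMap_complex, map_algebraMap_complex_pow]
      exact_mod_cast h3
    nlinarith

/-- A square matrix as an operator on the Euclidean space. -/
abbrev opOf (F : Matrix (Fin n) (Fin n) ℝ) : State n →L[ℝ] State n :=
  Matrix.toEuclideanCLM (n := Fin n) (𝕜 := ℝ) F

theorem opOf_apply (F : Matrix (Fin n) (Fin n) ℝ) (x : State n) :
    opOf F x = WithLp.toLp 2 (F *ᵥ x.ofLp) := rfl

theorem opOf_entry (F : Matrix (Fin n) (Fin n) ℝ) (i j : Fin n) :
    opOf F (EuclideanSpace.single j 1) i = F i j := by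
  simp [opOf_apply]

theorem abs_entry_le_norm_opOf (F : Matrix (Fin n) (Fin n) ℝ) (i j : Fin n) :
    |F i j| ≤ ‖opOf F‖ := by
  rw [← opOf_entry F i j, ← Real.norm_eq_abs]
  refine (PiLp.norm_apply_le _ i).trans ?_
  simpa using (opOf F).le_opNorm (EuclideanSpace.single j 1)

theorem norm_le_mul_norm_opOf (F : Matrix (Fin n) (Fin n) ℝ) : ‖F‖ ≤ n * ‖opOf F‖ := by
  rw [Matrix.linfty_opNorm_def]
  have : (Finset.univ.sup fun i => ∑ j, ‖F i j‖₊) ≤ n * ‖opOf F‖₊ := by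
    refine Finset.sup_le fun i _ => ?_
    calc ∑ j, ‖F i j‖₊ ≤ ∑ _j : Fin n, ‖opOf F‖₊ :=
          Finset.sum_le_sum fun j _ => abs_entry_le_norm_opOf F i j
      _ = _ := by simp
  exact_mod_cast this

theorem norm_opOf_le_mul_norm (F : Matrix (Fin n) (Fin n) ℝ) : ‖opOf F‖ ≤ n * ‖F‖ := by
  have hrow : ∀ i, ∑ j, |F i j| ≤ ‖F‖ := by
    intro i
    rw [Matrix.linfty_opNorm_def]
    have := NNReal.coe_le_coe.2
      (Finset.le_sup (f := fun i => ∑ j, ‖F i j‖₊) (Finset.mem_univ i))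
    simpa using this
  refine ContinuousLinearMap.opNorm_le_bound _ (by positivity) fun x => ?_
  have hcoord : ∀ i, |opOf F x i| ≤ ‖F‖ * ‖x‖ := by
    intro i
    rw [opOf_apply]
    simp only [Matrix.mulVec, dotProduct]
    calc |∑ j, F i j * x j| ≤ ∑ j, |F i j| * ‖x‖ := by
          refine (Finset.abs_sum_le_sum_abs _ _).trans (Finset.sum_le_sum fun j _ => ?_)
          rw [abs_mul]
          gcongr
          exact PiLp.norm_apply_le x j
      _ ≤ ‖F‖ * ‖x‖ := by
          rw [← Finset.sum_mul]
          gcongr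
          exact hrow i
  calc ‖opOf F x‖ ≤ ∑ i, ‖opOf F x i‖ := by
        conv_lhs => rw [← (EuclideanSpace.basisFun (Fin n) ℝ).sum_repr (opOf F x)]
        refine (norm_sum_le _ _).trans (Finset.sum_le_sum fun i _ => ?_)
        simp [norm_smul]
    _ ≤ ∑ _i : Fin n, ‖F‖ * ‖x‖ := Finset.sum_le_sum fun i _ => hcoord i
    _ = n * ‖F‖ * ‖x‖ := by simp [mul_assoc]

theorem SchurStable.exists_norm_opOf_pow_le {F : Matrix (Fin n) (Fin n) ℝ} (h : SchurStable F) :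
    ∃ C q : ℝ, 0 ≤ C ∧ 0 < q ∧ q < 1 ∧ ∀ t, ‖opOf F ^ t‖ ≤ C * q ^ t := by
  obtain ⟨C, q, hC, hq0, hq1, hb⟩ := h.exists_norm_pow_le
  refine ⟨n * C, q, by positivity, hq0, hq1, fun t => ?_⟩
  rw [← map_pow, mul_assoc]
  exact (norm_opOf_le_mul_norm _).trans (by gcongr; exact hb t)

/-- Powers of `F` that tend to zero in the Euclidean operator norm do so in the `ℓ^∞` operator norm. -/
theorem schurStable_of_tendsto {F : Matrix (Fin n) (Fin n) ℝ} {u : ℕ → ℕ}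
    (h : Tendsto (fun k => ‖opOf F ^ (u k + 1)‖) atTop (𝓝 0)) : SchurStable F := by
  have h2 := (h.const_mul (n : ℝ))
  rw [mul_zero] at h2
  obtain ⟨k, hk⟩ := (h2.eventually_lt_const one_pos).exists
  refine schurStable_of_norm_pow_lt_one (k := u k) ((norm_le_mul_norm_opOf _).trans_lt ?_)
  rwa [← map_pow] at hk

theorem schurStable_of_norm_opOf_pow_lt_one {F : Matrix (Fin n) (Fin n) ℝ} {k : ℕ}
    (h : ‖opOf F ^ (k + 1)‖ < 1) : SchurStable F := by
  refine schurStable_of_tendsto (u := fun j => (k + 1) * (j + 1) - 1) ?_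
  have h0 : Tendsto (fun j : ℕ => ‖opOf F ^ (k + 1)‖ ^ (j + 1)) atTop (𝓝 0) :=
    (tendsto_pow_atTop_nhds_zero_of_lt_one (norm_nonneg _) h).comp (tendsto_add_atTop_nat 1)
  refine squeeze_zero (fun _ => norm_nonneg _) (fun j => ?_) h0
  rw [Nat.sub_add_cancel (Nat.mul_pos k.succ_pos j.succ_pos), pow_mul]
  exact norm_pow_le' _ (Nat.succ_pos j)

end Schur

/-! ### The discrete Lyapunov equation -/

section Lyapunov

open ContinuousLinearMap

variable {E : Type*} [NormedAddCommGroup E] [InnerProductSpace ℝ E] [FiniteDimensional ℝ E]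

/-- Geometric decay of the powers of an operator. -/
def PowDecay (T : E →L[ℝ] E) : Prop :=
  ∃ C q : ℝ, 0 ≤ C ∧ 0 < q ∧ q < 1 ∧ ∀ t, ‖T ^ t‖ ≤ C * q ^ t

/-- The solution `∑ (T†)ᵗ W Tᵗ` of the discrete Lyapunov equation `X = W + T† X T`. -/
def lyap (T W : E →L[ℝ] E) : E →L[ℝ] E :=
  ∑' t, (adjoint T) ^ t * W * T ^ t

theorem adjoint_pow' (T : E →L[ℝ] E) (t : ℕ) : adjoint T ^ t = adjoint (T ^ t) := by
  simp only [← ContinuousLinearMap.star_eq_adjoint, star_pow]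

theorem PowDecay.summable {T : E →L[ℝ] E} (h : PowDecay T) (W : E →L[ℝ] E) :
    Summable (fun t => (adjoint T) ^ t * W * T ^ t) := by
  obtain ⟨C, q, hC, hq0, hq1, hb⟩ := h
  have hgeo : Summable fun t : ℕ => C * ‖W‖ * C * (q * q) ^ t :=
    (summable_geometric_of_lt_one (by positivity) (by nlinarith)).mul_left _
  refine Summable.of_norm_bounded hgeo fun t => ?_
  have h1 : ‖(adjoint T) ^ t‖ ≤ C * q ^ t := by
    rw [adjoint_pow', LinearIsometryEquiv.norm_map]
    exact hb t
  calc ‖(adjoint T) ^ t * W * T ^ t‖ ≤ ‖(adjoint T) ^ t‖ * ‖W‖ * ‖T ^ t‖ :=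
        (norm_mul_le _ _).trans (by gcongr; exact norm_mul_le _ _)
    _ ≤ (C * q ^ t) * ‖W‖ * (C * q ^ t) := by
        gcongr
        exact hb t
    _ = _ := by rw [mul_pow]; ring

theorem PowDecay.hasSum_inner {T : E →L[ℝ] E} (h : PowDecay T) (W : E →L[ℝ] E) (x : E) :
    HasSum (fun t => inner ℝ ((T ^ t) x) (W ((T ^ t) x))) (inner ℝ x (lyap T W x)) := by
  have := ((h.summable W).hasSum.mapL (apply ℝ E x)).mapL (innerSL ℝ x)
  refine this.congr_fun ?_
  intro t
  simp [adjoint_pow', adjoint_inner_right]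

theorem PowDecay.lyap_eq {T : E →L[ℝ] E} (h : PowDecay T) (W : E →L[ℝ] E) :
    lyap T W = W + adjoint T * lyap T W * T := by
  have hs := h.summable W
  conv_lhs => rw [lyap, hs.tsum_eq_zero_add]
  rw [lyap, ← hs.tsum_mul_left, ← (hs.mul_left _).tsum_mul_right]
  refine congrArg₂ (· + ·) ?_ (tsum_congr fun t => ?_)
  · simp only [pow_zero, one_mul, mul_one]
  · rw [pow_succ', pow_succ]
    simp only [mul_assoc]

/-- The Lyapunov operator `X ↦ X - T† X T`. -/
def lyapOp (T : E →L[ℝ] E) : (E →L[ℝ] E) →L[ℝ] (E →L[ℝ] E) :=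
  1 - mulLeftRight ℝ (E →L[ℝ] E) (adjoint T) T

theorem lyapOp_apply (T X : E →L[ℝ] E) : lyapOp T X = X - adjoint T * X * T := by
  simp [lyapOp]

/-- A solution of `X = T† X T` satisfies `X = (T†)ᵗ X Tᵗ` for all `t`, and the right-hand side tends
to zero; so the Lyapunov operator is injective, hence invertible in finite dimension. -/
theorem PowDecay.isUnit_lyapOp {T : E →L[ℝ] E} (h : PowDecay T) : IsUnit (lyapOp T) := by
  have hinj : Function.Injective (lyapOp T) := by
    rw [injective_iff_map_eq_zero]
    intro X hX
    rw [lyapOp_apply, sub_eq_zero] at hX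
    have hX' : ∀ t, (adjoint T) ^ t * X * T ^ t = X := by
      intro t
      induction t with
      | zero => simp
      | succ t ih =>
        rw [pow_succ, pow_succ', show adjoint T ^ t * adjoint T * X * (T * T ^ t) =
          adjoint T ^ t * (adjoint T * X * T) * T ^ t by simp only [mul_assoc], ← hX, ih]
    have := (h.summable X).tendsto_atTop_zero
    simp only [hX'] at this
    exact tendsto_nhds_unique tendsto_const_nhds this
  rw [ContinuousLinearMap.isUnit_iff_bijective]
  exact ⟨hinj, (LinearMap.injective_iff_surjective (f := (lyapOp T).toLinearMap)).1 hinj⟩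

theorem PowDecay.lyap_eq_inverse {T : E →L[ℝ] E} (h : PowDecay T) (W : E →L[ℝ] E) :
    lyap T W = Ring.inverse (lyapOp T) W := by
  have h1 : lyapOp T (lyap T W) = W := by
    rw [lyapOp_apply, sub_eq_iff_eq_add]
    exact h.lyap_eq W
  conv_rhs => rw [← h1]
  rw [← mul_apply_eq_comp, Ring.inverse_mul_cancel _ h.isUnit_lyapOp]
  rfl

theorem contDiff_lyapOp : ContDiff ℝ ⊤ (lyapOp : (E →L[ℝ] E) → _) := by
  unfold lyapOp
  have : ContDiff ℝ ⊤ fun T : E →L[ℝ] E => adjoint T :=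
    (adjoint (𝕜 := ℝ) (E := E) (F := E)).toContinuousLinearEquiv.contDiff
  fun_prop

/-- Smooth dependence of the solution on `T`, by smoothness of the inversion of units; the series
`lyap` is not differentiated term by term. -/
theorem contDiffAt_inverse_lyapOp {T : E →L[ℝ] E} (h : PowDecay T) :
    ContDiffAt ℝ ⊤ (fun T : E →L[ℝ] E => Ring.inverse (lyapOp T)) T := by
  have := contDiffAt_ringInverse ℝ (n := ⊤) (R := (E →L[ℝ] E) →L[ℝ] (E →L[ℝ] E))
    h.isUnit_lyapOp.unit
  rw [IsUnit.unit_spec] at this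
  exact this.comp T contDiff_lyapOp.contDiffAt

end Lyapunov

/-! ### The cost as a quadratic form -/

namespace LQR

variable {m n : ℕ}

/-- The operator `x ↦ K x` of a policy, as a continuous linear function of the policy. -/
def gainL : Policy m n →L[ℝ] (State n →L[ℝ] State m) :=
  LinearMap.toContinuousLinearMap
    (LinearMap.toContinuousLinearMap.toLinearMap ∘ₗ
      (Matrix.toEuclideanLin (𝕜 := ℝ) (m := Fin m) (n := Fin n)).toLinearMap ∘ₗ
      { toFun := Policy.mat, map_add' := fun _ _ => rfl, map_smul' := fun _ _ => rfl })

theorem gainL_apply (K : Policy m n) (x : State n) :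
    gainL K x = WithLp.toLp 2 (K.mat *ᵥ x.ofLp) := rfl

/-- The operator of the input matrix. -/
def inputOp (S : LQR m n) : State m →L[ℝ] State n :=
  LinearMap.toContinuousLinearMap (Matrix.toEuclideanLin (𝕜 := ℝ) S.B)

theorem inputOp_apply (S : LQR m n) (u : State m) :
    S.inputOp u = WithLp.toLp 2 (S.B *ᵥ u.ofLp) := rfl

/-- The closed-loop operator `A - B K`. -/
def clOp (S : LQR m n) (K : Policy m n) : State n →L[ℝ] State n :=
  opOf S.A - S.inputOp ∘L gainL K

/-- The operator `Q + Kᵀ R K` of the stage cost. -/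
def stageOp (S : LQR m n) (K : Policy m n) : State n →L[ℝ] State n :=
  opOf S.Q + (gainL K).adjoint ∘L opOf S.R ∘L gainL K

/-- The operator `P_K` of the quadratic form `x ↦ 𝒥(K; x)`. -/
def valueOp (S : LQR m n) (K : Policy m n) : State n →L[ℝ] State n :=
  lyap (S.clOp K) (S.stageOp K)

theorem clOp_eq (S : LQR m n) (K : Policy m n) : S.clOp K = opOf (S.A - S.B * K.mat) := by
  ext x : 1
  simp [clOp, opOf_apply, inputOp_apply, gainL_apply, Matrix.mulVec_mulVec]

theorem clOp_apply (S : LQR m n) (K : Policy m n) (x : State n) :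
    S.clOp K x = opOf S.A x - S.inputOp (gainL K x) := rfl

theorem inner_stageOp (S : LQR m n) (K : Policy m n) (x : State n) :
    inner ℝ x (S.stageOp K x) =
      inner ℝ x (opOf S.Q x) + inner ℝ (gainL K x) (opOf S.R (gainL K x)) := by
  simp [stageOp, inner_add_right, ContinuousLinearMap.adjoint_inner_right]

theorem traj_eq (S : LQR m n) (K : Policy m n) (x : State n) (t : ℕ) :
    S.traj K x t = (S.clOp K ^ t) x := by
  induction t with
  | zero => rfl
  | succ t ih =>
    rw [traj, ih, pow_succ', mul_apply_eq_comp, clOp_apply, opOf_apply,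
      inputOp_apply, gainL_apply, Matrix.mulVec_neg, ← sub_eq_add_neg]
    rfl

theorem inner_opOf {k : ℕ} (M : Matrix (Fin k) (Fin k) ℝ) (x : State k) :
    inner ℝ x (opOf M x) = x.ofLp ⬝ᵥ (M *ᵥ x.ofLp) := by
  rw [opOf_apply, EuclideanSpace.inner_eq_star_dotProduct, dotProduct_comm]
  rfl

theorem stageCost_eq (S : LQR m n) (K : Policy m n) (x : State n) (t : ℕ) :
    S.stageCost K x t = inner ℝ (S.traj K x t) (S.stageOp K (S.traj K x t)) := by
  rw [inner_stageOp, inner_opOf, inner_opOf, stageCost, gainL_apply,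
    Matrix.mulVec_neg, dotProduct_neg, neg_dotProduct, neg_neg]

theorem continuous_clOp (S : LQR m n) : Continuous S.clOp := by
  unfold clOp
  fun_prop

theorem contDiff_clOp (S : LQR m n) : ContDiff ℝ ⊤ S.clOp := by
  unfold clOp
  fun_prop

theorem contDiff_stageOp (S : LQR m n) : ContDiff ℝ ⊤ S.stageOp := by
  have : ContDiff ℝ ⊤ fun T : State n →L[ℝ] State m => ContinuousLinearMap.adjoint T :=
    (ContinuousLinearMap.adjoint (𝕜 := ℝ) (E := State n)
      (F := State m)).toContinuousLinearEquiv.contDiff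
  unfold stageOp
  fun_prop

theorem powDecay_of_mem_stab {S : LQR m n} {K : Policy m n} (hK : K ∈ S.stab) :
    PowDecay (S.clOp K) := by
  rw [clOp_eq]
  exact SchurStable.exists_norm_opOf_pow_le hK

theorem mem_stab_of_norm_pow_lt_one {S : LQR m n} {K : Policy m n} {k : ℕ}
    (h : ‖S.clOp K ^ (k + 1)‖ < 1) : K ∈ S.stab := by
  rw [clOp_eq] at h
  exact schurStable_of_norm_opOf_pow_lt_one h

theorem _root_.PowDecay.exists_norm_pow_lt_one {E : Type*} [NormedAddCommGroup E]
    [InnerProductSpace ℝ E] [FiniteDimensional ℝ E] {T : E →L[ℝ] E} (h : PowDecay T) :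
    ∃ k : ℕ, ‖T ^ (k + 1)‖ < 1 := by
  obtain ⟨C, q, hC, hq0, hq1, hb⟩ := h
  have h1 : Tendsto (fun k : ℕ => C * q ^ (k + 1)) atTop (𝓝 (C * 0)) :=
    ((tendsto_pow_atTop_nhds_zero_of_lt_one hq0.le hq1).comp (tendsto_add_atTop_nat 1)).const_mul C
  rw [mul_zero] at h1
  obtain ⟨k, hk⟩ := (h1.eventually_lt_const one_pos).exists
  exact ⟨k, (hb _).trans_lt hk⟩

theorem isOpen_stab (S : LQR m n) : IsOpen S.stab := by
  rw [isOpen_iff_mem_nhds]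
  intro K hK
  obtain ⟨k, hk⟩ := (powDecay_of_mem_stab hK).exists_norm_pow_lt_one
  have hc : Continuous fun K => ‖S.clOp K ^ (k + 1)‖ := (S.continuous_clOp.pow _).norm
  filter_upwards [hc.continuousAt.eventually_lt_const hk] with K' hK'
  exact mem_stab_of_norm_pow_lt_one hK'

theorem hasSum_stageCost {S : LQR m n} {K : Policy m n} (hK : K ∈ S.stab) (x : State n) :
    HasSum (S.stageCost K x) (inner ℝ x (S.valueOp K x)) := by
  refine ((powDecay_of_mem_stab hK).hasSum_inner (S.stageOp K) x).congr_fun fun t => ?_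
  rw [stageCost_eq, traj_eq]

theorem costFrom_eq {S : LQR m n} {K : Policy m n} (hK : K ∈ S.stab) (x : State n) :
    S.costFrom K x = inner ℝ x (S.valueOp K x) := (hasSum_stageCost hK x).tsum_eq

/-- The value operator as a smooth function of the policy: the inverse of the Lyapunov operator
applied to the stage cost. -/
def smoothValueOp (S : LQR m n) (K : Policy m n) : State n →L[ℝ] State n :=
  Ring.inverse (lyapOp (S.clOp K)) (S.stageOp K)

theorem smoothValueOp_eq {S : LQR m n} {K : Policy m n} (hK : K ∈ S.stab) :
    S.smoothValueOp K = S.valueOp K :=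
  ((powDecay_of_mem_stab hK).lyap_eq_inverse _).symm

theorem contDiffAt_valueOp {S : LQR m n} {K : Policy m n} (hK : K ∈ S.stab) :
    ContDiffAt ℝ ⊤ S.valueOp K := by
  have h1 : ContDiffAt ℝ ⊤ S.smoothValueOp K :=
    ((contDiffAt_inverse_lyapOp (powDecay_of_mem_stab hK)).comp K
      S.contDiff_clOp.contDiffAt).clm_apply S.contDiff_stageOp.contDiffAt
  refine h1.congr_of_eventuallyEq ?_
  filter_upwards [S.isOpen_stab.mem_nhds hK] with K' hK'
  exact (smoothValueOp_eq hK').symm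

/-- The solution of the Lyapunov equation with right-hand side the identity is continuous. -/
theorem continuousAt_lyap_one {S : LQR m n} {K : Policy m n} (hK : K ∈ S.stab) :
    ContinuousAt (fun K => lyap (S.clOp K) 1) K := by
  have h1 : ContinuousAt (fun K => Ring.inverse (lyapOp (S.clOp K)) 1) K :=
    (((contDiffAt_inverse_lyapOp (powDecay_of_mem_stab hK)).comp K
      S.contDiff_clOp.contDiffAt).clm_apply (contDiffAt_const (c := 1))).continuousAt
  refine h1.congr ?_
  filter_upwards [S.isOpen_stab.mem_nhds hK] with K' hK'
  exact ((powDecay_of_mem_stab hK').lyap_eq_inverse _).symm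

/-! ### The mean cost as a trace -/

/-- The standard basis of the state space. -/
abbrev basis (n : ℕ) (i : Fin n) : State n := EuclideanSpace.single i 1

theorem sum_inner_basis (P : State n →L[ℝ] State n) (x : State n) :
    inner ℝ x (P x) = ∑ i, ∑ j, (x i * x j) * inner ℝ (basis n i) (P (basis n j)) := by
  have hx : x = ∑ i, x i • basis n i := by
    simpa using ((EuclideanSpace.basisFun (Fin n) ℝ).sum_repr x).symm
  conv_lhs => rw [hx]
  simp only [map_sum, map_smul, sum_inner]
  refine Finset.sum_congr rfl fun i _ => ?_
  rw [inner_sum]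
  refine Finset.sum_congr rfl fun j _ => ?_
  rw [inner_smul_left, inner_smul_right, conj_trivial, mul_assoc]

variable {S : LQR m n} {Cm : ℝ}

theorem Standing.integrable_mul (hS : S.Standing Cm) (i j : Fin n) :
    Integrable (fun x : State n => x i * x j) S.D := by
  have := hS.prob
  refine Integrable.of_bound (C := Cm) (by fun_prop) ?_
  filter_upwards [hS.bounded] with x hx
  rw [norm_mul]
  calc ‖x i‖ * ‖x j‖ ≤ ‖x‖ * ‖x‖ := by
        gcongr <;> exact PiLp.norm_apply_le x _
    _ ≤ Cm := by rwa [← sq]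

theorem Standing.integrable_inner (hS : S.Standing Cm) (P : State n →L[ℝ] State n) :
    Integrable (fun x => inner ℝ x (P x)) S.D := by
  simp_rw [sum_inner_basis P]
  exact integrable_finsetSum _ fun i _ => integrable_finsetSum _ fun j _ =>
    (hS.integrable_mul i j).mul_const _

/-- As the initial state has identity covariance, a quadratic form has mean equal to its trace. -/
theorem Standing.integral_inner (hS : S.Standing Cm) (P : State n →L[ℝ] State n) :
    ∫ x, inner ℝ x (P x) ∂S.D = ∑ i, inner ℝ (basis n i) (P (basis n i)) := by
  simp_rw [sum_inner_basis P]
  rw [integral_finsetSum _ fun i _ => integrable_finsetSum _ fun j _ =>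
    (hS.integrable_mul i j).mul_const _]
  refine Finset.sum_congr rfl fun i _ => ?_
  rw [integral_finsetSum _ fun j _ => (hS.integrable_mul i j).mul_const _]
  simp_rw [integral_mul_const, hS.cov_one]
  simp [Matrix.one_apply]

theorem Standing.cost_eq (hS : S.Standing Cm) {K : Policy m n} (hK : K ∈ S.stab) :
    S.cost K = ∑ i, inner ℝ (basis n i) (S.valueOp K (basis n i)) := by
  rw [cost, ← hS.integral_inner]
  simp_rw [costFrom_eq hK]

theorem Standing.cost_eq_sum (hS : S.Standing Cm) {K : Policy m n} (hK : K ∈ S.stab) :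
    S.cost K = ∑ i, S.costFrom K (basis n i) := by
  rw [hS.cost_eq hK]
  simp_rw [costFrom_eq hK]

theorem Standing.contDiffAt_cost (hS : S.Standing Cm) {K : Policy m n} (hK : K ∈ S.stab) :
    ContDiffAt ℝ ⊤ S.cost K := by
  have h1 : ContDiffAt ℝ ⊤ (fun K => ∑ i, inner ℝ (basis n i) (S.valueOp K (basis n i))) K := by
    refine ContDiffAt.sum fun i _ => ?_
    exact contDiffAt_const.inner ℝ ((contDiffAt_valueOp hK).clm_apply contDiffAt_const)
  refine h1.congr_of_eventuallyEq ?_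
  filter_upwards [S.isOpen_stab.mem_nhds hK] with K' hK'
  exact hS.cost_eq hK'

theorem Standing.inner_Q_nonneg (hS : S.Standing Cm) (x : State n) :
    0 ≤ inner ℝ x (opOf S.Q x) := by
  rw [inner_opOf]
  simpa using hS.Q_posSemidef.dotProduct_mulVec_nonneg x.ofLp

theorem Standing.exists_R_lower (hS : S.Standing Cm) :
    ∃ r0 : ℝ, 0 < r0 ∧ ∀ u : State m, r0 * ‖u‖ ^ 2 ≤ inner ℝ u (opOf S.R u) := by
  rcases Nat.eq_zero_or_pos m with rfl | hm
  · exact ⟨1, one_pos, fun u => by simp [Subsingleton.elim u 0]⟩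
  have : Nonempty (Fin m) := ⟨⟨0, hm⟩⟩
  have hpos : ∀ u : State m, u ≠ 0 → 0 < inner ℝ u (opOf S.R u) := by
    intro u hu
    rw [inner_opOf]
    have h0 : u.ofLp ≠ 0 := fun h => hu (by ext i; simpa using congrFun h i)
    simpa using hS.R_posDef.dotProduct_mulVec_pos h0
  obtain ⟨u0, hu0, hmin⟩ := (isCompact_sphere (0 : State m) 1).exists_isMinOn
    (NormedSpace.sphere_nonempty.2 zero_le_one)
    (f := fun u => inner ℝ u (opOf S.R u)) (by fun_prop)
  refine ⟨inner ℝ u0 (opOf S.R u0), hpos u0 (by rintro rfl; simp at hu0), fun u => ?_⟩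
  rcases eq_or_ne u 0 with rfl | hu
  · simp
  have h1 := hmin (show ‖u‖⁻¹ • u ∈ Metric.sphere (0 : State m) 1 by
    simp [norm_smul, hu])
  have h2 : 0 < ‖u‖ := norm_pos_iff.2 hu
  simp only [Set.mem_ofPred_eq, map_smul, inner_smul_left, inner_smul_right, conj_trivial] at h1
  calc _ ≤ (‖u‖⁻¹ * (‖u‖⁻¹ * inner ℝ u (opOf S.R u))) * ‖u‖ ^ 2 := by gcongr
    _ = _ := by field_simp

theorem Standing.inner_stageOp_nonneg (hS : S.Standing Cm) (K : Policy m n) (x : State n) :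
    0 ≤ inner ℝ x (S.stageOp K x) := by
  obtain ⟨r0, hr0, hR⟩ := hS.exists_R_lower
  rw [inner_stageOp]
  exact add_nonneg (hS.inner_Q_nonneg x) (le_trans (by positivity) (hR (gainL K x)))

theorem Standing.stageCost_nonneg (hS : S.Standing Cm) (K : Policy m n) (x : State n) (t : ℕ) :
    0 ≤ S.stageCost K x t := by
  rw [stageCost_eq]
  exact hS.inner_stageOp_nonneg K _

theorem Standing.costFrom_nonneg (hS : S.Standing Cm) (K : Policy m n) (x : State n) :
    0 ≤ S.costFrom K x := tsum_nonneg fun t => hS.stageCost_nonneg K x t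

theorem Standing.cost_nonneg (hS : S.Standing Cm) (K : Policy m n) : 0 ≤ S.cost K :=
  integral_nonneg fun x => hS.costFrom_nonneg K x

/-- A nonnegative quadratic form is bounded by its trace. -/
theorem inner_le_of_nonneg {P : State n →L[ℝ] State n} (hP : ∀ x, 0 ≤ inner ℝ x (P x))
    (x : State n) :
    inner ℝ x (P x) ≤ ‖x‖ ^ 2 * ∑ i, inner ℝ (basis n i) (P (basis n i)) := by
  set b : Fin n → Fin n → ℝ := fun i j => inner ℝ (basis n i) (P (basis n j)) with hb
  -- nonnegativity at `x_j e_i - x_i e_j`, summed over `i` and `j`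
  have h1 : ∀ i j, x i * x j * b i j + x j * x i * b j i ≤ x j ^ 2 * b i i + x i ^ 2 * b j j := by
    intro i j
    have := hP (x j • basis n i - x i • basis n j)
    simp only [map_sub, map_smul, inner_sub_left, inner_sub_right, inner_smul_left,
      inner_smul_right, conj_trivial] at this
    simp only [hb]
    nlinarith
  have h2 := Finset.sum_le_sum fun i (_ : i ∈ Finset.univ) =>
    Finset.sum_le_sum fun j (_ : j ∈ Finset.univ) => h1 i j
  simp only [Finset.sum_add_distrib] at h2
  rw [Finset.sum_comm (f := fun i j => x j * x i * b j i),
    Finset.sum_comm (f := fun i j => x i ^ 2 * b j j), ← sum_inner_basis] at h2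
  simp only [← Finset.sum_mul, ← EuclideanSpace.real_norm_sq_eq, ← Finset.mul_sum] at h2
  linarith

/-- The cost from `x` is a nonnegative quadratic form whose trace is the mean cost. -/
theorem Standing.costFrom_le (hS : S.Standing Cm) {K : Policy m n} (hK : K ∈ S.stab)
    (x : State n) : S.costFrom K x ≤ ‖x‖ ^ 2 * S.cost K := by
  rw [hS.cost_eq hK, costFrom_eq hK]
  exact inner_le_of_nonneg (fun y => costFrom_eq hK y ▸ hS.costFrom_nonneg K y) x

end LQR

namespace LQR

variable {m n : ℕ} {S : LQR m n} {Cm : ℝ}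

/-! ### The Frobenius norm of a policy -/

theorem norm_sq_eq_sum_gainL (K : Policy m n) :
    ‖K‖ ^ 2 = ∑ i, ‖gainL K (basis n i)‖ ^ 2 := by
  simp only [EuclideanSpace.real_norm_sq_eq, Fintype.sum_prod_type]
  rw [Finset.sum_comm]
  refine Finset.sum_congr rfl fun j _ => Finset.sum_congr rfl fun i _ => ?_
  simp [gainL_apply, Policy.mat]

theorem exists_gainL_eq (T : State n →L[ℝ] State m) : ∃ K : Policy m n, gainL K = T := by
  refine ⟨WithLp.toLp 2 fun p => T (basis n p.2) p.1, ?_⟩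
  have : (gainL (WithLp.toLp 2 fun p => T (basis n p.2) p.1)).toLinearMap = T.toLinearMap := by
    refine (EuclideanSpace.basisFun (Fin n) ℝ).toBasis.ext fun j => ?_
    ext i
    simp [gainL_apply, Policy.mat]
  exact ContinuousLinearMap.coe_injective this

theorem norm_apply_sq_le_sum {E : Type*} [NormedAddCommGroup E] [InnerProductSpace ℝ E]
    [CompleteSpace E] (T : State n →L[ℝ] E) (x : State n) :
    ‖T x‖ ^ 2 ≤ ‖x‖ ^ 2 * ∑ i, ‖T (basis n i)‖ ^ 2 := by
  have := inner_le_of_nonneg (P := T.adjoint ∘L T) (fun y => by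
    simp [ContinuousLinearMap.adjoint_inner_right]) x
  simpa [ContinuousLinearMap.adjoint_inner_right] using this

theorem norm_gainL_apply_sq_le (K : Policy m n) (x : State n) :
    ‖gainL K x‖ ^ 2 ≤ ‖K‖ ^ 2 * ‖x‖ ^ 2 := by
  rw [norm_sq_eq_sum_gainL, mul_comm]
  exact norm_apply_sq_le_sum _ x

/-! ### Cost differences and gradient dominance -/

/-- The symmetric part of an operator. -/
def symPart {E : Type*} [NormedAddCommGroup E] [InnerProductSpace ℝ E] [CompleteSpace E]
    (T : E →L[ℝ] E) : E →L[ℝ] E := (1 / 2 : ℝ) • (T + T.adjoint)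

theorem inner_symPart {E : Type*} [NormedAddCommGroup E] [InnerProductSpace ℝ E] [CompleteSpace E]
    (T : E →L[ℝ] E) (x y : E) :
    inner ℝ x (symPart T y) = 1 / 2 * (inner ℝ x (T y) + inner ℝ y (T x)) := by
  simp only [symPart, smul_apply, add_apply,
    inner_smul_right, inner_add_right, ContinuousLinearMap.adjoint_inner_right]
  rw [real_inner_comm y (T x)]

/-- The operator `E_K = R K - Bᵀ P_K (A - B K)`; the gradient of the cost is `2 E_K Σ_K`, where
`Σ_K` is the state correlation matrix. -/
def gradOp (S : LQR m n) (K : Policy m n) : State n →L[ℝ] State m :=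
  symPart (opOf S.R) ∘L gainL K - S.inputOp.adjoint ∘L symPart (S.valueOp K) ∘L S.clOp K

/-- The advantage of switching from `K` to `K'` for one step at the state `y`. -/
def advantage (S : LQR m n) (K K' : Policy m n) (y : State n) : ℝ :=
  inner ℝ y (S.stageOp K' y) + inner ℝ (S.clOp K' y) (S.valueOp K (S.clOp K' y)) -
    inner ℝ y (S.valueOp K y)

theorem inner_valueOp {K : Policy m n} (hK : K ∈ S.stab) (y : State n) :
    inner ℝ y (S.valueOp K y) =
      inner ℝ y (S.stageOp K y) + inner ℝ (S.clOp K y) (S.valueOp K (S.clOp K y)) := by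
  conv_lhs => rw [valueOp, (powDecay_of_mem_stab hK).lyap_eq]
  rw [add_apply, inner_add_right, mul_apply_eq_comp, mul_apply_eq_comp,
    ContinuousLinearMap.adjoint_inner_right]
  rfl

/-- The advantage as a quadratic function of `K' - K`. Since `gradOp` uses symmetric parts, symmetry
of the value operator is not needed. -/
theorem advantage_eq {K K' : Policy m n} (hK : K ∈ S.stab) (y : State n) :
    S.advantage K K' y =
      2 * inner ℝ (gainL (K' - K) y) (S.gradOp K y) +
      inner ℝ (gainL (K' - K) y) (opOf S.R (gainL (K' - K) y)) +
      inner ℝ (S.inputOp (gainL (K' - K) y))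
        (S.valueOp K (S.inputOp (gainL (K' - K) y))) := by
  have h1 : gainL K' y = gainL K y + gainL (K' - K) y := by
    rw [map_sub, sub_apply, add_sub_cancel]
  have h2 : S.clOp K' y = S.clOp K y - S.inputOp (gainL (K' - K) y) := by
    rw [clOp_apply, clOp_apply, h1, map_add, sub_add_eq_sub_sub]
  rw [advantage, inner_valueOp hK y, inner_stageOp, inner_stageOp, h1, h2]
  simp only [gradOp, sub_apply, ContinuousLinearMap.comp_apply,
    inner_sub_right, ContinuousLinearMap.adjoint_inner_right, inner_symPart]
  simp only [map_add, map_sub, inner_add_left, inner_add_right, inner_sub_left, inner_sub_right]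
  ring

/-- The advantages along the trajectory of `K'` telescope to the cost difference. -/
theorem hasSum_advantage {K K' : Policy m n} (hK : K ∈ S.stab) (hK' : K' ∈ S.stab) (y : State n) :
    HasSum (fun t => S.advantage K K' (S.traj K' y t)) (S.costFrom K' y - S.costFrom K y) := by
  have hs := (powDecay_of_mem_stab hK').hasSum_inner (S.valueOp K) y
  have hs1 := (hasSum_nat_add_iff' (f := fun t => inner ℝ ((S.clOp K' ^ t) y)
    (S.valueOp K ((S.clOp K' ^ t) y))) 1).2 hs
  have h := ((hasSum_stageCost hK' y).add hs1).sub hs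
  have h0 : S.costFrom K' y - S.costFrom K y =
      inner ℝ y (S.valueOp K' y) + (inner ℝ y (lyap (S.clOp K') (S.valueOp K) y) -
        ∑ t ∈ Finset.range 1, inner ℝ ((S.clOp K' ^ t) y) (S.valueOp K ((S.clOp K' ^ t) y))) -
        inner ℝ y (lyap (S.clOp K') (S.valueOp K) y) := by
    rw [Finset.sum_range_one, pow_zero, one_apply_eq_self, costFrom_eq hK, costFrom_eq hK']
    ring
  rw [h0]
  refine h.congr_fun fun t => ?_
  rw [advantage, stageCost_eq, traj_eq, pow_succ', mul_apply_eq_comp]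

theorem Standing.inner_valueOp_nonneg (hS : S.Standing Cm) {K : Policy m n} (hK : K ∈ S.stab)
    (y : State n) : 0 ≤ inner ℝ y (S.valueOp K y) :=
  costFrom_eq hK y ▸ hS.costFrom_nonneg K y

/-- The cost gap to any stabilizing policy is controlled by `‖E_K‖²`. -/
theorem Standing.cost_sub_le (hS : S.Standing Cm) {r0 : ℝ} (hr0 : 0 < r0)
    (hR : ∀ u : State m, r0 * ‖u‖ ^ 2 ≤ inner ℝ u (opOf S.R u)) {K K' E : Policy m n}
    (hK : K ∈ S.stab) (hK' : K' ∈ S.stab) (hE : gainL E = S.gradOp K) :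
    S.cost K - S.cost K' ≤
      (∑ i, inner ℝ (basis n i) (lyap (S.clOp K') 1 (basis n i))) / r0 * ‖E‖ ^ 2 := by
  have hadv : ∀ y, -(‖E‖ ^ 2 / r0 * ‖y‖ ^ 2) ≤ S.advantage K K' y := by
    intro y
    rw [advantage_eq hK, ← hE]
    set u := gainL (K' - K) y
    set v := gainL E y
    have h1 := hR u
    have h2 := hS.inner_valueOp_nonneg hK (S.inputOp u)
    have h3 : ‖v‖ ^ 2 ≤ ‖E‖ ^ 2 * ‖y‖ ^ 2 := norm_gainL_apply_sq_le E y
    have h4 : 0 ≤ ‖r0 • u + v‖ ^ 2 := by positivity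
    rw [norm_add_sq_real, norm_smul, inner_smul_left, mul_pow, Real.norm_eq_abs, sq_abs,
      conj_trivial] at h4
    have h5 : 0 ≤ r0 * ‖u‖ ^ 2 + 2 * inner ℝ u v + ‖v‖ ^ 2 / r0 := by
      have : r0 * ‖u‖ ^ 2 + 2 * inner ℝ u v + ‖v‖ ^ 2 / r0 =
          (r0 ^ 2 * ‖u‖ ^ 2 + 2 * (r0 * inner ℝ u v) + ‖v‖ ^ 2) / r0 := by field_simp
      rw [this]
      positivity
    have h6 : ‖v‖ ^ 2 / r0 ≤ ‖E‖ ^ 2 / r0 * ‖y‖ ^ 2 := by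
      rw [div_mul_eq_mul_div]
      gcongr
    linarith
  have hsum : ∀ i, S.costFrom K (basis n i) - S.costFrom K' (basis n i) ≤
      ‖E‖ ^ 2 / r0 * inner ℝ (basis n i) (lyap (S.clOp K') 1 (basis n i)) := by
    intro i
    have h1 := hasSum_advantage hK hK' (basis n i)
    have h2 := (((powDecay_of_mem_stab hK').hasSum_inner 1 (basis n i)).mul_left
      (‖E‖ ^ 2 / r0)).neg
    have := hasSum_le (fun t => ?_) h2 h1
    · linarith
    · have := hadv (S.traj K' (basis n i) t)
      simpa [traj_eq] using this
  rw [hS.cost_eq_sum hK, hS.cost_eq_sum hK', ← Finset.sum_sub_distrib]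
  refine (Finset.sum_le_sum fun i _ => hsum i).trans (le_of_eq ?_)
  rw [← Finset.mul_sum]
  ring

theorem inner_gradient (f : Policy m n → ℝ) (K V : Policy m n) :
    inner ℝ (gradient f K) V = fderiv ℝ f K V := by
  rw [gradient, InnerProductSpace.toDual_symm_apply]

/-- The derivative of the cost in the direction `E_K` is at least `2 ‖E_K‖²`. -/
theorem Standing.two_mul_norm_le_norm_gradient (hS : S.Standing Cm) {K E : Policy m n}
    (hK : K ∈ S.stab) (hE : gainL E = S.gradOp K) : 2 * ‖E‖ ≤ ‖gradient S.cost K‖ := by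
  obtain ⟨r0, hr0, hR⟩ := hS.exists_R_lower
  have hadv : ∀ τ : ℝ, 0 < τ → ∀ y, 2 * τ * ‖gainL E y‖ ^ 2 ≤ S.advantage K (K + τ • E) y := by
    intro τ hτ y
    rw [advantage_eq hK, ← hE, add_sub_cancel_left, map_smul, smul_apply,
      inner_smul_left, real_inner_self_eq_norm_sq, conj_trivial]
    have h1 := hR (τ • gainL E y)
    have h2 := hS.inner_valueOp_nonneg hK (S.inputOp (τ • gainL E y))
    have h3 : 0 ≤ r0 * ‖τ • gainL E y‖ ^ 2 := by positivity
    linarith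
  have hgrow : ∀ τ : ℝ, 0 < τ → K + τ • E ∈ S.stab →
      S.cost K + 2 * τ * ‖E‖ ^ 2 ≤ S.cost (K + τ • E) := by
    intro τ hτ hst
    rw [hS.cost_eq_sum hK, hS.cost_eq_sum hst, norm_sq_eq_sum_gainL, Finset.mul_sum,
      ← Finset.sum_add_distrib]
    refine Finset.sum_le_sum fun i _ => ?_
    have h1 := hasSum_advantage hK hst (basis n i)
    have h2 := h1.summable.le_tsum 0 fun t _ =>
      (hadv τ hτ (S.traj (K + τ • E) (basis n i) t)).trans' (by positivity)
    rw [h1.tsum_eq] at h2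
    have h3 := hadv τ hτ (S.traj (K + τ • E) (basis n i) 0)
    have h4 : S.traj (K + τ • E) (basis n i) 0 = basis n i := rfl
    rw [h4] at h2 h3
    linarith
  have hd : HasDerivAt (fun τ : ℝ => S.cost (K + τ • E)) (inner ℝ (gradient S.cost K) E) 0 := by
    have h1 : HasFDerivAt S.cost (fderiv ℝ S.cost K) (K + (0 : ℝ) • E) := by
      rw [zero_smul, add_zero]
      exact ((hS.contDiffAt_cost hK).differentiableAt (by simp)).hasFDerivAt
    have h2 : HasDerivAt (fun τ : ℝ => K + τ • E) E 0 := by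
      simpa using ((hasDerivAt_id (0 : ℝ)).smul_const E).const_add K
    rw [inner_gradient]
    exact h1.comp_hasDerivAt (0 : ℝ) h2
  have hslope := (hasDerivAt_iff_tendsto_slope_zero.1 hd).mono_left
    (nhdsWithin_mono (0 : ℝ) (fun x (hx : 0 < x) => hx.ne') : 𝓝[>] (0 : ℝ) ≤ 𝓝[≠] 0)
  have hev : ∀ᶠ τ : ℝ in 𝓝[>] 0, K + τ • E ∈ S.stab := by
    refine nhdsWithin_le_nhds ?_
    have hc : ContinuousAt (fun τ : ℝ => K + τ • E) 0 := by fun_prop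
    exact hc.eventually_mem (S.isOpen_stab.mem_nhds (by simpa using hK))
  have hle : 2 * ‖E‖ ^ 2 ≤ inner ℝ (gradient S.cost K) E := by
    refine ge_of_tendsto hslope ?_
    filter_upwards [hev, self_mem_nhdsWithin] with τ hτ hτ0
    have hτ0 : 0 < τ := hτ0
    have := hgrow τ hτ0 hτ
    simp only [zero_add, zero_smul, add_zero, smul_eq_mul]
    rw [inv_mul_eq_div, le_div_iff₀ hτ0]
    linarith
  rcases (norm_nonneg E).eq_or_lt with h0 | h0
  · rw [← h0]; simp
  · have := hle.trans (real_inner_le_norm _ _)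
    nlinarith

/-- Gradient dominance of the LQR cost. -/
theorem Standing.exists_pl (hS : S.Standing Cm) (hn : 0 < n) {K' : Policy m n}
    (hK' : K' ∈ S.stab) :
    ∃ μ : ℝ, 0 < μ ∧ ∀ K ∈ S.stab, μ * (S.cost K - S.cost K') ≤ ‖gradient S.cost K‖ ^ 2 := by
  obtain ⟨r0, hr0, hR⟩ := hS.exists_R_lower
  set s := ∑ i, inner ℝ (basis n i) (lyap (S.clOp K') 1 (basis n i)) with hs
  have hs0 : 0 < s := by
    have : Nonempty (Fin n) := ⟨⟨0, hn⟩⟩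
    refine Finset.sum_pos (fun i _ => ?_) Finset.univ_nonempty
    have h1 := (powDecay_of_mem_stab hK').hasSum_inner 1 (basis n i)
    have h2 := h1.summable.le_tsum 0 fun t _ => by
      simp
    rw [h1.tsum_eq] at h2
    refine lt_of_lt_of_le ?_ h2
    simp
  refine ⟨4 * r0 / s, by positivity, fun K hK => ?_⟩
  obtain ⟨E, hE⟩ := exists_gainL_eq (S.gradOp K)
  have h1 := hS.cost_sub_le hr0 hR hK hK' hE
  have h2 := hS.two_mul_norm_le_norm_gradient hK hE
  rw [← hs] at h1
  calc 4 * r0 / s * (S.cost K - S.cost K') ≤ 4 * r0 / s * (s / r0 * ‖E‖ ^ 2) := by gcongr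
    _ = (2 * ‖E‖) ^ 2 := by field_simp; ring
    _ ≤ _ := by gcongr

end LQR

namespace LQR

variable {m n : ℕ} {S : LQR m n} {Cm : ℝ}

/-! ### Compactness of sublevel sets and existence of the optimal policy -/

theorem inner_lyap_one {T : State n →L[ℝ] State n} (hT : PowDecay T) (y : State n) :
    inner ℝ y (lyap T 1 y) = ‖y‖ ^ 2 + inner ℝ (T y) (lyap T 1 (T y)) := by
  conv_lhs => rw [hT.lyap_eq]
  rw [add_apply, inner_add_right, mul_apply_eq_comp, mul_apply_eq_comp,
    ContinuousLinearMap.adjoint_inner_right, one_apply_eq_self, real_inner_self_eq_norm_sq]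

theorem inner_lyap_one_nonneg {T : State n →L[ℝ] State n} (hT : PowDecay T) (y : State n) :
    0 ≤ inner ℝ y (lyap T 1 y) :=
  (hT.hasSum_inner 1 y).nonneg fun t => by
    rw [one_apply_eq_self]; exact real_inner_self_nonneg

/-- Detectability: the energy of a trajectory is controlled by its cost, uniformly in the policy
and the horizon. The Lyapunov function of the observer `A - L H` is decreasing along the closed
loop up to the cost. -/
theorem Standing.exists_energy_le (hS : S.Standing Cm) :
    ∃ a b : ℝ, 0 ≤ a ∧ 0 ≤ b ∧ ∀ (K : Policy m n) (y : State n) (N : ℕ),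
      ∑ t ∈ Finset.range N, ‖S.traj K y t‖ ^ 2 ≤
        a * ‖y‖ ^ 2 + b * ∑ t ∈ Finset.range N, S.stageCost K y t := by
  obtain ⟨r0, hr0, hR⟩ := hS.exists_R_lower
  obtain ⟨H, hH, hHQ, L, hL⟩ := hS.detectable
  have hT : PowDecay (opOf (S.A - L * H)) := SchurStable.exists_norm_opOf_pow_le hL
  set T := opOf (S.A - L * H) with hTdef
  set X := lyap T 1
  have hQ : ∀ x, inner ℝ x (opOf S.Q x) = ‖opOf H x‖ ^ 2 := by
    intro x
    have h1 : (opOf H).adjoint = opOf H := by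
      rw [← ContinuousLinearMap.star_eq_adjoint]
      change star (Matrix.toEuclideanCLM (n := Fin n) (𝕜 := ℝ) H) = _
      rw [← map_star]
      congr 1
      exact hH.isHermitian
    have h2 : opOf S.Q = opOf H * opOf H := by rw [← hHQ]; exact map_mul _ H H
    rw [h2, mul_apply_eq_comp]
    conv_lhs => rw [← h1, ContinuousLinearMap.adjoint_inner_right, h1]
    exact real_inner_self_eq_norm_sq _
  have hstep : ∀ (K : Policy m n) (y : State n),
      S.clOp K y = T y + (opOf L (opOf H y) - S.inputOp (gainL K y)) := by
    intro K y
    have : T = opOf S.A - opOf L * opOf H := by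
      rw [hTdef]
      exact (map_sub _ _ _).trans (congrArg _ (map_mul _ L H))
    rw [clOp_apply, this, sub_apply, mul_apply_eq_comp]
    abel
  set c := 2 * (‖T‖ * ‖X‖) ^ 2 + ‖X‖
  set c' := 2 * ‖opOf L‖ ^ 2 + 2 * ‖S.inputOp‖ ^ 2 / r0
  have hc : 0 ≤ c := by positivity
  have hc' : 0 ≤ c' := by positivity
  have hone : ∀ (K : Policy m n) (y : State n), 1 / 2 * ‖y‖ ^ 2 ≤
      inner ℝ y (X y) - inner ℝ (S.clOp K y) (X (S.clOp K y)) +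
        c * c' * inner ℝ y (S.stageOp K y) := by
    intro K y
    set w := opOf L (opOf H y) - S.inputOp (gainL K y) with hw
    have h1 : inner ℝ (S.clOp K y) (X (S.clOp K y)) ≤
        inner ℝ (T y) (X (T y)) + 2 * (‖T‖ * ‖X‖) * ‖y‖ * ‖w‖ + ‖X‖ * ‖w‖ ^ 2 := by
      rw [hstep]
      simp only [map_add, inner_add_left, inner_add_right]
      have e1 : inner ℝ (T y) (X w) ≤ (‖T‖ * ‖y‖) * (‖X‖ * ‖w‖) :=
        (real_inner_le_norm _ _).trans (mul_le_mul (T.le_opNorm y) (X.le_opNorm w)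
          (norm_nonneg _) (by positivity))
      have e2 : inner ℝ w (X (T y)) ≤ ‖w‖ * (‖X‖ * (‖T‖ * ‖y‖)) :=
        (real_inner_le_norm _ _).trans (by
          gcongr
          exact (X.le_opNorm _).trans (by gcongr; exact T.le_opNorm y))
      have e3 : inner ℝ w (X w) ≤ ‖w‖ * (‖X‖ * ‖w‖) :=
        (real_inner_le_norm _ _).trans (by gcongr; exact X.le_opNorm w)
      linarith
    have h2 : ‖w‖ ^ 2 ≤ c' * inner ℝ y (S.stageOp K y) := by
      have e1 : ‖w‖ ≤ ‖opOf L‖ * ‖opOf H y‖ + ‖S.inputOp‖ * ‖gainL K y‖ :=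
        (norm_sub_le _ _).trans (add_le_add ((opOf L).le_opNorm _) (S.inputOp.le_opNorm _))
      have e2 : ‖w‖ ^ 2 ≤ 2 * (‖opOf L‖ * ‖opOf H y‖) ^ 2 +
          2 * (‖S.inputOp‖ * ‖gainL K y‖) ^ 2 := by
        nlinarith [norm_nonneg w, sq_nonneg (‖opOf L‖ * ‖opOf H y‖ - ‖S.inputOp‖ * ‖gainL K y‖)]
      have e3 := hR (gainL K y)
      have e4 : ‖gainL K y‖ ^ 2 ≤ inner ℝ (gainL K y) (opOf S.R (gainL K y)) / r0 := by
        rw [le_div_iff₀ hr0]; linarith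
      rw [inner_stageOp, hQ]
      have e5 : 0 ≤ inner ℝ (gainL K y) (opOf S.R (gainL K y)) := le_trans (by positivity) e3
      have e6 : ‖S.inputOp‖ ^ 2 * ‖gainL K y‖ ^ 2 ≤
          ‖S.inputOp‖ ^ 2 * (inner ℝ (gainL K y) (opOf S.R (gainL K y)) / r0) := by gcongr
      have e7 : 0 ≤ 2 * ‖opOf L‖ ^ 2 * inner ℝ (gainL K y) (opOf S.R (gainL K y)) := by positivity
      have e8 : 0 ≤ 2 * ‖S.inputOp‖ ^ 2 / r0 * ‖opOf H y‖ ^ 2 := by positivity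
      have e9 : c' * (‖opOf H y‖ ^ 2 + inner ℝ (gainL K y) (opOf S.R (gainL K y))) =
          2 * ‖opOf L‖ ^ 2 * ‖opOf H y‖ ^ 2 +
          2 * (‖S.inputOp‖ ^ 2 * (inner ℝ (gainL K y) (opOf S.R (gainL K y)) / r0)) +
          2 * ‖opOf L‖ ^ 2 * inner ℝ (gainL K y) (opOf S.R (gainL K y)) +
          2 * ‖S.inputOp‖ ^ 2 / r0 * ‖opOf H y‖ ^ 2 := by
        simp only [c']; ring
      rw [mul_pow, mul_pow] at e2
      linarith
    have h3 := inner_lyap_one hT y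
    have h4 : 2 * (‖T‖ * ‖X‖) * ‖y‖ * ‖w‖ ≤ 1 / 2 * ‖y‖ ^ 2 + 2 * (‖T‖ * ‖X‖) ^ 2 * ‖w‖ ^ 2 := by
      nlinarith [sq_nonneg (‖y‖ - 2 * (‖T‖ * ‖X‖) * ‖w‖)]
    have h5 : c * ‖w‖ ^ 2 ≤ c * (c' * inner ℝ y (S.stageOp K y)) := by gcongr
    have h6 : c * ‖w‖ ^ 2 = 2 * (‖T‖ * ‖X‖) ^ 2 * ‖w‖ ^ 2 + ‖X‖ * ‖w‖ ^ 2 := by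
      simp only [c]; ring
    linarith
  refine ⟨2 * ‖X‖, 2 * (c * c'), by positivity, by positivity, fun K y N => ?_⟩
  have hsum : ∀ N, 1 / 2 * ∑ t ∈ Finset.range N, ‖S.traj K y t‖ ^ 2 ≤
      inner ℝ y (X y) - inner ℝ (S.traj K y N) (X (S.traj K y N)) +
        c * c' * ∑ t ∈ Finset.range N, S.stageCost K y t := by
    intro N
    induction N with
    | zero => simp [traj]
    | succ N ih =>
      have h1 := hone K (S.traj K y N)
      have h2 : S.clOp K (S.traj K y N) = S.traj K y (N + 1) := by
        rw [traj_eq, traj_eq, pow_succ', mul_apply_eq_comp]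
      rw [h2, ← stageCost_eq] at h1
      rw [Finset.sum_range_succ, Finset.sum_range_succ]
      linarith
  have h1 := hsum N
  have h2 : 0 ≤ inner ℝ (S.traj K y N) (X (S.traj K y N)) := inner_lyap_one_nonneg hT _
  have h3 : inner ℝ y (X y) ≤ ‖X‖ * ‖y‖ ^ 2 :=
    (real_inner_le_norm _ _).trans (by
      have := X.le_opNorm y
      nlinarith [norm_nonneg y])
  linarith

theorem continuous_traj (x : State n) (t : ℕ) : Continuous fun K => S.traj K x t := by
  simp_rw [traj_eq]
  exact (S.continuous_clOp.pow t).clm_apply continuous_const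

theorem continuous_stageCost (x : State n) (t : ℕ) : Continuous fun K => S.stageCost K x t := by
  simp_rw [stageCost_eq]
  exact (continuous_traj x t).inner ((S.contDiff_stageOp.continuous).clm_apply (continuous_traj x t))

/-- The total finite-horizon cost from the basis vectors. -/
def basisCost (S : LQR m n) (K : Policy m n) (N : ℕ) : ℝ :=
  ∑ i, ∑ t ∈ Finset.range N, S.stageCost K (basis n i) t

/-- By detectability, bounded costs from a basis force the powers of the closed-loop operator to
tend to zero, so the policy is stabilizing. -/
theorem Standing.mem_stab_of_basisCost_le (hS : S.Standing Cm) {K : Policy m n} {C : ℝ}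
    (h : ∀ N, S.basisCost K N ≤ C) : K ∈ S.stab := by
  obtain ⟨a, b, ha, hb, hab⟩ := hS.exists_energy_le
  have hi : ∀ i N, ∑ t ∈ Finset.range N, S.stageCost K (basis n i) t ≤ C := fun i N =>
    (Finset.single_le_sum (f := fun i => ∑ t ∈ Finset.range N, S.stageCost K (basis n i) t)
      (fun i _ => Finset.sum_nonneg fun t _ => hS.stageCost_nonneg K _ t)
      (Finset.mem_univ i)).trans (h N)
  have hto : ∀ i, Tendsto (fun t => ‖S.traj K (basis n i) t‖ ^ 2) atTop (𝓝 0) := by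
    intro i
    refine (summable_of_sum_range_le (c := a * ‖basis n i‖ ^ 2 + b * C)
      (fun t => by positivity) fun N => (hab K _ N).trans ?_).tendsto_atTop_zero
    gcongr
    exact hi i N
  have hto2 : Tendsto (fun t => ∑ i, ‖S.traj K (basis n i) t‖ ^ 2) atTop (𝓝 0) := by
    simpa using tendsto_finsetSum Finset.univ fun i _ => hto i
  obtain ⟨t, ht⟩ := ((hto2.comp (tendsto_add_atTop_nat 1)).eventually_lt_const one_pos).exists
  refine mem_stab_of_norm_pow_lt_one (k := t) ?_
  set s := ∑ i, ‖S.traj K (basis n i) (t + 1)‖ ^ 2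
  have hs : s < 1 := ht
  have hs0 : 0 ≤ s := by positivity
  have h1 : ‖S.clOp K ^ (t + 1)‖ ≤ √s := by
    refine ContinuousLinearMap.opNorm_le_bound _ (Real.sqrt_nonneg _) fun x => ?_
    refine le_of_sq_le_sq ?_ (by positivity)
    have := norm_apply_sq_le_sum (S.clOp K ^ (t + 1)) x
    simp_rw [← traj_eq] at this ⊢
    rw [mul_pow, Real.sq_sqrt hs0, mul_comm]
    exact this
  exact h1.trans_lt (by rw [Real.sqrt_lt' one_pos]; simpa using hs)

theorem Standing.basisCost_le_cost (hS : S.Standing Cm) {K : Policy m n} (hK : K ∈ S.stab)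
    (N : ℕ) : S.basisCost K N ≤ S.cost K := by
  rw [hS.cost_eq_sum hK, basisCost]
  refine Finset.sum_le_sum fun i _ => ?_
  exact (hasSum_stageCost hK _).summable.sum_le_tsum _ fun t _ => hS.stageCost_nonneg K _ t

theorem Standing.cost_le_of_basisCost_le (hS : S.Standing Cm) {K : Policy m n} (hK : K ∈ S.stab)
    {C : ℝ} (h : ∀ N, S.basisCost K N ≤ C) : S.cost K ≤ C := by
  have h1 : Tendsto (S.basisCost K) atTop (𝓝 (S.cost K)) := by
    rw [hS.cost_eq_sum hK]
    refine tendsto_finsetSum _ fun i _ => ?_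
    rw [costFrom_eq hK]
    exact (hasSum_stageCost hK _).tendsto_sum_nat
  exact le_of_tendsto' h1 h

/-- Sublevel sets of the cost among the stabilizing policies are compact. -/
theorem Standing.isCompact_sublevel (hS : S.Standing Cm) (C : ℝ) :
    IsCompact {K | K ∈ S.stab ∧ S.cost K ≤ C} := by
  have heq : {K | K ∈ S.stab ∧ S.cost K ≤ C} = ⋂ N, {K | S.basisCost K N ≤ C} := by
    ext K
    simp only [Set.mem_ofPred_eq, Set.mem_iInter]
    exact ⟨fun h N => (hS.basisCost_le_cost h.1 N).trans h.2, fun h =>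
      ⟨hS.mem_stab_of_basisCost_le h, hS.cost_le_of_basisCost_le (hS.mem_stab_of_basisCost_le h) h⟩⟩
  rw [heq]
  refine Metric.isCompact_of_isClosed_isBounded (isClosed_iInter fun N => ?_) ?_
  · refine isClosed_le ?_ continuous_const
    unfold basisCost
    exact continuous_finsetSum _ fun i _ => continuous_finsetSum _ fun t _ =>
      continuous_stageCost _ t
  · obtain ⟨r0, hr0, hR⟩ := hS.exists_R_lower
    refine (Metric.isBounded_closedBall (x := (0 : Policy m n)) (r := √(C / r0))).subset ?_
    intro K hK
    have h1 : S.basisCost K 1 ≤ C := Set.mem_iInter.1 hK 1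
    have h2 : r0 * ‖K‖ ^ 2 ≤ S.basisCost K 1 := by
      rw [norm_sq_eq_sum_gainL, Finset.mul_sum, basisCost]
      refine Finset.sum_le_sum fun i _ => ?_
      rw [Finset.sum_range_one, stageCost_eq, inner_stageOp]
      exact (hR _).trans (le_add_of_nonneg_left (hS.inner_Q_nonneg _))
    rw [mem_closedBall_zero_iff]
    refine Real.le_sqrt_of_sq_le ?_
    rw [le_div_iff₀ hr0]
    linarith

theorem Standing.exists_isOptimal (hS : S.Standing Cm) : ∃ Kstar, S.IsOptimal Kstar := by
  obtain ⟨F, hF⟩ := hS.stabilizable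
  have hK1 : (WithLp.toLp 2 fun p => F p.1 p.2 : Policy m n) ∈ S.stab := hF
  set K1 : Policy m n := WithLp.toLp 2 fun p => F p.1 p.2
  obtain ⟨Ks, hKs, hmin⟩ := (hS.isCompact_sublevel (S.cost K1)).exists_isMinOn ⟨K1, hK1, le_rfl⟩
    (f := S.cost) fun K hK => (hS.contDiffAt_cost hK.1).continuousAt.continuousWithinAt
  refine ⟨Ks, hKs.1, fun K hK => ?_⟩
  rcases le_total (S.cost K) (S.cost K1) with h | h
  · exact hmin ⟨hK, h⟩
  · exact hKs.2.trans h

end LQR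

/-! ### Admissible constants and uniform decay -/

namespace LQR

variable {m n : ℕ} {S : LQR m n} {Cm : ℝ} {Kstar K0 : Policy m n}

theorem Standing.isCompact_sublevel' (hS : S.Standing Cm) :
    IsCompact (S.sublevel Kstar K0) := by
  have := hS.isCompact_sublevel (10 * S.gap Kstar K0 + S.cost Kstar)
  simp only [← sub_le_iff_le_add] at this
  exact this

theorem IsOptimal.gap_nonneg (hopt : S.IsOptimal Kstar) (hK0 : K0 ∈ S.stab) :
    0 ≤ S.gap Kstar K0 := sub_nonneg.2 (hopt.2 K0 hK0)

theorem IsOptimal.mem_sublevel (hopt : S.IsOptimal Kstar) (hK0 : K0 ∈ S.stab) :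
    K0 ∈ S.sublevel Kstar K0 := by
  have := hopt.gap_nonneg hK0
  exact ⟨hK0, by change S.gap Kstar K0 ≤ _; linarith⟩

theorem Standing.contDiffAt_gradient (hS : S.Standing Cm) {K : Policy m n} (hK : K ∈ S.stab) :
    ContDiffAt ℝ 1 (gradient S.cost) K := by
  have h1 : ContDiffAt ℝ 1 (fderiv ℝ S.cost) K :=
    (hS.contDiffAt_cost hK).fderiv_right (by exact le_top)
  exact (InnerProductSpace.toDual ℝ (Policy m n)).symm.toContinuousLinearEquiv.contDiff.contDiffAt.comp
    K h1

/-- A function that is `C¹` near a compact set has bounded derivative there. -/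
theorem exists_norm_fderiv_le {F : Type*} [NormedAddCommGroup F] [NormedSpace ℝ F]
    {f : Policy m n → F} {T : Set (Policy m n)} (hT : IsCompact T)
    (hf : ∀ K ∈ T, ContDiffAt ℝ 1 f K) : ∃ C, 0 ≤ C ∧ ∀ K ∈ T, ‖fderiv ℝ f K‖ ≤ C := by
  obtain ⟨C, hC⟩ := hT.exists_bound_of_continuousOn (f := fderiv ℝ f) fun K hK =>
    ((hf K hK).fderiv_right (m := 0) (by simp)).continuousAt.continuousWithinAt
  exact ⟨max C 0, le_max_right _ _, fun K hK => (hC K hK).trans (le_max_left _ _)⟩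

/-- Admissible constants exist: by compactness, derivatives of the costs and of the gradient are
bounded on a closed neighborhood of the sublevel set that consists of stabilizing policies, so all
the local constants can be chosen independent of the policy. -/
theorem Standing.exists_admissible (hS : S.Standing Cm) (hn : 0 < n) (hopt : S.IsOptimal Kstar)
    (hK0 : K0 ∈ S.stab) : ∃ c : LocalConstants m n, c.Admissible S Kstar K0 := by
  set G := S.sublevel Kstar K0
  have hG : IsCompact G := hS.isCompact_sublevel'
  obtain ⟨ρ, hρ, hρG⟩ := hG.exists_cthickening_subset_open S.isOpen_stab fun K hK => hK.1
  set T := Metric.cthickening ρ G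
  have hT : IsCompact T := hG.cthickening
  have hball : ∀ K ∈ G, Metric.closedBall K ρ ⊆ T := fun K hK =>
    Metric.closedBall_subset_cthickening hK ρ
  obtain ⟨l1, hl1, h1⟩ := exists_norm_fderiv_le hT fun K hK =>
    (hS.contDiffAt_cost (hρG hK)).of_le le_top
  obtain ⟨l2, hl2, h2⟩ := exists_norm_fderiv_le hT fun K hK => hS.contDiffAt_gradient (hρG hK)
  obtain ⟨l3, hl3, h3⟩ := exists_norm_fderiv_le hT fun K hK =>
    (contDiffAt_valueOp (hρG hK)).of_le le_top
  obtain ⟨μ, hμ, hpl⟩ := hS.exists_pl hn hopt.1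
  have hlip : ∀ {F : Type} [NormedAddCommGroup F] [NormedSpace ℝ F] (f : Policy m n → F) (l : ℝ),
      (∀ K ∈ T, ‖fderiv ℝ f K‖ ≤ l) → (∀ K ∈ T, ContDiffAt ℝ 1 f K) → ∀ K ∈ G, ∀ K' K'',
      ‖K' - K‖ ≤ ρ → ‖K'' - K‖ ≤ ρ → ‖f K' - f K''‖ ≤ l * ‖K' - K''‖ := by
    intro F _ _ f l hl hf K hK K' K'' hK' hK''
    exact (convex_closedBall K ρ).norm_image_sub_le_of_norm_fderiv_le
      (fun x hx => (hf x (hball K hK hx)).differentiableAt (by simp))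
      (fun x hx => hl x (hball K hK hx)) (mem_closedBall_iff_norm.2 hK'')
      (mem_closedBall_iff_norm.2 hK')
  have hst : ∀ K ∈ G, ∀ K', ‖K' - K‖ ≤ ρ → K' ∈ S.stab := fun K hK K' hK' =>
    hρG (hball K hK (mem_closedBall_iff_norm.2 hK'))
  have hself : ∀ K : Policy m n, ‖K - K‖ ≤ ρ := fun K => by simpa using hρ.le
  have hCm := hS.Cm_pos
  refine ⟨⟨fun _ => l1 + 1, fun _ => Cm * l3 + 1, fun _ => ρ, fun _ => l2 + 1, fun _ => ρ, μ⟩,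
    fun _ _ => by positivity, fun _ _ => by positivity, fun _ _ => hρ, fun _ _ => by positivity,
    fun _ _ => hρ, hμ, fun K hK K' hK' => ⟨hst K hK K' hK', ?_⟩, fun K hK => ?_,
    fun K hK K' hK' => ⟨hst K hK K' hK', ?_⟩, hpl, ?_, ?_, ?_, ?_⟩
  · have := hlip S.cost l1 h1 (fun K hK => (hS.contDiffAt_cost (hρG hK)).of_le le_top)
      K hK K' K hK' (hself K)
    rw [Real.norm_eq_abs] at this
    exact this.trans (by gcongr; linarith)
  · filter_upwards [hS.bounded] with x hx K' K'' hK' hK''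
    have := hlip S.valueOp l3 h3 (fun K hK => (contDiffAt_valueOp (hρG hK)).of_le le_top)
      K hK K' K'' hK' hK''
    rw [costFrom_eq (hst K hK K' hK'), costFrom_eq (hst K hK K'' hK''), ← inner_sub_right,
      ← sub_apply]
    calc |inner ℝ x ((S.valueOp K' - S.valueOp K'') x)|
        ≤ ‖x‖ * ((l3 * ‖K' - K''‖) * ‖x‖) := by
          refine (abs_real_inner_le_norm _ _).trans ?_
          gcongr
          exact (ContinuousLinearMap.le_opNorm _ _).trans (by gcongr)
      _ = ‖x‖ ^ 2 * l3 * ‖K' - K''‖ := by ring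
      _ ≤ (Cm * l3 + 1) * ‖K' - K''‖ := by
          gcongr
          have : ‖x‖ ^ 2 * l3 ≤ Cm * l3 := by gcongr
          linarith
  · have := hlip (gradient S.cost) l2 h2 (fun K hK => hS.contDiffAt_gradient (hρG hK))
      K hK K' K hK' (hself K)
    exact this.trans (by gcongr; linarith)
  · exact ⟨l1 + 1, by rintro _ ⟨K, -, rfl⟩; exact le_rfl⟩
  · exact ⟨Cm * l3 + 1, by rintro _ ⟨K, -, rfl⟩; exact le_rfl⟩
  · exact ⟨l2 + 1, by rintro _ ⟨K, -, rfl⟩; exact le_rfl⟩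
  · have : (fun _ : Policy m n => min ρ ρ) '' S.sublevel Kstar K0 = {ρ} := by
      rw [min_self, Set.Nonempty.image_const ⟨K0, hopt.mem_sublevel hK0⟩]
    simp only [LocalConstants.rho0]
    rw [this, csInf_singleton]
    exact hρ

end LQR

namespace LocalConstants.Admissible

open LQR

variable {m n : ℕ} {S : LQR m n} {Cm : ℝ} {Kstar K0 K : Policy m n} {c : LocalConstants m n}

theorem rho0_le (hc : c.Admissible S Kstar K0) (hK : K ∈ S.sublevel Kstar K0) :
    c.rho0 (S.sublevel Kstar K0) ≤ min (c.beta K) (c.zeta K) := by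
  refine csInf_le ⟨0, ?_⟩ ⟨K, hK, rfl⟩
  rintro _ ⟨K', hK', rfl⟩
  exact le_min (hc.beta_pos K' hK').le (hc.zeta_pos K' hK').le

theorem lam_le (hc : c.Admissible S Kstar K0) (hK : K ∈ S.sublevel Kstar K0) :
    c.lam K ≤ c.lam0 (S.sublevel Kstar K0) := le_csSup hc.lam_bdd ⟨K, hK, rfl⟩

theorem lamT_le (hc : c.Admissible S Kstar K0) (hK : K ∈ S.sublevel Kstar K0) :
    c.lamT K ≤ c.lamT0 (S.sublevel Kstar K0) := le_csSup hc.lamT_bdd ⟨K, hK, rfl⟩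

theorem phi_le (hc : c.Admissible S Kstar K0) (hK : K ∈ S.sublevel Kstar K0) :
    c.phi K ≤ c.phi0 (S.sublevel Kstar K0) := le_csSup hc.phi_bdd ⟨K, hK, rfl⟩

theorem mem_stab (hc : c.Admissible S Kstar K0) (hK : K ∈ S.sublevel Kstar K0) {K' : Policy m n}
    (h : ‖K' - K‖ ≤ c.rho0 (S.sublevel Kstar K0)) : K' ∈ S.stab :=
  (hc.cost_lip K hK K' (h.trans ((hc.rho0_le hK).trans (min_le_right _ _)))).1

theorem cost_lip' (hc : c.Admissible S Kstar K0) (hK : K ∈ S.sublevel Kstar K0) {K' : Policy m n}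
    (h : ‖K' - K‖ ≤ c.rho0 (S.sublevel Kstar K0)) :
    |S.cost K' - S.cost K| ≤ c.lam0 (S.sublevel Kstar K0) * ‖K' - K‖ :=
  (hc.cost_lip K hK K' (h.trans ((hc.rho0_le hK).trans (min_le_right _ _)))).2.trans
    (by gcongr; exact hc.lam_le hK)

theorem grad_lip' (hc : c.Admissible S Kstar K0) (hK : K ∈ S.sublevel Kstar K0) {K' : Policy m n}
    (h : ‖K' - K‖ ≤ c.rho0 (S.sublevel Kstar K0)) :
    ‖gradient S.cost K' - gradient S.cost K‖ ≤ c.phi0 (S.sublevel Kstar K0) * ‖K' - K‖ :=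
  (hc.grad_lip K hK K' (h.trans ((hc.rho0_le hK).trans (min_le_left _ _)))).2.trans
    (by gcongr; exact hc.phi_le hK)

theorem costFrom_lip' (hc : c.Admissible S Kstar K0) (hK : K ∈ S.sublevel Kstar K0) :
    ∀ᵐ x ∂S.D, ∀ K' K'', ‖K' - K‖ ≤ c.rho0 (S.sublevel Kstar K0) →
      ‖K'' - K‖ ≤ c.rho0 (S.sublevel Kstar K0) →
      |S.costFrom K' x - S.costFrom K'' x| ≤ c.lamT0 (S.sublevel Kstar K0) * ‖K' - K''‖ := by
  filter_upwards [hc.costFrom_lip K hK] with x hx K' K'' h h'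
  have h0 := (hc.rho0_le hK).trans (min_le_right _ _)
  exact (hx K' K'' (h.trans h0) (h'.trans h0)).trans (by gcongr; exact hc.lamT_le hK)

theorem lam0_pos (hc : c.Admissible S Kstar K0) (hK : K ∈ S.sublevel Kstar K0) :
    0 < c.lam0 (S.sublevel Kstar K0) := (hc.lam_pos K hK).trans_le (hc.lam_le hK)

theorem lamT0_pos (hc : c.Admissible S Kstar K0) (hK : K ∈ S.sublevel Kstar K0) :
    0 < c.lamT0 (S.sublevel Kstar K0) := (hc.lamT_pos K hK).trans_le (hc.lamT_le hK)

theorem phi0_pos (hc : c.Admissible S Kstar K0) (hK : K ∈ S.sublevel Kstar K0) :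
    0 < c.phi0 (S.sublevel Kstar K0) := (hc.phi_pos K hK).trans_le (hc.phi_le hK)

theorem theta0_pos (hc : c.Admissible S Kstar K0) (hK : K ∈ S.sublevel Kstar K0) :
    0 < c.theta0 (S.sublevel Kstar K0) := by
  have := hc.phi0_pos hK
  have := hc.lam0_pos hK
  have := hc.rho0_pos
  exact lt_min (by positivity) (by positivity)

theorem rolloutSet_subset (hc : c.Admissible S Kstar K0) {r : ℝ}
    (hr : r ≤ c.rho0 (S.sublevel Kstar K0)) : S.rolloutSet Kstar K0 r ⊆ S.stab := by
  rintro K' ⟨K, hK, h⟩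
  exact hc.mem_stab hK (h.trans hr)

end LocalConstants.Admissible

namespace LQR

variable {m n : ℕ} {S : LQR m n} {Cm : ℝ} {Kstar K0 : Policy m n}

open scoped Pointwise in
theorem Standing.isCompact_rolloutSet (hS : S.Standing Cm) (r : ℝ) :
    IsCompact (S.rolloutSet Kstar K0 r) := by
  have h : S.rolloutSet Kstar K0 r = S.sublevel Kstar K0 + Metric.closedBall (0 : Policy m n) r := by
    ext K'
    simp only [rolloutSet, Set.mem_ofPred_eq, Set.mem_add, mem_closedBall_zero_iff]
    constructor
    · rintro ⟨K, hK, h⟩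
      exact ⟨K, hK, K' - K, h, by abel⟩
    · rintro ⟨K, hK, D, hD, rfl⟩
      exact ⟨K, hK, by simpa using hD⟩
  rw [h]
  exact hS.isCompact_sublevel'.add (isCompact_closedBall _ _)

/-- A uniform decay rate, from the Lyapunov functions with right-hand side `I`, which are uniformly
bounded on the compact set of rolled-out policies. -/
theorem Standing.exists_decayConstants (hS : S.Standing Cm) {c : LocalConstants m n}
    (hc : c.Admissible S Kstar K0) {r : ℝ} (hr : r ≤ c.rho0 (S.sublevel Kstar K0)) :
    ∃ M γ : ℝ, S.DecayConstants Kstar K0 r M γ := by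
  have hst := hc.rolloutSet_subset hr
  obtain ⟨C, hC⟩ := (hS.isCompact_rolloutSet (Kstar := Kstar) (K0 := K0) r).exists_bound_of_continuousOn
    (f := fun K => lyap (S.clOp K) 1)
    fun K hK => (continuousAt_lyap_one (hst hK)).continuousWithinAt
  set b := max C 2
  have hb : 2 ≤ b := le_max_right _ _
  have hb1 : 0 < 1 - 1 / b := by
    have : 1 / b ≤ 1 / 2 := one_div_le_one_div_of_le (by norm_num) hb
    linarith
  have hb2 : 1 - 1 / b < 1 := by
    have : 0 < 1 / b := by positivity
    linarith
  refine ⟨b, √(1 - 1 / b), by positivity, Real.sqrt_pos.2 hb1, ?_, fun K hK x t => ?_⟩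
  · rw [Real.sqrt_lt' one_pos]
    simpa using hb2
  have hT := powDecay_of_mem_stab (hst hK)
  set T := S.clOp K
  have hup : ∀ y, inner ℝ y (lyap T 1 y) ≤ b * ‖y‖ ^ 2 := by
    intro y
    have h1 : ‖lyap T 1 y‖ ≤ b * ‖y‖ :=
      (ContinuousLinearMap.le_opNorm _ _).trans (by
        gcongr; exact (hC K hK).trans (le_max_left _ _))
    refine (real_inner_le_norm _ _).trans ?_
    nlinarith [norm_nonneg y]
  have hdec : ∀ t, inner ℝ ((T ^ t) x) (lyap T 1 ((T ^ t) x)) ≤ (1 - 1 / b) ^ t * (b * ‖x‖ ^ 2) := by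
    intro t
    induction t with
    | zero => simpa using hup x
    | succ t ih =>
      have h1 := inner_lyap_one hT ((T ^ t) x)
      have h2 := hup ((T ^ t) x)
      have h3 : 1 / b * inner ℝ ((T ^ t) x) (lyap T 1 ((T ^ t) x)) ≤ ‖(T ^ t) x‖ ^ 2 := by
        rw [one_div, inv_mul_le_iff₀ (by positivity)]
        exact h2
      rw [pow_succ', mul_apply_eq_comp, pow_succ']
      have h4 := mul_le_mul_of_nonneg_left ih hb1.le
      linarith
  have h1 := inner_lyap_one hT ((T ^ t) x)
  have h2 := inner_lyap_one_nonneg hT (T ((T ^ t) x))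
  have h3 := hdec t
  rw [traj_eq, pow_mul, Real.sq_sqrt hb1.le]
  linarith

end LQR

section Sphere

open Set Metric Module

variable {E : Type*} [NormedAddCommGroup E] [InnerProductSpace ℝ E]

/-! ### Radial cutoff functions -/

/-- A smooth radial cutoff: `1` where `s² ≤ 1 - δ`, and `0` where `s² ≥ 1`. -/
def radialCutoff (δ s : ℝ) : ℝ := Real.smoothTransition ((1 - s ^ 2) / δ)

theorem contDiff_radialCutoff (δ : ℝ) : ContDiff ℝ 1 (radialCutoff δ) := by
  unfold radialCutoff
  exact Real.smoothTransition.contDiff.comp (by fun_prop)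

theorem radialCutoff_of_one_le {δ s : ℝ} (hδ : 0 < δ) (hs : 1 ≤ s ^ 2) : radialCutoff δ s = 0 :=
  Real.smoothTransition.zero_of_nonpos (div_nonpos_of_nonpos_of_nonneg (by linarith) hδ.le)

theorem abs_radialCutoff_le (δ s : ℝ) : |radialCutoff δ s| ≤ 1 := by
  rw [radialCutoff, abs_of_nonneg (Real.smoothTransition.nonneg _)]
  exact Real.smoothTransition.le_one _

theorem tendsto_radialCutoff {s : ℝ} (hs : s ^ 2 < 1) :
    Tendsto (fun k : ℕ => radialCutoff (1 / ((k : ℝ) + 1)) s) atTop (𝓝 1) := by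
  have h1 : ∀ᶠ k : ℕ in atTop, 1 / ((k : ℝ) + 1) < 1 - s ^ 2 :=
    tendsto_one_div_add_atTop_nhds_zero_nat.eventually_lt_const (by linarith)
  refine tendsto_const_nhds.congr' ?_
  filter_upwards [h1] with k hk
  refine (Real.smoothTransition.one_of_one_le ?_).symm
  rw [one_le_div (by positivity)]
  exact hk.le

theorem deriv_radialCutoff_of_one_lt {δ s : ℝ} (hδ : 0 < δ) (hs : 1 < s) :
    deriv (radialCutoff δ) s = 0 := by
  have : radialCutoff δ =ᶠ[𝓝 s] fun _ => 0 := by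
    filter_upwards [lt_mem_nhds hs] with t ht
    exact radialCutoff_of_one_le hδ (by nlinarith)
  rw [this.deriv_eq, deriv_const]

theorem integral_deriv_cutoff {φ φ' : ℝ → ℝ} (hφ : ∀ x, HasDerivAt φ (φ' x) x)
    (hφ' : Continuous φ') {δ : ℝ} (hδ : 0 < δ) :
    ∫ s in (0 : ℝ)..1, deriv (radialCutoff δ) s * φ s =
      - φ 0 * radialCutoff δ 0 - ∫ s in (0 : ℝ)..1, radialCutoff δ s * φ' s := by
  simp_rw [mul_comm (deriv _ _), mul_comm (radialCutoff δ _) (φ' _)]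
  rw [intervalIntegral.integral_mul_deriv_eq_deriv_mul (fun x _ => hφ x)
    (fun x _ => ((contDiff_radialCutoff δ).differentiable (by simp) x).hasDerivAt)
    (hφ'.intervalIntegrable _ _)
    (((contDiff_radialCutoff δ).continuous_deriv (by simp)).intervalIntegrable _ _),
    radialCutoff_of_one_le hδ (by norm_num)]
  ring

/-- The one-dimensional boundary limit: the derivative of the cutoff approaches minus the Dirac
mass at `1`. -/
theorem tendsto_integral_deriv_cutoff {φ φ' : ℝ → ℝ} (hφ : ∀ x, HasDerivAt φ (φ' x) x)
    (hφ' : Continuous φ') {k : ℕ → ℝ} (hk : ∀ j, k j = 1 / ((j : ℝ) + 1)) :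
    Tendsto (fun j => ∫ s in (0 : ℝ)..1, deriv (radialCutoff (k j)) s * φ s) atTop (𝓝 (-φ 1)) := by
  have hibp := fun j => integral_deriv_cutoff hφ hφ' (δ := k j) (by rw [hk]; positivity)
  simp_rw [hibp]
  have h1 : Tendsto (fun j => radialCutoff (k j) 0) atTop (𝓝 1) := by
    simp_rw [hk]
    exact tendsto_radialCutoff (by norm_num)
  have h2 : Tendsto (fun j => ∫ s in (0 : ℝ)..1, radialCutoff (k j) s * φ' s) atTop
      (𝓝 (∫ s in (0 : ℝ)..1, φ' s)) := by
    refine intervalIntegral.tendsto_integral_filter_of_dominated_convergence (fun s => |φ' s|)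
      (Eventually.of_forall fun j => ?_) (Eventually.of_forall fun j => ?_)
      (hφ'.abs.intervalIntegrable _ _) ?_
    · exact ((contDiff_radialCutoff (k j)).continuous.mul hφ').aestronglyMeasurable
    · refine Eventually.of_forall fun s _ => ?_
      rw [norm_mul, Real.norm_eq_abs, Real.norm_eq_abs]
      exact mul_le_of_le_one_left (abs_nonneg _) (abs_radialCutoff_le _ _)
    · have hne : ∀ᵐ s : ℝ, s ≠ 1 := by simp [ae_iff]
      filter_upwards [hne] with s hs hs'
      rw [uIoc_of_le zero_le_one] at hs'
      have hlt : s < 1 := lt_of_le_of_ne hs'.2 hs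
      have := (tendsto_radialCutoff (s := s) (by nlinarith [hs'.1])).mul_const (φ' s)
      simp_rw [hk]
      simpa using this
  have h3 : ∫ s in (0 : ℝ)..1, φ' s = φ 1 - φ 0 :=
    intervalIntegral.integral_eq_sub_of_hasDerivAt (fun x _ => hφ x) (hφ'.intervalIntegrable _ _)
  have := (h1.const_mul (-φ 0)).sub h2
  rw [h3] at this
  convert this using 2
  ring

theorem contDiff_radialCutoff_norm (δ : ℝ) : ContDiff ℝ 1 fun x : E => radialCutoff δ ‖x‖ := by
  unfold radialCutoff
  exact Real.smoothTransition.contDiff.comp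
    ((contDiff_const.sub (contDiff_norm_sq ℝ)).div_const δ)

theorem fderiv_radialCutoff_norm (δ : ℝ) (u : sphere (0 : E) 1) {s : ℝ} (hs : 0 < s) (e : E) :
    fderiv ℝ (fun x : E => radialCutoff δ ‖x‖) (s • (u : E)) e =
      deriv (radialCutoff δ) s * inner ℝ (u : E) e := by
  have hu : ‖(u : E)‖ = 1 := by simp
  have hne : s • (u : E) ≠ 0 := by
    rw [← norm_ne_zero_iff, norm_smul, hu, mul_one, norm_ne_zero_iff]
    exact hs.ne'
  have hns : ‖s • (u : E)‖ = s := by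
    rw [norm_smul, hu, mul_one, Real.norm_eq_abs, abs_of_pos hs]
  have h1 : HasFDerivAt (fun x : E => ‖x‖) (innerSL ℝ (u : E)) (s • (u : E)) := by
    have h := ((hasStrictFDerivAt_norm_sq (s • (u : E))).hasFDerivAt.sqrt (by
      simpa using hne))
    simp only [Real.sqrt_sq (norm_nonneg _)] at h
    convert h using 1
    ext v
    simp only [hns, smul_apply, innerSL_apply_apply, smul_eq_mul, map_smul, two_smul, add_apply]
    field_simp
    ring
  have h2 : HasDerivAt (radialCutoff δ) (deriv (radialCutoff δ) s) ‖s • (u : E)‖ := by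
    rw [hns]
    exact ((contDiff_radialCutoff δ).differentiable (by simp) s).hasDerivAt
  have h3 := (h2.comp_hasFDerivAt (s • (u : E)) h1).fderiv
  rw [show (fun x : E => radialCutoff δ ‖x‖) = radialCutoff δ ∘ fun x : E => ‖x‖ from rfl, h3]
  simp

variable [FiniteDimensional ℝ E]

theorem hasCompactSupport_radialCutoff_norm {δ : ℝ} (hδ : 0 < δ) :
    HasCompactSupport fun x : E => radialCutoff δ ‖x‖ := by
  refine HasCompactSupport.intro (isCompact_closedBall (0 : E) 1) fun x hx => ?_
  rw [mem_closedBall_zero_iff, not_le] at hx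
  exact radialCutoff_of_one_le hδ (by nlinarith)

variable [MeasurableSpace E] [BorelSpace E]

/-! ### Integration in polar coordinates -/

theorem measurableEmbedding_polar :
    MeasurableEmbedding (fun p : sphere (0 : E) 1 × Ioi (0 : ℝ) => (p.2 : ℝ) • (p.1 : E)) :=
  (MeasurableEmbedding.subtype_coe (measurableSet_singleton (0 : E)).compl).comp
    (homeomorphUnitSphereProd E).symm.measurableEmbedding

theorem integral_volumeIoiPow (k : ℕ) (f : ℝ → ℝ) :
    ∫ x : Ioi (0 : ℝ), f x ∂(Measure.volumeIoiPow k) = ∫ x in Ioi (0 : ℝ), x ^ k * f x := by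
  simp only [Measure.volumeIoiPow, ENNReal.ofReal]
  rw [integral_withDensity_eq_integral_smul
      ((measurable_subtype_coe.pow_const _).real_toNNReal),
    integral_subtype_comap measurableSet_Ioi fun a ↦ Real.toNNReal (a ^ k) • f a]
  refine setIntegral_congr_fun measurableSet_Ioi fun x (hx : 0 < x) ↦ ?_
  simp only [NNReal.smul_def, Real.coe_toNNReal _ (pow_nonneg hx.le _), smul_eq_mul]

variable [Nontrivial E] (μ : Measure E) [μ.IsAddHaarMeasure]

/-- Polar coordinates as a measure-preserving map to the whole space: the origin is a null set. -/
theorem measurePreserving_polar :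
    MeasurePreserving (fun p : sphere (0 : E) 1 × Ioi (0 : ℝ) => (p.2 : ℝ) • (p.1 : E))
      (μ.toSphere.prod (Measure.volumeIoiPow (finrank ℝ E - 1))) μ := by
  have h1 : MeasurePreserving (homeomorphUnitSphereProd E).symm
      (μ.toSphere.prod (Measure.volumeIoiPow (finrank ℝ E - 1))) (μ.comap (↑)) :=
    μ.measurePreserving_homeomorphUnitSphereProd.symm
      (homeomorphUnitSphereProd E).toMeasurableEquiv
  have h2 : MeasurePreserving ((↑) : ({0}ᶜ : Set E) → E) (μ.comap (↑)) μ := by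
    refine ⟨measurable_subtype_coe, ?_⟩
    rw [map_comap_subtype_coe (measurableSet_singleton (0 : E)).compl,
      restrict_compl_singleton]
  exact h2.comp h1

theorem integral_polar (f : E → ℝ) :
    ∫ x, f x ∂μ = ∫ p : sphere (0 : E) 1 × Ioi (0 : ℝ), f ((p.2 : ℝ) • (p.1 : E))
      ∂(μ.toSphere.prod (Measure.volumeIoiPow (finrank ℝ E - 1))) :=
  ((measurePreserving_polar μ).integral_comp measurableEmbedding_polar f).symm

end Sphere

section Divergence

open Set Metric Module

variable {E : Type*} [NormedAddCommGroup E] [InnerProductSpace ℝ E] [FiniteDimensional ℝ E]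
  [MeasurableSpace E] [BorelSpace E] (μ : Measure E) [μ.IsAddHaarMeasure]

/-! ### The divergence theorem on the unit ball -/

/-- Integration by parts against the radial cutoff, which has compact support. -/
theorem integral_mul_fderiv_cutoff {f : E → ℝ} (hf : ContDiff ℝ 1 f) {δ : ℝ} (hδ : 0 < δ) (e : E) :
    Integrable (fun x => f x * fderiv ℝ (fun x : E => radialCutoff δ ‖x‖) x e) μ ∧
    ∫ x, f x * fderiv ℝ (fun x : E => radialCutoff δ ‖x‖) x e ∂μ =
      - ∫ x, fderiv ℝ f x e * radialCutoff δ ‖x‖ ∂μ := by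
  have hw := contDiff_radialCutoff_norm (E := E) δ
  have hwc := hasCompactSupport_radialCutoff_norm (E := E) hδ
  have hf' : Continuous fun x => fderiv ℝ f x e :=
    (hf.continuous_fderiv (by simp)).clm_apply continuous_const
  have hw' : Continuous fun x => fderiv ℝ (fun x : E => radialCutoff δ ‖x‖) x e :=
    (hw.continuous_fderiv (by simp)).clm_apply continuous_const
  have hwc' : HasCompactSupport fun x => fderiv ℝ (fun x : E => radialCutoff δ ‖x‖) x e :=
    hwc.fderiv_apply (𝕜 := ℝ) e
  have h1 : Integrable (fun x => f x * fderiv ℝ (fun x : E => radialCutoff δ ‖x‖) x e) μ :=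
    (hf.continuous.mul hw').integrable_of_hasCompactSupport hwc'.mul_left
  refine ⟨h1, ?_⟩
  exact integral_mul_fderiv_eq_neg_fderiv_mul_of_integrable
    ((hf'.mul hw.continuous).integrable_of_hasCompactSupport hwc.mul_left) h1
    ((hf.continuous.mul hw.continuous).integrable_of_hasCompactSupport hwc.mul_left)
    (fun x _ => hf.differentiable (by simp) x) (fun x _ => hw.differentiable (by simp) x)

theorem continuous_deriv_radialCutoff (δ : ℝ) : Continuous (deriv (radialCutoff δ)) :=
  (contDiff_radialCutoff δ).continuous_deriv (by simp)

variable [Nontrivial E]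

/-- The integral against the derivative of the cutoff in polar coordinates. The inner integral runs
over `0..1` only, as the cutoff vanishes outside the unit ball. -/
theorem integral_mul_fderiv_cutoff_polar {f : E → ℝ} (hf : ContDiff ℝ 1 f) {δ : ℝ} (hδ : 0 < δ)
    (e : E) :
    ∫ x, f x * fderiv ℝ (fun x : E => radialCutoff δ ‖x‖) x e ∂μ =
      ∫ u : sphere (0 : E) 1, inner ℝ (u : E) e *
        (∫ s in (0 : ℝ)..1, deriv (radialCutoff δ) s * (s ^ (finrank ℝ E - 1) * f (s • (u : E))))
          ∂μ.toSphere := by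
  have hint := ((measurePreserving_polar μ).integrable_comp_emb measurableEmbedding_polar).2
    (integral_mul_fderiv_cutoff μ hf hδ e).1
  simp only [Function.comp_def] at hint
  rw [integral_polar, integral_prod _ hint]
  refine integral_congr_ae (Eventually.of_forall fun u => ?_)
  have h1 : ∀ s : Ioi (0 : ℝ), f ((s : ℝ) • (u : E)) *
      fderiv ℝ (fun x : E => radialCutoff δ ‖x‖) ((s : ℝ) • (u : E)) e =
      (fun s : ℝ => f (s • (u : E)) * (deriv (radialCutoff δ) s * inner ℝ (u : E) e)) s := fun s => by
    rw [fderiv_radialCutoff_norm δ u s.2]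
  refine (integral_congr_ae (Eventually.of_forall h1)).trans
    ((integral_volumeIoiPow (finrank ℝ E - 1) fun s : ℝ =>
      f (s • (u : E)) * (deriv (radialCutoff δ) s * inner ℝ (u : E) e)).trans ?_)
  beta_reduce
  rw [intervalIntegral.integral_of_le zero_le_one, ← integral_const_mul,
    setIntegral_eq_of_subset_of_forall_sdiff_eq_zero measurableSet_Ioi
      (show Ioc (0 : ℝ) 1 ⊆ Ioi 0 from fun s hs => hs.1)]
  · refine integral_congr_ae (Eventually.of_forall fun s => ?_)
    beta_reduce
    ring
  · intro s hs
    rw [deriv_radialCutoff_of_one_lt hδ (not_le.1 fun h => hs.2 ⟨hs.1, h⟩)]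
    ring

/-- The divergence theorem for `f e` on the unit ball. -/
theorem integral_sphere_mul_inner {f : E → ℝ} (hf : ContDiff ℝ 1 f) (e : E) :
    ∫ u : sphere (0 : E) 1, f u * inner ℝ (u : E) e ∂μ.toSphere =
      ∫ x in ball (0 : E) 1, fderiv ℝ f x e ∂μ := by
  set k : ℕ → ℝ := fun j => 1 / ((j : ℝ) + 1) with hk
  have hkpos : ∀ j, 0 < k j := fun j => by rw [hk]; positivity
  have hf' : Continuous fun x => fderiv ℝ f x e :=
    (hf.continuous_fderiv (by simp)).clm_apply continuous_const
  set d := finrank ℝ E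
  -- the volume side
  have hvol : Tendsto (fun j => - ∫ x, fderiv ℝ f x e * radialCutoff (k j) ‖x‖ ∂μ) atTop
      (𝓝 (- ∫ x in ball (0 : E) 1, fderiv ℝ f x e ∂μ)) := by
    refine Tendsto.neg ?_
    rw [← integral_indicator measurableSet_ball]
    refine tendsto_integral_of_dominated_convergence
      ((closedBall (0 : E) 1).indicator fun x => |fderiv ℝ f x e|) (fun j => ?_) ?_ (fun j => ?_) ?_
    · exact (hf'.mul (contDiff_radialCutoff_norm (k j)).continuous).aestronglyMeasurable
    · exact (hf'.abs.continuousOn.integrableOn_compact (isCompact_closedBall _ _)).integrable_indicator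
        measurableSet_closedBall
    · refine Eventually.of_forall fun x => ?_
      by_cases hx : x ∈ closedBall (0 : E) 1
      · rw [indicator_of_mem hx, norm_mul, Real.norm_eq_abs, Real.norm_eq_abs]
        exact mul_le_of_le_one_right (abs_nonneg _) (abs_radialCutoff_le _ _)
      · rw [indicator_of_notMem hx, radialCutoff_of_one_le (hkpos j), mul_zero, norm_zero]
        rw [mem_closedBall_zero_iff, not_le] at hx
        nlinarith
    · refine Eventually.of_forall fun x => ?_
      by_cases hx : x ∈ ball (0 : E) 1
      · rw [indicator_of_mem hx]
        rw [mem_ball_zero_iff] at hx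
        have := (tendsto_radialCutoff (s := ‖x‖) (by nlinarith [norm_nonneg x])).const_mul
          (fderiv ℝ f x e)
        rwa [mul_one] at this
      · rw [indicator_of_notMem hx]
        rw [mem_ball_zero_iff, not_lt] at hx
        have : ∀ j, fderiv ℝ f x e * radialCutoff (k j) ‖x‖ = 0 := fun j => by
          rw [radialCutoff_of_one_le (hkpos j) (by nlinarith), mul_zero]
        simp only [this]
        exact tendsto_const_nhds
  -- the surface side
  have hray : ∀ u : sphere (0 : E) 1, ∀ s, HasDerivAt (fun s : ℝ => s ^ (d - 1) * f (s • (u : E)))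
      ((d - 1 : ℕ) * s ^ (d - 1 - 1) * f (s • (u : E)) +
        s ^ (d - 1) * fderiv ℝ f (s • (u : E)) u) s := by
    intro u s
    have h1 : HasDerivAt (fun s : ℝ => s • (u : E)) (u : E) s := by
      simpa using (hasDerivAt_id s).smul_const (u : E)
    have h2 := ((hf.differentiable (by simp) (s • (u : E))).hasFDerivAt).comp_hasDerivAt s h1
    exact (hasDerivAt_pow (d - 1) s).mul h2
  have hfd := hf.continuous_fderiv (by simp)
  have hfc := hf.continuous
  have hcont : Continuous fun p : sphere (0 : E) 1 × ℝ =>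
      (d - 1 : ℕ) * p.2 ^ (d - 1 - 1) * f (p.2 • (p.1 : E)) +
        p.2 ^ (d - 1) * fderiv ℝ f (p.2 • (p.1 : E)) p.1 := by
    have : Continuous fun p : sphere (0 : E) 1 × ℝ => fderiv ℝ f (p.2 • (p.1 : E)) p.1 :=
      (hfd.comp (by fun_prop)).clm_apply (by fun_prop)
    fun_prop
  obtain ⟨C, hC⟩ := (isCompact_univ.prod isCompact_Icc : IsCompact
    ((univ : Set (sphere (0 : E) 1)) ×ˢ Icc (0 : ℝ) 1)).exists_bound_of_continuousOn hcont.continuousOn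
  have hray' : ∀ u : sphere (0 : E) 1, Continuous fun s : ℝ =>
      (d - 1 : ℕ) * s ^ (d - 1 - 1) * f (s • (u : E)) +
        s ^ (d - 1) * fderiv ℝ f (s • (u : E)) u := fun u =>
    hcont.comp (Continuous.prodMk_right u)
  have hsurf : Tendsto (fun j => ∫ u : sphere (0 : E) 1, inner ℝ (u : E) e *
      (∫ s in (0 : ℝ)..1, deriv (radialCutoff (k j)) s * (s ^ (d - 1) * f (s • (u : E))))
        ∂μ.toSphere) atTop (𝓝 (∫ u : sphere (0 : E) 1, -(f u * inner ℝ (u : E) e) ∂μ.toSphere)) := by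
    refine tendsto_integral_of_dominated_convergence (fun _ => ‖e‖ * (|f 0| + C)) (fun j => ?_)
      (integrable_const _) (fun j => Eventually.of_forall fun u => ?_)
      (Eventually.of_forall fun u => ?_)
    · refine Continuous.aestronglyMeasurable (Continuous.mul (by fun_prop) ?_)
      refine intervalIntegral.continuous_parametric_intervalIntegral_of_continuous' ?_ _ _
      have := continuous_deriv_radialCutoff (k j)
      unfold Function.uncurry
      fun_prop
    · rw [integral_deriv_cutoff (hray u) (hray' u) (hkpos j), norm_mul]
      have h1 : ‖inner ℝ (u : E) e‖ ≤ ‖e‖ := by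
        have := norm_inner_le_norm (𝕜 := ℝ) (u : E) e
        simpa using this
      have h2 : |0 ^ (d - 1) * f ((0 : ℝ) • (u : E))| ≤ |f 0| := by
        rw [zero_smul, abs_mul]
        refine mul_le_of_le_one_left (abs_nonneg _) ?_
        rw [abs_pow, abs_zero]
        exact pow_le_one₀ le_rfl zero_le_one
      have h3 : ‖∫ s in (0 : ℝ)..1, radialCutoff (k j) s *
          ((d - 1 : ℕ) * s ^ (d - 1 - 1) * f (s • (u : E)) +
            s ^ (d - 1) * fderiv ℝ f (s • (u : E)) u)‖ ≤ C * |1 - 0| := by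
        refine intervalIntegral.norm_integral_le_of_norm_le_const fun s hs => ?_
        rw [uIoc_of_le zero_le_one] at hs
        have := hC (u, s) ⟨mem_univ _, hs.1.le, hs.2⟩
        rw [norm_mul]
        exact (mul_le_of_le_one_left (norm_nonneg _) (abs_radialCutoff_le _ _)).trans this
      rw [sub_zero, abs_one, mul_one] at h3
      gcongr
      refine (norm_sub_le _ _).trans (add_le_add ?_ h3)
      rw [norm_mul, norm_neg]
      exact (mul_le_of_le_one_right (norm_nonneg _) (abs_radialCutoff_le _ _)).trans h2
    · have := (tendsto_integral_deriv_cutoff (hray u) (hray' u) (fun _ => rfl)).const_mul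
        (inner ℝ (u : E) e)
      convert this using 2
      simp
      ring
  simp_rw [← fun j => (integral_mul_fderiv_cutoff μ hf (hkpos j) e).2,
    fun j => integral_mul_fderiv_cutoff_polar μ hf (hkpos j) e] at hvol
  have := tendsto_nhds_unique hsurf hvol
  rw [integral_neg] at this
  exact neg_injective this

/-- If the derivative of `f` in the direction `e` is within `b` of `a` on the unit ball, then so is
`d` times the average of `f u ⟪u, e⟫` over the sphere: by the divergence theorem the latter is the
average of that derivative over the ball, since the sphere has `d` times the measure of the ball. -/
theorem abs_average_sphere_sub_le {f : E → ℝ} (hf : ContDiff ℝ 1 f) (e : E) {a b : ℝ}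
    (hab : ∀ x ∈ ball (0 : E) 1, |fderiv ℝ f x e - a| ≤ b) :
    |(finrank ℝ E : ℝ) * ((μ.toSphere.real univ)⁻¹ *
      ∫ u : sphere (0 : E) 1, f u * inner ℝ (u : E) e ∂μ.toSphere) - a| ≤ b := by
  have hpos : 0 < μ.real (ball (0 : E) 1) :=
    ENNReal.toReal_pos (measure_ball_pos μ _ one_pos).ne' measure_ball_lt_top.ne
  have hd : (0 : ℝ) < finrank ℝ E := Nat.cast_pos.2 finrank_pos
  have hint : IntegrableOn (fun x => fderiv ℝ f x e) (ball (0 : E) 1) μ :=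
    ((((hf.continuous_fderiv (by simp)).clm_apply continuous_const).continuousOn.integrableOn_compact
      (isCompact_closedBall _ _))).mono_set ball_subset_closedBall
  rw [integral_sphere_mul_inner μ hf, μ.toSphere_real_apply_univ]
  have h1 : (finrank ℝ E : ℝ) * (((finrank ℝ E : ℝ) * μ.real (ball (0 : E) 1))⁻¹ *
      ∫ x in ball (0 : E) 1, fderiv ℝ f x e ∂μ) - a =
      (μ.real (ball (0 : E) 1))⁻¹ * ∫ x in ball (0 : E) 1, (fderiv ℝ f x e - a) ∂μ := by
    rw [integral_sub hint (integrableOn_const measure_ball_lt_top.ne), setIntegral_const, smul_eq_mul]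
    field_simp
  rw [h1, abs_mul, abs_of_pos (inv_pos.2 hpos), inv_mul_le_iff₀ hpos, mul_comm, ← Real.norm_eq_abs]
  exact norm_setIntegral_le_of_norm_le_const measure_ball_lt_top fun x hx => hab x hx

end Divergence

section Gaussian

open Set Metric Module Real

/-! ### Wirtinger's inequality -/

/-- Wirtinger's inequality for functions with `f (θ + π) = - f θ`. -/
theorem integral_sq_le_of_antiperiodic {f f' : ℝ → ℝ} (hf : ∀ x, HasDerivAt f (f' x) x)
    (hf' : Continuous f') (hanti : ∀ x, f (x + π) = - f x) :
    ∫ x in (0 : ℝ)..2 * π, f x ^ 2 ≤ ∫ x in (0 : ℝ)..2 * π, f' x ^ 2 := by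
  have hfc : Continuous f := continuous_iff_continuousAt.2 fun x => (hf x).continuousAt
  have hab : (0 : ℝ) < 2 * π := by positivity
  set F : ℝ → ℂ := fun x => (f x : ℂ)
  set F' : ℝ → ℂ := fun x => (f' x : ℂ)
  have hF : ∀ x, HasDerivAt F (F' x) x := fun x => (hf x).ofReal_comp
  have hFc : Continuous F := by fun_prop
  have hF'c : Continuous F' := by fun_prop
  have hmem : ∀ g : ℝ → ℂ, Continuous g → MemLp g 2 (volume.restrict (Ioc 0 (2 * π))) := by
    intro g hg
    obtain ⟨C, hC⟩ := isCompact_Icc.exists_bound_of_continuousOn (s := Icc 0 (2 * π)) hg.continuousOn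
    refine MemLp.of_bound hg.aestronglyMeasurable C ?_
    filter_upwards [ae_restrict_mem measurableSet_Ioc] with x hx
    exact hC x ⟨hx.1.le, hx.2⟩
  have h0 : ∫ x in (0 : ℝ)..2 * π, f x = 0 := by
    have h1 : ∫ x in π..2 * π, f x = - ∫ x in (0 : ℝ)..π, f x := by
      rw [← intervalIntegral.integral_neg]
      simp_rw [← hanti]
      rw [intervalIntegral.integral_comp_add_right]
      congr 1 <;> ring
    rw [← intervalIntegral.integral_add_adjacent_intervals (hfc.intervalIntegrable 0 π)
      (hfc.intervalIntegrable π _), h1]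
    ring
  have hper : f (2 * π) = f 0 := by
    have h1 := hanti 0
    have h2 := hanti π
    rw [zero_add] at h1
    rw [two_mul, h2, h1, neg_neg]
  have hcoef : ∀ i : ℤ, ‖fourierCoeffOn hab F i‖ ^ 2 ≤ ‖fourierCoeffOn hab F' i‖ ^ 2 := by
    intro i
    rcases eq_or_ne i 0 with rfl | hi
    · have : fourierCoeffOn hab F 0 = 0 := by
        rw [fourierCoeffOn_eq_integral]
        simp only [neg_zero, fourier_zero, one_smul]
        rw [intervalIntegral.integral_ofReal, h0]
        simp
      rw [this]
      simp
    · have h1 : F (2 * π) - F 0 = 0 := by simp [F, hper]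
      rw [fourierCoeffOn_of_hasDerivAt hab hi (fun x _ => hF x) (hF'c.intervalIntegrable _ _), h1]
      have hi1 : (1 : ℝ) ≤ |(i : ℝ)| := by exact_mod_cast Int.one_le_abs hi
      have h2 : ‖(1 / (-2 * π * Complex.I * i) : ℂ)‖ * (2 * π) ≤ 1 := by
        simp only [norm_div, norm_mul, norm_neg, norm_one, Complex.norm_ofNat, Complex.norm_real,
          Complex.norm_I, Complex.norm_intCast, mul_one, Real.norm_eq_abs, abs_of_pos pi_pos]
        rw [one_div, inv_mul_le_iff₀ (by positivity)]
        nlinarith [pi_pos]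
      have h3 : ‖(1 / (-2 * π * Complex.I * i) * (fourier (-i) ((0 : ℝ) : AddCircle (2 * π - 0)) * 0 -
          ((2 * π : ℝ) - (0 : ℝ)) * fourierCoeffOn hab F' i) : ℂ)‖ ≤ ‖fourierCoeffOn hab F' i‖ := by
        rw [mul_zero, zero_sub, norm_mul, norm_neg, norm_mul, Complex.ofReal_zero, sub_zero,
          Complex.norm_real, Real.norm_eq_abs, abs_of_pos hab, ← mul_assoc]
        exact mul_le_of_le_one_left (norm_nonneg _) h2
      gcongr
  have hs := hasSum_le hcoef (hasSum_sq_fourierCoeffOn hab (hmem F hFc))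
    (hasSum_sq_fourierCoeffOn hab (hmem F' hF'c))
  simp only [F, F', Complex.norm_real, Real.norm_eq_abs, sq_abs, smul_eq_mul, sub_zero] at hs
  exact le_of_mul_le_mul_left hs (by positivity)

/-! ### The standard Gaussian measure in polar coordinates -/

variable {E : Type*} [NormedAddCommGroup E] [InnerProductSpace ℝ E] [FiniteDimensional ℝ E]
  [MeasurableSpace E] [BorelSpace E]

theorem lintegral_sq_stdGaussian (l : StrongDual ℝ E) :
    ∫⁻ x, ENNReal.ofReal (l x ^ 2) ∂(stdGaussian E) = ENNReal.ofReal (‖l‖ ^ 2) := by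
  have h1 : MemLp l 2 (stdGaussian E) := IsGaussian.memLp_dual _ l 2 (by simp)
  rw [← ofReal_integral_eq_lintegral_ofReal h1.integrable_sq
    (Eventually.of_forall fun x => sq_nonneg _), ← variance_dual_stdGaussian l,
    variance_of_integral_eq_zero (by fun_prop) (integral_strongDual_stdGaussian l)]

theorem lintegral_norm_sq_stdGaussian :
    ∫⁻ x : E, ENNReal.ofReal (‖x‖ ^ 2) ∂(stdGaussian E) = finrank ℝ E := by
  set b := stdOrthonormalBasis ℝ E
  have h1 : ∀ x : E, ENNReal.ofReal (‖x‖ ^ 2) =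
      ∑ i, ENNReal.ofReal ((innerSL ℝ (b i) : StrongDual ℝ E) x ^ 2) := by
    intro x
    rw [← ENNReal.ofReal_sum_of_nonneg fun i _ => sq_nonneg _, ← b.sum_sq_norm_inner_right x]
    simp
  simp_rw [h1]
  rw [lintegral_finsetSum _ fun i _ => by fun_prop]
  simp_rw [lintegral_sq_stdGaussian]
  simp

/-- The unnormalized Gaussian density. -/
def gaussianWeight (s : ℝ) : ℝ := rexp (-(1 / 2) * s ^ 2)

/-- The density of the standard Gaussian, identified through its characteristic function. -/
theorem stdGaussian_eq_withDensity : ∃ Z : ℝ, 0 < Z ∧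
    stdGaussian E = (volume : Measure E).withDensity
      (fun x => ENNReal.ofReal (Z * gaussianWeight ‖x‖)) := by
  set d := finrank ℝ E
  set Z : ℝ := ((π / (1 / 2)) ^ ((d : ℝ) / 2))⁻¹ with hZ
  have hZ0 : 0 < Z := by positivity
  have hint : Integrable (fun x : E => Z * gaussianWeight ‖x‖) := by
    have := (GaussianFourier.integrable_cexp_neg_mul_sq_norm_add (V := E) (b := 1 / 2)
      (by norm_num) 0 0).norm
    refine (this.congr (Eventually.of_forall fun x => ?_)).const_mul Z
    simp only [Complex.norm_exp, gaussianWeight]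
    congr 1
    have : (-(1 / 2) * (‖x‖ : ℂ) ^ 2 + 0 * (inner ℝ (0 : E) x : ℝ) : ℂ) =
      ((-(1 / 2) * ‖x‖ ^ 2 : ℝ) : ℂ) := by push_cast; ring
    rw [this, Complex.ofReal_re]
  refine ⟨Z, hZ0, ?_⟩
  have := isFiniteMeasure_withDensity_ofReal hint.2
  refine Measure.ext_of_charFun ?_
  ext t
  have hnn : ∀ x : E, 0 ≤ Z * gaussianWeight ‖x‖ := fun x => by
    unfold gaussianWeight; positivity
  have hm : Measurable fun x : E => ENNReal.ofReal (Z * gaussianWeight ‖x‖) := by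
    unfold gaussianWeight; fun_prop
  rw [charFun_stdGaussian, charFun_apply, integral_withDensity_eq_integral_toReal_smul hm
    (Eventually.of_forall fun _ => ENNReal.ofReal_lt_top)]
  have h1 : ∀ x : E, (ENNReal.ofReal (Z * gaussianWeight ‖x‖)).toReal •
      Complex.exp ((inner ℝ x t : ℝ) * Complex.I) =
      (Z : ℂ) * Complex.exp (-(1 / 2) * (‖x‖ : ℂ) ^ 2 + Complex.I * (inner ℝ t x : ℝ)) := by
    intro x
    rw [ENNReal.toReal_ofReal (hnn x), Complex.exp_add, gaussianWeight, Complex.real_smul,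
      real_inner_comm t x, mul_comm Complex.I]
    push_cast
    ring
  simp_rw [h1]
  rw [integral_const_mul, GaussianFourier.integral_cexp_neg_mul_sq_norm_add (by norm_num)]
  have h2 : (Z : ℂ) * (π / (1 / 2)) ^ ((finrank ℝ E : ℂ) / 2) = 1 := by
    have : ((π / (1 / 2)) ^ ((finrank ℝ E : ℂ) / 2) : ℂ) = (((π / (1 / 2)) ^ ((d : ℝ) / 2) : ℝ) : ℂ) := by
      rw [Complex.ofReal_cpow (by positivity)]
      push_cast
      rfl
    rw [this, ← Complex.ofReal_mul, hZ, inv_mul_cancel₀ (by positivity), Complex.ofReal_one]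
  rw [← mul_assoc, h2, one_mul, Complex.I_sq]
  congr 1
  ring

theorem stdGaussian_absolutelyContinuous : stdGaussian E ≪ (volume : Measure E) := by
  obtain ⟨Z, -, h⟩ := stdGaussian_eq_withDensity (E := E)
  rw [h]
  exact withDensity_absolutelyContinuous _ _

variable [Nontrivial E]

/-- Under the Gaussian measure the direction is uniform and independent of the norm. -/
theorem lintegral_norm_sq_mul_direction {ψ : E → ENNReal} (hψ : Measurable ψ) :
    (finrank ℝ E : ENNReal) * ∫⁻ u : sphere (0 : E) 1, ψ u ∂(volume : Measure E).toSphere =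
      (volume : Measure E).toSphere univ *
        ∫⁻ x, ENNReal.ofReal (‖x‖ ^ 2) * ψ (‖x‖⁻¹ • x) ∂(stdGaussian E) := by
  obtain ⟨Z, hZ, h⟩ := stdGaussian_eq_withDensity (E := E)
  set I := ∫⁻ s : Ioi (0 : ℝ), ENNReal.ofReal (Z * gaussianWeight s) * ENNReal.ofReal ((s : ℝ) ^ 2)
    ∂(Measure.volumeIoiPow (finrank ℝ E - 1)) with hI
  have hw : Measurable gaussianWeight := by unfold gaussianWeight; fun_prop
  have hpolar : ∀ ψ : E → ENNReal, Measurable ψ →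
      ∫⁻ x, ENNReal.ofReal (‖x‖ ^ 2) * ψ (‖x‖⁻¹ • x) ∂(stdGaussian E) =
        (∫⁻ u : sphere (0 : E) 1, ψ u ∂(volume : Measure E).toSphere) * I := by
    intro ψ hψ
    have hψ' : Measurable fun x : E => ψ (‖x‖⁻¹ • x) := hψ.comp (by fun_prop)
    rw [h, lintegral_withDensity_eq_lintegral_mul _ (by fun_prop) (by fun_prop),
      ← (measurePreserving_polar (volume : Measure E)).lintegral_comp (by fun_prop), hI,
      ← lintegral_prod_mul (by fun_prop) (by fun_prop)]
    refine lintegral_congr fun p => ?_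
    have hp : (0 : ℝ) < p.2 := p.2.2
    have hn : ‖(p.2 : ℝ) • (p.1 : E)‖ = p.2 := by
      rw [norm_smul, norm_eq_of_mem_sphere, mul_one, Real.norm_eq_abs, abs_of_pos hp]
    simp only [Pi.mul_apply]
    rw [hn, smul_smul, inv_mul_cancel₀ hp.ne', one_smul]
    ring
  have h1 := hpolar (fun _ => 1) measurable_const
  simp only [mul_one, lintegral_norm_sq_stdGaussian, lintegral_one] at h1
  rw [hpolar ψ hψ, h1]
  ring

end Gaussian

section Poincare

open Set Metric Module Real

/-! ### A Poincaré inequality for odd functions on the sphere -/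

variable {E : Type*} [NormedAddCommGroup E] [InnerProductSpace ℝ E]

/-- The extension of `h` from the unit sphere that is homogeneous of degree one. -/
def homogExt (h : E → ℝ) (x : E) : ℝ := ‖x‖ * h (‖x‖⁻¹ • x)

/-- The derivative of `homogExt h` at `x`, read off from `h` and `fderiv ℝ h` at `x / ‖x‖`. -/
def homogExtDeriv (h : E → ℝ) (x : E) : E →L[ℝ] ℝ :=
  h (‖x‖⁻¹ • x) • innerSL ℝ (‖x‖⁻¹ • x) + fderiv ℝ h (‖x‖⁻¹ • x) ∘L
    (1 - (innerSL ℝ (‖x‖⁻¹ • x)).smulRight (‖x‖⁻¹ • x))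

theorem homogExtDeriv_apply (h : E → ℝ) (x y : E) :
    homogExtDeriv h x y = inner ℝ (‖x‖⁻¹ • x) y * h (‖x‖⁻¹ • x) +
      fderiv ℝ h (‖x‖⁻¹ • x) (y - inner ℝ (‖x‖⁻¹ • x) y • (‖x‖⁻¹ • x)) := by
  simp only [homogExtDeriv, add_apply, smul_apply, innerSL_apply_apply, smul_eq_mul,
    ContinuousLinearMap.comp_apply, sub_apply, one_apply_eq_self,
    ContinuousLinearMap.smulRight_apply]
  rw [mul_comm]

theorem hasDerivAt_homogExt_comp {h : E → ℝ} (hh : ContDiff ℝ 1 h) {c : ℝ → E} {c' : E} {θ : ℝ}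
    (hc : HasDerivAt c c' θ) (hne : c θ ≠ 0) :
    HasDerivAt (fun t => homogExt h (c t)) (homogExtDeriv h (c θ) c') θ := by
  have hpos : 0 < ‖c θ‖ := norm_pos_iff.2 hne
  have hn : HasDerivAt (fun t => ‖c t‖) (inner ℝ (‖c θ‖⁻¹ • c θ) c') θ := by
    have := (hc.norm_sq).sqrt (by positivity)
    simp only [Real.sqrt_sq (norm_nonneg _)] at this
    convert this using 1
    rw [real_inner_smul_left]
    field_simp
  have hi : HasDerivAt (fun t => ‖c t‖⁻¹) (-(inner ℝ (‖c θ‖⁻¹ • c θ) c') / ‖c θ‖ ^ 2) θ :=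
    hn.fun_inv hpos.ne'
  have hu : HasDerivAt (fun t => ‖c t‖⁻¹ • c t)
      (‖c θ‖⁻¹ • (c' - inner ℝ (‖c θ‖⁻¹ • c θ) c' • (‖c θ‖⁻¹ • c θ))) θ := by
    convert hi.fun_smul hc using 1
    rw [smul_sub, smul_smul, smul_smul, add_comm, add_comm, sub_eq_add_neg, ← neg_smul]
    congr 2
    field_simp
  have hhu := ((hh.differentiable (by simp)) (‖c θ‖⁻¹ • c θ)).hasFDerivAt.comp_hasDerivAt θ hu
  have hprod := hn.fun_mul hhu
  rw [map_smul, smul_eq_mul, Function.comp_apply, ← mul_assoc, mul_inv_cancel₀ hpos.ne', one_mul]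
    at hprod
  rw [homogExtDeriv_apply]
  exact hprod

/-- The radial component of the gradient of the homogeneous extension is `h` and the tangential one
is that of the gradient of `h`; both are at most `L`. -/
theorem norm_homogExtDeriv_sq_le {h : E → ℝ} {L : ℝ} (h1 : ∀ u : E, ‖u‖ = 1 → |h u| ≤ L)
    (h2 : ∀ u : E, ‖u‖ = 1 → ‖fderiv ℝ h u‖ ≤ L) {x : E} (hx : x ≠ 0) :
    ‖homogExtDeriv h x‖ ^ 2 ≤ 2 * L ^ 2 := by
  set u := ‖x‖⁻¹ • x with hu
  have hu1 : ‖u‖ = 1 := norm_smul_inv_norm hx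
  have hL : 0 ≤ L := (abs_nonneg _).trans (h1 u hu1)
  have : ‖homogExtDeriv h x‖ ≤ √(2 * L ^ 2) := by
    refine ContinuousLinearMap.opNorm_le_bound _ (by positivity) fun y => ?_
    rw [homogExtDeriv_apply, ← hu]
    set s : ℝ := inner ℝ u y
    set z := y - s • u
    have hz : ‖y‖ ^ 2 = s ^ 2 + ‖z‖ ^ 2 := by
      have hus : inner ℝ y u = s := real_inner_comm u y
      rw [norm_sub_sq_real, real_inner_smul_right, hus, norm_smul, hu1, Real.norm_eq_abs, mul_one,
        sq_abs]
      ring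
    have h3 : ‖s * h u + fderiv ℝ h u z‖ ≤ L * (|s| + ‖z‖) := by
      refine (norm_add_le _ _).trans ?_
      rw [norm_mul, Real.norm_eq_abs, Real.norm_eq_abs]
      have := (fderiv ℝ h u).le_of_opNorm_le (h2 u hu1) z
      have := mul_le_mul_of_nonneg_left (h1 u hu1) (abs_nonneg s)
      linarith
    refine h3.trans (le_of_sq_le_sq ?_ (by positivity))
    rw [mul_pow, mul_pow, Real.sq_sqrt (by positivity), hz, ← sq_abs s]
    nlinarith [mul_nonneg (sq_nonneg L) (sq_nonneg (|s| - ‖z‖))]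
  calc _ ≤ √(2 * L ^ 2) ^ 2 := by gcongr
    _ = _ := Real.sq_sqrt (by positivity)

/-- If a combination with coefficients on the unit circle vanishes, the Cauchy-Schwarz inequality
is an equality. -/
theorem inner_sq_eq_of_cos_smul_add_sin_smul_eq_zero {x y : E} {θ : ℝ}
    (h : cos θ • x + sin θ • y = 0) : inner ℝ x y ^ 2 = ‖x‖ ^ 2 * ‖y‖ ^ 2 := by
  have h1 : inner ℝ x (cos θ • x + sin θ • y) = (0 : ℝ) := by rw [h, inner_zero_right]
  have h2 : inner ℝ y (cos θ • x + sin θ • y) = (0 : ℝ) := by rw [h, inner_zero_right]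
  simp only [inner_add_right, real_inner_smul_right, real_inner_self_eq_norm_sq,
    real_inner_comm x y] at h1 h2
  have h3 := Real.cos_sq_add_sin_sq θ
  have h4 : cos θ * (‖x‖ ^ 2 * ‖y‖ ^ 2 - inner ℝ x y ^ 2) = 0 := by
    linear_combination ‖y‖ ^ 2 * h1 - inner ℝ x y * h2
  have h5 : sin θ * (‖x‖ ^ 2 * ‖y‖ ^ 2 - inner ℝ x y ^ 2) = 0 := by
    linear_combination ‖x‖ ^ 2 * h2 - inner ℝ x y * h1
  linear_combination (‖x‖ ^ 2 * ‖y‖ ^ 2 - inner ℝ x y ^ 2) * h3 - cos θ * h4 - sin θ * h5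

variable [FiniteDimensional ℝ E] [MeasurableSpace E] [BorelSpace E]

theorem measurable_homogExt {h : E → ℝ} (hh : ContDiff ℝ 1 h) : Measurable (homogExt h) := by
  have := hh.continuous.measurable
  unfold homogExt
  fun_prop

theorem measurable_homogExtDeriv {h : E → ℝ} (hh : ContDiff ℝ 1 h) :
    Measurable fun p : E × E => homogExtDeriv h p.1 p.2 := by
  have h1 := hh.continuous.measurable
  have h2 : Measurable fun p : E × E => (fderiv ℝ h p.1) p.2 :=
    ((hh.continuous_fderiv (by simp)).comp continuous_fst |>.clm_apply continuous_snd).measurable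
  simp_rw [homogExtDeriv_apply]
  have h3 : Measurable fun p : E × E => (‖p.1‖⁻¹ • p.1,
      p.2 - (inner ℝ (‖p.1‖⁻¹ • p.1) p.2 : ℝ) • (‖p.1‖⁻¹ • p.1)) := by fun_prop
  exact (by fun_prop : Measurable fun p : E × E => inner ℝ (‖p.1‖⁻¹ • p.1) p.2 *
    h (‖p.1‖⁻¹ • p.1)).add (h2.comp h3)

/-- Two independent Gaussian vectors are almost surely not parallel. -/
theorem ae_inner_sq_ne_stdGaussian (hd : 2 ≤ finrank ℝ E) :
    ∀ᵐ p : E × E ∂((stdGaussian E).prod (stdGaussian E)),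
      inner ℝ p.1 p.2 ^ 2 ≠ ‖p.1‖ ^ 2 * ‖p.2‖ ^ 2 := by
  have : Nontrivial E := nontrivial_of_finrank_pos (R := ℝ) (by omega)
  have hspan : ∀ x : E, stdGaussian E (ℝ ∙ x : Submodule ℝ E) = 0 := by
    intro x
    refine stdGaussian_absolutelyContinuous (Measure.addHaar_submodule _ _ fun htop => ?_)
    have h1 := finrank_span_le_card (R := ℝ) ({x} : Set E)
    rw [htop, finrank_top, Set.toFinset_singleton, Finset.card_singleton] at h1
    omega
  have hm : MeasurableSet {p : E × E | inner ℝ p.1 p.2 ^ 2 = ‖p.1‖ ^ 2 * ‖p.2‖ ^ 2} :=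
    (isClosed_eq (by fun_prop) (by fun_prop)).measurableSet
  rw [ae_iff]
  simp only [ne_eq, not_not]
  rw [Measure.measure_prod_null hm]
  have h0 : ∀ᵐ x : E ∂(stdGaussian E), x ≠ 0 := by
    have := hspan 0
    simpa [ae_iff] using this
  filter_upwards [h0] with x hx
  refine measure_mono_null (fun y hy => ?_) (hspan x)
  have hy' : inner ℝ x y ^ 2 = ‖x‖ ^ 2 * ‖y‖ ^ 2 := hy
  have hx' : 0 < ‖x‖ := norm_pos_iff.2 hx
  refine Submodule.mem_span_singleton.2 ⟨inner ℝ x y / ‖x‖ ^ 2, ?_⟩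
  rw [← sub_eq_zero, ← norm_eq_zero, ← sq_eq_zero_iff, norm_sub_sq_real, real_inner_smul_left,
    norm_smul, Real.norm_eq_abs, mul_pow, sq_abs]
  field_simp
  linear_combination -hy'

/-- Wirtinger's inequality along the great circles through independent Gaussian vectors. -/
theorem lintegral_homogExt_sq_le {h : E → ℝ} (hh : ContDiff ℝ 1 h) (hodd : ∀ x, h (-x) = - h x)
    {L : ℝ} (h1 : ∀ u : E, ‖u‖ = 1 → |h u| ≤ L) (h2 : ∀ u : E, ‖u‖ = 1 → ‖fderiv ℝ h u‖ ≤ L)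
    (hd : 2 ≤ finrank ℝ E) :
    ∫⁻ x, ENNReal.ofReal (homogExt h x ^ 2) ∂(stdGaussian E) ≤ ENNReal.ofReal (2 * L ^ 2) := by
  set γ := stdGaussian E with hγ
  have : Nontrivial E := nontrivial_of_finrank_pos (R := ℝ) (by omega)
  have hmH := measurable_homogExt hh
  have hmN := measurable_homogExtDeriv hh
  -- position and velocity of the curve `cos θ x + sin θ y` are the rotated pair, with the same law
  have hrot : ∀ θ, MeasurePreserving (ContinuousLinearMap.rotation θ : E × E → E × E)
      (γ.prod γ) (γ.prod γ) := fun θ => ⟨by fun_prop,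
    IsGaussian.map_rotation_eq_self_of_forall_strongDual_eq_zero
      (fun l => integral_strongDual_stdGaussian l) θ⟩
  have hcirc : ∀ᵐ p : E × E ∂(γ.prod γ),
      ∫⁻ θ in Ioc 0 (2 * π), ENNReal.ofReal (homogExt h (ContinuousLinearMap.rotation θ p).1 ^ 2) ≤
      ∫⁻ θ in Ioc 0 (2 * π), ENNReal.ofReal (homogExtDeriv h (ContinuousLinearMap.rotation θ p).1
        (ContinuousLinearMap.rotation θ p).2 ^ 2) := by
    filter_upwards [ae_inner_sq_ne_stdGaussian hd] with p hp
    simp only [ContinuousLinearMap.rotation_apply]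
    set c : ℝ → E := fun θ => cos θ • p.1 + sin θ • p.2
    set c' : ℝ → E := fun θ => -sin θ • p.1 + cos θ • p.2
    have hc : ∀ θ, HasDerivAt c (c' θ) θ := fun θ =>
      ((hasDerivAt_cos θ).smul_const p.1).add ((hasDerivAt_sin θ).smul_const p.2)
    have hne : ∀ θ, c θ ≠ 0 := fun θ h0 =>
      hp (inner_sq_eq_of_cos_smul_add_sin_smul_eq_zero h0)
    have hcc : Continuous c := by fun_prop
    have hcc' : Continuous c' := by fun_prop
    have huc : Continuous fun θ => ‖c θ‖⁻¹ • c θ :=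
      (hcc.norm.inv₀ fun θ => (norm_pos_iff.2 (hne θ)).ne').smul hcc
    have hf' : Continuous fun θ => homogExtDeriv h (c θ) (c' θ) := by
      simp_rw [homogExtDeriv_apply]
      have h3 := hh.continuous.comp huc
      have h4 := (hh.continuous_fderiv (by simp)).comp huc
      exact ((huc.inner hcc').mul h3).add (h4.clm_apply (hcc'.sub ((huc.inner hcc').smul huc)))
    have hder := fun θ => hasDerivAt_homogExt_comp hh (hc θ) (hne θ)
    have hf : Continuous fun θ => homogExt h (c θ) :=
      continuous_iff_continuousAt.2 fun θ => (hder θ).continuousAt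
    have hanti : ∀ θ, homogExt h (c (θ + π)) = - homogExt h (c θ) := by
      intro θ
      have : c (θ + π) = - c θ := by
        simp only [c, cos_add_pi, sin_add_pi, neg_smul]
        abel
      simp only [this, homogExt, norm_neg, smul_neg, hodd]
      ring
    have key := integral_sq_le_of_antiperiodic hder hf' hanti
    rw [intervalIntegral.integral_of_le (by positivity),
      intervalIntegral.integral_of_le (by positivity)] at key
    change ∫⁻ θ in Ioc 0 (2 * π), ENNReal.ofReal (homogExt h (c θ) ^ 2) ≤
      ∫⁻ θ in Ioc 0 (2 * π), ENNReal.ofReal (homogExtDeriv h (c θ) (c' θ) ^ 2)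
    have hf2 : Continuous fun θ => homogExt h (c θ) ^ 2 := hf.pow 2
    have hf2' : Continuous fun θ => homogExtDeriv h (c θ) (c' θ) ^ 2 := hf'.pow 2
    rw [← ofReal_integral_eq_lintegral_ofReal
        (hf2.integrableOn_Icc.mono_set Ioc_subset_Icc_self)
        (Eventually.of_forall fun _ => sq_nonneg _),
      ← ofReal_integral_eq_lintegral_ofReal
        (hf2'.integrableOn_Icc.mono_set Ioc_subset_Icc_self)
        (Eventually.of_forall fun _ => sq_nonneg _)]
    exact ENNReal.ofReal_le_ofReal key
  have hcont : Continuous fun q : (E × E) × ℝ =>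
      (ContinuousLinearMap.rotation q.2 q.1 : E × E) := by
    simp only [ContinuousLinearMap.rotation_apply]
    fun_prop
  have key := lintegral_mono_ae hcirc
  rw [lintegral_lintegral_swap
      (f := fun p θ => ENNReal.ofReal (homogExt h (ContinuousLinearMap.rotation θ p).1 ^ 2))
      (((hmH.comp (measurable_fst.comp hcont.measurable)).pow_const 2).ennreal_ofReal).aemeasurable,
    lintegral_lintegral_swap
      (f := fun p θ => ENNReal.ofReal (homogExtDeriv h (ContinuousLinearMap.rotation θ p).1
        (ContinuousLinearMap.rotation θ p).2 ^ 2))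
      (((hmN.comp hcont.measurable).pow_const 2).ennreal_ofReal).aemeasurable] at key
  have hl : ∀ θ, ∫⁻ p : E × E, ENNReal.ofReal (homogExt h (ContinuousLinearMap.rotation θ p).1 ^ 2)
      ∂(γ.prod γ) = ∫⁻ x, ENNReal.ofReal (homogExt h x ^ 2) ∂γ := by
    intro θ
    rw [(hrot θ).lintegral_comp (f := fun p : E × E => ENNReal.ofReal (homogExt h p.1 ^ 2))
      (by fun_prop), lintegral_prod _ (by fun_prop)]
    simp
  have hr : ∀ θ, ∫⁻ p : E × E, ENNReal.ofReal (homogExtDeriv h (ContinuousLinearMap.rotation θ p).1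
      (ContinuousLinearMap.rotation θ p).2 ^ 2) ∂(γ.prod γ) ≤ ENNReal.ofReal (2 * L ^ 2) := by
    intro θ
    rw [(hrot θ).lintegral_comp
      (f := fun p : E × E => ENNReal.ofReal (homogExtDeriv h p.1 p.2 ^ 2))
      ((hmN.pow_const 2).ennreal_ofReal),
      lintegral_prod _ ((hmN.pow_const 2).ennreal_ofReal).aemeasurable]
    have h0 : ∀ᵐ x : E ∂γ, x ≠ 0 := by
      have : γ ({0} : Set E) = 0 :=
        stdGaussian_absolutelyContinuous (measure_singleton (0 : E))
      simpa [ae_iff] using this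
    calc _ ≤ ∫⁻ _, ENNReal.ofReal (2 * L ^ 2) ∂γ := by
          refine lintegral_mono_ae (h0.mono fun x hx => ?_)
          have := lintegral_sq_stdGaussian (homogExtDeriv h x)
          refine this.trans_le ?_
          exact ENNReal.ofReal_le_ofReal (norm_homogExtDeriv_sq_le h1 h2 hx)
      _ = _ := by simp
  simp_rw [hl] at key
  have hv : volume (Ioc 0 (2 * π)) ≠ 0 := by simp [pi_pos]
  have hv' : volume (Ioc 0 (2 * π)) ≠ ⊤ := measure_Ioc_lt_top.ne
  have key2 := key.trans (lintegral_mono hr)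
  simp only [lintegral_const, Measure.restrict_apply_univ] at key2
  exact (ENNReal.mul_le_mul_iff_left hv hv').1 key2

/-- The Poincaré inequality for odd functions on the unit sphere, in terms of a common bound on
the function and its derivative. -/
theorem lintegral_sphere_sq_le_of_odd {h : E → ℝ} (hh : ContDiff ℝ 1 h) (hodd : ∀ x, h (-x) = - h x)
    {L : ℝ} (h1 : ∀ u : E, ‖u‖ = 1 → |h u| ≤ L) (h2 : ∀ u : E, ‖u‖ = 1 → ‖fderiv ℝ h u‖ ≤ L)
    [Nontrivial E] :
    (finrank ℝ E : ENNReal) * ∫⁻ u : sphere (0 : E) 1, ENNReal.ofReal (h u ^ 2)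
      ∂(volume : Measure E).toSphere ≤
      (volume : Measure E).toSphere univ * ENNReal.ofReal (2 * L ^ 2) := by
  have hd0 : 0 < finrank ℝ E := finrank_pos
  rcases (by omega : finrank ℝ E = 1 ∨ 2 ≤ finrank ℝ E) with hd | hd
  · rw [hd, Nat.cast_one, one_mul, mul_comm, ← lintegral_const]
    refine lintegral_mono fun u => ENNReal.ofReal_le_ofReal ?_
    have := h1 u (norm_eq_of_mem_sphere u)
    nlinarith [sq_abs (h u), abs_nonneg (h u)]
  · have hm := hh.continuous.measurable
    rw [lintegral_norm_sq_mul_direction (ψ := fun x => ENNReal.ofReal (h x ^ 2)) (by fun_prop)]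
    gcongr
    refine le_trans (le_of_eq (lintegral_congr fun x => ?_)) (lintegral_homogExt_sq_le hh hodd h1 h2 hd)
    rw [← ENNReal.ofReal_mul (by positivity), homogExt, mul_pow]

end Poincare

/-! ### Measurability of the costs and of the gradient estimates -/

namespace LQR

variable {m n : ℕ} {S : LQR m n} {Cm : ℝ} {Kstar K0 : Policy m n}

theorem continuous_stageCost_uncurry (t : ℕ) :
    Continuous fun p : Policy m n × State n => S.stageCost p.1 p.2 t := by
  have h1 : Continuous fun p : Policy m n × State n => S.traj p.1 p.2 t := by
    simp_rw [traj_eq]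
    exact ((S.continuous_clOp.comp continuous_fst).pow t).clm_apply continuous_snd
  simp_rw [stageCost_eq]
  exact h1.inner ((S.contDiff_stageOp.continuous.comp continuous_fst).clm_apply h1)

theorem continuous_truncCost_uncurry (T : ℕ) :
    Continuous fun p : Policy m n × State n => S.truncCost T p.1 p.2 :=
  continuous_finsetSum _ fun t _ => continuous_stageCost_uncurry t

/-- Joint measurability of the series `costFrom` holds for all policies: it is `ENNReal.toReal` of
a series in `[0, ∞]`, also where it diverges and both have the value zero. -/
theorem Standing.measurable_costFrom_uncurry (hS : S.Standing Cm) :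
    Measurable fun p : Policy m n × State n => S.costFrom p.1 p.2 := by
  have h : ∀ p : Policy m n × State n, S.costFrom p.1 p.2 =
      ((∑' t, ENNReal.ofReal (S.stageCost p.1 p.2 t)).toReal) := by
    intro p
    rw [ENNReal.tsum_toReal_eq fun t => ENNReal.ofReal_ne_top]
    exact tsum_congr fun t => (ENNReal.toReal_ofReal (hS.stageCost_nonneg _ _ _)).symm
  simp_rw [h]
  exact (Measurable.tsum fun t =>
    (continuous_stageCost_uncurry t).measurable.ennreal_ofReal).ennreal_toReal

theorem Standing.measurable_cost (hS : S.Standing Cm) : Measurable S.cost := by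
  have := hS.prob
  exact (hS.measurable_costFrom_uncurry.stronglyMeasurable.integral_prod_right
    (ν := S.D)).measurable

end LQR

theorem measurable_gradEst {m n : ℕ} (σ : Setting) {J : Policy m n → State n → ℝ}
    (hJ : Measurable fun p : Policy m n × State n => J p.1 p.2) (r : ℝ) :
    Measurable fun q : Policy m n × (State n × Policy m n) => gradEst σ J r q.1 q.2.2 q.2.1 := by
  have h1 : Measurable fun q : Policy m n × (State n × Policy m n) => J (q.1 + r • q.2.2) q.2.1 :=
    hJ.comp (f := fun q : Policy m n × (State n × Policy m n) => (q.1 + r • q.2.2, q.2.1))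
      (by fun_prop)
  have h2 : Measurable fun q : Policy m n × (State n × Policy m n) => J (q.1 - r • q.2.2) q.2.1 :=
    hJ.comp (f := fun q : Policy m n × (State n × Policy m n) => (q.1 - r • q.2.2, q.2.1))
      (by fun_prop)
  cases σ <;> simp only [gradEst] <;> fun_prop

/-! ### The error of a finite rollout -/

theorem norm_gradEst_sub_le {m n : ℕ} (σ : Setting) {J J' : Policy m n → State n → ℝ} {r τ : ℝ}
    (hr : 0 < r) {K D : Policy m n} {x : State n} (hD : ‖D‖ = 1)
    (h1 : |J (K + r • D) x - J' (K + r • D) x| ≤ τ)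
    (h2 : |J (K - r • D) x - J' (K - r • D) x| ≤ τ) :
    ‖gradEst σ J r K D x - gradEst σ J' r K D x‖ ≤ τ * ((m * n : ℝ) / r) := by
  cases σ <;> simp only [gradEst]
  · rw [← sub_smul, norm_smul, hD, mul_one, ← sub_mul, norm_mul, Real.norm_eq_abs,
      Real.norm_eq_abs, abs_of_nonneg (by positivity : 0 ≤ (m * n : ℝ) / r)]
    gcongr
  · rw [← sub_smul, norm_smul, hD, mul_one, ← sub_mul, norm_mul, Real.norm_eq_abs,
      Real.norm_eq_abs, abs_of_nonneg (by positivity : 0 ≤ (m * n : ℝ) / (2 * r))]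
    have h3 : |J (K + r • D) x - J (K - r • D) x - (J' (K + r • D) x - J' (K - r • D) x)| ≤ 2 * τ := by
      rw [abs_le] at *
      constructor <;> linarith [h1.1, h1.2, h2.1, h2.2]
    calc _ ≤ 2 * τ * ((m * n : ℝ) / (2 * r)) := by gcongr
      _ = _ := by field_simp

namespace LQR

variable {m n : ℕ} {S : LQR m n} {Cm : ℝ} {Kstar K0 : Policy m n}

theorem specNorm_eq_norm_stageOp (S : LQR m n) (K : Policy m n) :
    specNorm (S.Q + K.matᵀ * S.R * K.mat) = ‖S.stageOp K‖ := by
  have : opOf (S.Q + K.matᵀ * S.R * K.mat) = S.stageOp K := by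
    ext x : 1
    refine ext_inner_left ℝ fun y => ?_
    rw [stageOp, add_apply, inner_add_right, ContinuousLinearMap.comp_apply,
      ContinuousLinearMap.adjoint_inner_right, ContinuousLinearMap.comp_apply, gainL_apply,
      gainL_apply, opOf_apply, opOf_apply, opOf_apply]
    simp only [EuclideanSpace.inner_eq_star_dotProduct, star_trivial]
    rw [Matrix.add_mulVec, add_dotProduct, ← Matrix.mulVec_mulVec, ← Matrix.mulVec_mulVec,
      dotProduct_comm (K.matᵀ *ᵥ _), Matrix.dotProduct_mulVec, Matrix.vecMul_transpose,
      dotProduct_comm (K.mat *ᵥ y.ofLp)]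
  rw [← this]
  rfl

theorem Standing.norm_stageOp_le_costBound (hS : S.Standing Cm) {r : ℝ} {K : Policy m n}
    (hK : K ∈ S.rolloutSet Kstar K0 r) : ‖S.stageOp K‖ ≤ S.costBound Kstar K0 r := by
  rw [← specNorm_eq_norm_stageOp]
  refine le_csSup ?_ ⟨K, hK, rfl⟩
  simp_rw [specNorm_eq_norm_stageOp]
  exact (hS.isCompact_rolloutSet r).bddAbove_image S.contDiff_stageOp.continuous.norm.continuousOn

theorem Standing.abs_costFrom_sub_truncCost_le (hS : S.Standing Cm) {r M γ : ℝ}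
    (hdec : S.DecayConstants Kstar K0 r M γ) {K : Policy m n} (hK : K ∈ S.rolloutSet Kstar K0 r)
    (hst : K ∈ S.stab) (x : State n) (T : ℕ) :
    |S.costFrom K x - S.truncCost T K x| ≤
      M * S.costBound Kstar K0 r * ‖x‖ ^ 2 / (1 - γ ^ 2) * γ ^ (2 * T) := by
  obtain ⟨hM, hγ0, hγ1, hd⟩ := hdec
  have h1 : HasSum (fun t => S.stageCost K x (t + T)) (S.costFrom K x - S.truncCost T K x) := by
    rw [costFrom_eq hst]
    exact (hasSum_nat_add_iff' T).2 (hasSum_stageCost hst x)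
  have hγ2 : γ ^ 2 < 1 := by nlinarith
  have h2 : HasSum (fun t => S.costBound Kstar K0 r * M * ‖x‖ ^ 2 * γ ^ (2 * T) * (γ ^ 2) ^ t)
      (S.costBound Kstar K0 r * M * ‖x‖ ^ 2 * γ ^ (2 * T) * (1 - γ ^ 2)⁻¹) :=
    (hasSum_geometric_of_lt_one (sq_nonneg γ) hγ2).mul_left _
  rw [abs_of_nonneg (h1.nonneg fun t => hS.stageCost_nonneg _ _ _)]
  refine (hasSum_le (fun t => ?_) h1 h2).trans_eq (by field_simp)
  have hb := hS.norm_stageOp_le_costBound hK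
  rw [stageCost_eq]
  calc inner ℝ (S.traj K x (t + T)) (S.stageOp K (S.traj K x (t + T)))
      ≤ ‖S.traj K x (t + T)‖ * (S.costBound Kstar K0 r * ‖S.traj K x (t + T)‖) :=
        (real_inner_le_norm _ _).trans (by
          gcongr
          exact (S.stageOp K).le_of_opNorm_le hb _)
    _ = S.costBound Kstar K0 r * ‖S.traj K x (t + T)‖ ^ 2 := by ring
    _ ≤ S.costBound Kstar K0 r * (M * γ ^ (2 * (t + T)) * ‖x‖ ^ 2) := by
        have := (norm_nonneg _).trans hb
        gcongr
        exact hd K hK x _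
    _ = _ := by ring

/-- The rollout length needed for a tail `a γ ^ (2 T)` to be at most `b`, from `γ ≤ exp (γ - 1)`. -/
theorem mul_pow_le_of_log_le {a b γ : ℝ} (hb : 0 < b) (ha : 0 ≤ a) (hγ0 : 0 < γ)
    {T : ℕ} (h : Real.log (a / b) ≤ 2 * (1 - γ) * T) : a * γ ^ (2 * T) ≤ b := by
  rcases ha.eq_or_lt with rfl | ha
  · simpa using hb.le
  have h1 : a / b ≤ Real.exp (2 * (1 - γ) * T) := (Real.log_le_iff_le_exp (by positivity)).1 h
  have h2 : γ ^ (2 * T) ≤ Real.exp (-(2 * (1 - γ) * T)) := by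
    have : γ ≤ Real.exp (γ - 1) := by linarith [Real.add_one_le_exp (γ - 1)]
    calc γ ^ (2 * T) ≤ Real.exp (γ - 1) ^ (2 * T) := by gcongr
      _ = _ := by
        rw [← Real.exp_nat_mul]
        congr 1
        push_cast
        ring
  rw [div_le_iff₀ hb] at h1
  calc a * γ ^ (2 * T) ≤ Real.exp (2 * (1 - γ) * T) * b * Real.exp (-(2 * (1 - γ) * T)) := by
        gcongr
    _ = b := by rw [mul_right_comm, ← Real.exp_add, add_neg_cancel, Real.exp_zero, one_mul]

/-- The two logarithms in `rolloutBound` are the two terms of `pertBound`. -/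
theorem tail_le_pertBound {c : LocalConstants m n} {ε r M γ : ℝ} (hε : 0 < ε) (hr : 0 < r)
    (hμ : 0 < c.mu) (hθ : 0 < c.theta0 (S.sublevel Kstar K0))
    (hβ : 0 ≤ S.costBound Kstar K0 r) (hdec : S.DecayConstants Kstar K0 r M γ) {x : State n} {T : ℕ}
    (hT : S.rolloutBound c Kstar K0 ε r M γ x ≤ T) :
    M * S.costBound Kstar K0 r * ‖x‖ ^ 2 / (1 - γ ^ 2) * γ ^ (2 * T) * ((m * n : ℝ) / r) ≤
      c.pertBound (S.sublevel Kstar K0) ε := by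
  obtain ⟨hM, hγ0, hγ1, -⟩ := hdec
  have hγ2 : 0 < 1 - γ ^ 2 := by nlinarith
  have hγ' : 0 < 1 - γ := by linarith
  simp only [rolloutBound, one_div, inv_mul_le_iff₀ (by positivity : 0 < 2 * (1 - γ))] at hT
  unfold LocalConstants.pertBound
  set β := S.costBound Kstar K0 r
  set θ := c.theta0 (S.sublevel Kstar K0)
  set a := M * β * ‖x‖ ^ 2 / (1 - γ ^ 2) * ((m * n : ℝ) / r) with ha
  have ha0 : 0 ≤ a := by positivity
  rw [mul_right_comm, ← ha]
  refine le_min (mul_pow_le_of_log_le (by positivity) ha0 hγ0 ?_)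
    (mul_pow_le_of_log_le (by positivity) ha0 hγ0 ?_)
  · refine le_trans (le_of_eq ?_) ((le_max_left _ _).trans hT)
    congr 1
    rw [Real.sqrt_div hε.le, ha]
    field_simp
  · refine le_trans (le_of_eq ?_) ((le_max_right _ _).trans hT)
    congr 1
    rw [Real.sqrt_div (by positivity), ha]
    field_simp

/-- The error of the gradient estimate from finite rollouts. -/
theorem Standing.norm_gradEst_sub_le_pertBound (hS : S.Standing Cm) {c : LocalConstants m n}
    (hc : c.Admissible S Kstar K0) {ε r M γ : ℝ} (hε : 0 < ε) (hr : 0 < r)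
    (hrρ : r ≤ c.rho0 (S.sublevel Kstar K0)) (hdec : S.DecayConstants Kstar K0 r M γ)
    {K D : Policy m n} (hK : K ∈ S.sublevel Kstar K0) (hD : ‖D‖ = 1) {x : State n} {T : ℕ}
    (hT : S.rolloutBound c Kstar K0 ε r M γ x ≤ T) (σ : Setting) :
    ‖gradEst σ S.costFrom r K D x - gradEst σ (S.truncCost T) r K D x‖ ≤
      c.pertBound (S.sublevel Kstar K0) ε := by
  have hrD : ‖r • D‖ ≤ r := by rw [norm_smul, hD, mul_one, Real.norm_eq_abs, abs_of_pos hr]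
  have h1 : K + r • D ∈ S.rolloutSet Kstar K0 r := ⟨K, hK, by simpa using hrD⟩
  have h2 : K - r • D ∈ S.rolloutSet Kstar K0 r := ⟨K, hK, by simpa using hrD⟩
  have hst := hc.rolloutSet_subset hrρ
  exact (norm_gradEst_sub_le σ hr hD (hS.abs_costFrom_sub_truncCost_le hdec h1 (hst h1) x T)
    (hS.abs_costFrom_sub_truncCost_le hdec h2 (hst h2) x T)).trans
    (tail_le_pertBound hε hr hc.mu_pos (hc.theta0_pos hK)
      ((norm_nonneg _).trans (hS.norm_stageOp_le_costBound h1)) hdec hT)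

end LQR

section UnifSphere

open Set Metric Module

/-! ### Averages over the uniform distribution on the unit sphere -/

/-- A function that is `C¹` near the closed unit ball is there the restriction of a `C¹` function;
the cutoff is even, so that it preserves oddness. -/
theorem exists_even_cutoff {E : Type*} [NormedAddCommGroup E] [InnerProductSpace ℝ E]
    [FiniteDimensional ℝ E] {f : E → ℝ} (hf : ∀ x ∈ closedBall (0 : E) 1, ContDiffAt ℝ 1 f x) :
    ∃ χ : E → ℝ, (∀ x, χ (-x) = χ x) ∧ ContDiff ℝ 1 (fun x => χ x * f x) ∧
      ∀ x ∈ closedBall (0 : E) 1, (fun y => χ y * f y) =ᶠ[𝓝 x] f := by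
  have hU : IsOpen {x | ContDiffAt ℝ 1 f x} :=
    isOpen_iff_mem_nhds.2 fun x hx => ContDiffAt.eventually hx (by simp)
  obtain ⟨δ, hδ, hsub⟩ := (isCompact_closedBall (0 : E) 1).exists_cthickening_subset_open hU
    fun x hx => hf x hx
  rw [cthickening_closedBall hδ.le zero_le_one] at hsub
  set χ : ContDiffBump (0 : E) := ⟨1 + δ / 2, 1 + δ, by positivity, by linarith⟩ with hχ
  refine ⟨χ, χ.neg, contDiff_iff_contDiffAt.2 fun x => ?_, fun x hx => ?_⟩
  · by_cases hx : x ∈ closedBall (0 : E) (δ + 1)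
    · exact χ.contDiffAt.mul (hsub hx)
    · have h0 : (fun y => χ y * f y) =ᶠ[𝓝 x] fun _ => 0 := by
        filter_upwards [isClosed_closedBall.isOpen_compl.mem_nhds hx] with y hy
        have : 1 + δ ≤ dist y 0 := by
          have h2 : ¬ dist y 0 ≤ δ + 1 := hy
          linarith
        rw [χ.zero_of_le_dist this, zero_mul]
      exact contDiffAt_const.congr_of_eventuallyEq h0
  · have hx' : x ∈ ball (0 : E) (1 + δ / 2) := by
      rw [mem_closedBall] at hx
      rw [mem_ball]
      linarith
    filter_upwards [isOpen_ball.mem_nhds hx'] with y hy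
    rw [χ.one_of_mem_closedBall (ball_subset_closedBall hy), one_mul]

variable {m n : ℕ}

theorem nontrivial_policy (hm : 0 < m) (hn : 0 < n) : Nontrivial (Policy m n) := by
  refine nontrivial_of_finrank_pos (R := ℝ) ?_
  rw [finrank_euclideanSpace, Fintype.card_prod, Fintype.card_fin, Fintype.card_fin]
  positivity

theorem toSphere_univ_ne_zero [Nontrivial (Policy m n)] :
    (volume : Measure (Policy m n)).toSphere univ ≠ 0 := by
  rw [Measure.toSphere_apply_univ]
  exact mul_ne_zero (Nat.cast_ne_zero.2 finrank_pos.ne') (measure_ball_pos _ _ one_pos).ne'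

theorem isProbabilityMeasure_unifSphere [Nontrivial (Policy m n)] :
    IsProbabilityMeasure (unifSphere m n) := by
  constructor
  rw [unifSphere, Measure.map_apply (by fun_prop) MeasurableSet.univ, preimage_univ,
    Measure.smul_apply, smul_eq_mul,
    ENNReal.inv_mul_cancel toSphere_univ_ne_zero (measure_ne_top _ _)]

theorem ae_norm_eq_one_unifSphere : ∀ᵐ D ∂(unifSphere m n), ‖D‖ = 1 := by
  rw [unifSphere, ae_map_iff (by fun_prop) (measurableSet_eq_fun (by fun_prop) (by fun_prop))]
  exact Eventually.of_forall fun u => norm_eq_of_mem_sphere u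

theorem lintegral_unifSphere (f : Policy m n → ENNReal) :
    ∫⁻ D, f D ∂(unifSphere m n) = ((volume : Measure (Policy m n)).toSphere univ)⁻¹ *
      ∫⁻ u : sphere (0 : Policy m n) 1, f u ∂(volume : Measure (Policy m n)).toSphere := by
  rw [unifSphere, (MeasurableEmbedding.subtype_coe isClosed_sphere.measurableSet).lintegral_map,
    lintegral_smul_measure, smul_eq_mul]

theorem integral_unifSphere (f : Policy m n → ℝ) :
    ∫ D, f D ∂(unifSphere m n) = ((volume : Measure (Policy m n)).toSphere.real univ)⁻¹ *
      ∫ u : sphere (0 : Policy m n) 1, f u ∂(volume : Measure (Policy m n)).toSphere := by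
  rw [unifSphere, (MeasurableEmbedding.subtype_coe isClosed_sphere.measurableSet).integral_map,
    integral_smul_measure, smul_eq_mul, ENNReal.toReal_inv]
  rfl

theorem finrank_policy : finrank ℝ (Policy m n) = m * n := by
  rw [finrank_euclideanSpace, Fintype.card_prod, Fintype.card_fin, Fintype.card_fin]

/-- The smoothing identity behind zeroth-order gradient estimates, as an inequality: the average of
`d f(D) D` is the average gradient over the ball. -/
theorem abs_integral_unifSphere_mul_inner_sub_le [Nontrivial (Policy m n)] {f : Policy m n → ℝ}
    (hf : ∀ x ∈ closedBall (0 : Policy m n) 1, ContDiffAt ℝ 1 f x) (e : Policy m n) {a b : ℝ}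
    (hab : ∀ x ∈ ball (0 : Policy m n) 1, |fderiv ℝ f x e - a| ≤ b) :
    |(m * n : ℝ) * ∫ D, f D * inner ℝ D e ∂(unifSphere m n) - a| ≤ b := by
  obtain ⟨χ, -, hχ, heq⟩ := exists_even_cutoff hf
  have h := abs_average_sphere_sub_le (volume : Measure (Policy m n)) hχ e (a := a) (b := b)
    fun x hx => by
      rw [(heq x (ball_subset_closedBall hx)).fderiv_eq]
      exact hab x hx
  rw [finrank_policy, Nat.cast_mul] at h
  rw [integral_unifSphere]
  convert h using 6
  funext u
  rw [(heq u (sphere_subset_closedBall u.2)).eq_of_nhds]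

theorem lintegral_unifSphere_sq_le [Nontrivial (Policy m n)] {f : Policy m n → ℝ}
    (hf : ∀ x ∈ closedBall (0 : Policy m n) 1, ContDiffAt ℝ 1 f x) (hodd : ∀ x, f (-x) = - f x)
    {L : ℝ} (h1 : ∀ u : Policy m n, ‖u‖ = 1 → |f u| ≤ L)
    (h2 : ∀ u : Policy m n, ‖u‖ = 1 → ‖fderiv ℝ f u‖ ≤ L) :
    (m * n : ENNReal) * ∫⁻ D, ENNReal.ofReal (f D ^ 2) ∂(unifSphere m n) ≤
      ENNReal.ofReal (2 * L ^ 2) := by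
  obtain ⟨χ, heven, hχ, heq⟩ := exists_even_cutoff hf
  have hmem : ∀ u : Policy m n, ‖u‖ = 1 → u ∈ closedBall (0 : Policy m n) 1 := fun u hu => by
    simp [hu]
  have h := lintegral_sphere_sq_le_of_odd (L := L) hχ (fun x => by rw [heven, hodd, mul_neg])
    (fun u hu => by rw [(heq u (hmem u hu)).eq_of_nhds]; exact h1 u hu)
    (fun u hu => by rw [(heq u (hmem u hu)).fderiv_eq]; exact h2 u hu)
  rw [finrank_policy, Nat.cast_mul] at h
  have h3 : ∫⁻ u : sphere (0 : Policy m n) 1, ENNReal.ofReal ((χ u * f u) ^ 2)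
      ∂(volume : Measure (Policy m n)).toSphere =
      ∫⁻ u : sphere (0 : Policy m n) 1, ENNReal.ofReal (f u ^ 2)
        ∂(volume : Measure (Policy m n)).toSphere :=
    lintegral_congr fun u => by rw [(heq u (sphere_subset_closedBall u.2)).eq_of_nhds]
  rw [h3] at h
  rw [lintegral_unifSphere, mul_left_comm]
  calc _ ≤ ((volume : Measure (Policy m n)).toSphere univ)⁻¹ *
        ((volume : Measure (Policy m n)).toSphere univ * ENNReal.ofReal (2 * L ^ 2)) := by gcongr
    _ = _ := by
      rw [← mul_assoc, ENNReal.inv_mul_cancel toSphere_univ_ne_zero (measure_ne_top _ _), one_mul]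

end UnifSphere

/-! ### Mean and second moment of the exact gradient estimate -/

/-- The almost sure bound on the norm of the exact gradient estimate. -/
def LocalConstants.estBound {m n : ℕ} (c : LocalConstants m n) (S : LQR m n) (Kstar K0 : Policy m n)
    (σ : Setting) (Cm r : ℝ) : ℝ :=
  match σ with
  | .onePoint => 20 * Cm * S.cost K0 * (m * n : ℝ) / r
  | .twoPoint => (m * n : ℝ) * c.lamT0 (S.sublevel Kstar K0)

/-- The bound on the second moment of the exact gradient estimate. In the two-point setting it is
smaller by the factor `d / 2` than the square of the almost sure bound. -/
def LocalConstants.estVar {m n : ℕ} (c : LocalConstants m n) (S : LQR m n) (Kstar K0 : Policy m n)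
    (σ : Setting) (Cm r : ℝ) : ℝ :=
  match σ with
  | .onePoint => (20 * Cm * S.cost K0 * (m * n : ℝ) / r) ^ 2
  | .twoPoint => 2 * (m * n : ℝ) * c.lamT0 (S.sublevel Kstar K0) ^ 2

namespace LQR

open Metric

variable {m n : ℕ} {S : LQR m n} {Cm : ℝ} {Kstar K0 K : Policy m n} {c : LocalConstants m n}

theorem contDiffAt_costFrom (hK : K ∈ S.stab) (x : State n) :
    ContDiffAt ℝ ⊤ (fun K => S.costFrom K x) K := by
  have h1 : ContDiffAt ℝ ⊤ (fun K => inner ℝ x (S.valueOp K x)) K :=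
    contDiffAt_const.inner ℝ ((contDiffAt_valueOp hK).clm_apply contDiffAt_const)
  refine h1.congr_of_eventuallyEq ?_
  filter_upwards [S.isOpen_stab.mem_nhds hK] with K' hK'
  exact costFrom_eq hK' x

theorem Standing.integrable_costFrom (hS : S.Standing Cm) (hK : K ∈ S.stab) :
    Integrable (S.costFrom K) S.D :=
  (hS.integrable_inner (S.valueOp K)).congr (Eventually.of_forall fun x => (costFrom_eq hK x).symm)

theorem norm_add_smul_sub_le (K : Policy m n) {s ρ : ℝ} (hs : |s| ≤ ρ) {v : Policy m n}
    (hv : ‖v‖ ≤ 1) : ‖K + s • v - K‖ ≤ ρ := by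
  rw [add_sub_cancel_left, norm_smul, Real.norm_eq_abs]
  exact (mul_le_of_le_one_right (abs_nonneg s) hv).trans hs

/-- The rescaled cost `v ↦ 𝒥(K + s v) / s` and its derivative. -/
theorem Standing.hasFDerivAt_cost_scaled (hS : S.Standing Cm) {s : ℝ} (hs : s ≠ 0) {v : Policy m n}
    (hst : K + s • v ∈ S.stab) :
    HasFDerivAt (fun v => S.cost (K + s • v) / s) (fderiv ℝ S.cost (K + s • v)) v := by
  have h1 : HasFDerivAt (fun v : Policy m n => K + s • v)
      (s • ContinuousLinearMap.id ℝ (Policy m n)) v :=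
    ((hasFDerivAt_id v).fun_const_smul s).const_add K
  have h2 := (((hS.contDiffAt_cost hst).differentiableAt (by simp)).hasFDerivAt.comp v h1).mul_const
    s⁻¹
  simp only [div_eq_mul_inv]
  exact h2.congr_fderiv (by ext e; simp [hs])

theorem Standing.contDiffAt_cost_scaled (hS : S.Standing Cm) {s : ℝ} {v : Policy m n}
    (hst : K + s • v ∈ S.stab) : ContDiffAt ℝ 1 (fun v => S.cost (K + s • v) / s) v := by
  have h1 : ContDiffAt ℝ 1 S.cost (K + s • v) := (hS.contDiffAt_cost hst).of_le le_top
  exact (h1.comp v (f := fun v : Policy m n => K + s • v) (by fun_prop)).div_const s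

theorem abs_fderiv_cost_sub_le (hc : c.Admissible S Kstar K0) (hK : K ∈ S.sublevel Kstar K0)
    {s : ℝ} (hs : |s| ≤ c.rho0 (S.sublevel Kstar K0)) {v : Policy m n} (hv : ‖v‖ ≤ 1)
    (e : Policy m n) :
    |fderiv ℝ S.cost (K + s • v) e - inner ℝ (gradient S.cost K) e| ≤
      c.phi0 (S.sublevel Kstar K0) * |s| * ‖e‖ := by
  rw [← inner_gradient, ← inner_sub_left]
  refine (abs_real_inner_le_norm _ _).trans ?_
  gcongr
  refine (hc.grad_lip' hK (norm_add_smul_sub_le K hs hv)).trans ?_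
  have := hc.phi0_pos hK
  gcongr
  exact norm_add_smul_sub_le K le_rfl hv

/-- The bias of the gradient estimate built from the exact mean cost. By the smoothing identity, its
mean over the directions is an average of `∇𝒥` over a ball of radius `r` around `K`. -/
theorem Standing.abs_integral_cost_estimate_sub_le (hS : S.Standing Cm) [Nontrivial (Policy m n)]
    (hc : c.Admissible S Kstar K0) (hK : K ∈ S.sublevel Kstar K0) {r : ℝ} (hr : 0 < r)
    (hrρ : r ≤ c.rho0 (S.sublevel Kstar K0)) (σ : Setting) (e : Policy m n) :
    |∫ D, inner ℝ (gradEst σ (fun K _ => S.cost K) r K D 0) e ∂(unifSphere m n) -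
      inner ℝ (gradient S.cost K) e| ≤ c.phi0 (S.sublevel Kstar K0) * r * ‖e‖ := by
  have hr1 : |r| ≤ c.rho0 (S.sublevel Kstar K0) := by rwa [abs_of_pos hr]
  have hr2 : |-r| ≤ c.rho0 (S.sublevel Kstar K0) := by rwa [abs_neg]
  have hst : ∀ s : ℝ, |s| ≤ c.rho0 (S.sublevel Kstar K0) → ∀ v ∈ closedBall (0 : Policy m n) 1,
      K + s • v ∈ S.stab := fun s hs v hv =>
    hc.mem_stab hK (norm_add_smul_sub_le K hs (mem_closedBall_zero_iff.1 hv))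
  set f : ℝ → Policy m n → ℝ := fun s v => S.cost (K + s • v) / s with hf
  have hf1 : ∀ s : ℝ, |s| ≤ c.rho0 (S.sublevel Kstar K0) → ∀ v ∈ closedBall (0 : Policy m n) 1,
      ContDiffAt ℝ 1 (f s) v := fun s hs v hv => hS.contDiffAt_cost_scaled (hst s hs v hv)
  have hb1 := fun v (hv : v ∈ ball (0 : Policy m n) 1) =>
    abs_fderiv_cost_sub_le hc hK hr1 (mem_ball_zero_iff.1 hv).le e
  have hb2 := fun v (hv : v ∈ ball (0 : Policy m n) 1) =>
    abs_fderiv_cost_sub_le hc hK hr2 (mem_ball_zero_iff.1 hv).le e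
  rw [abs_of_pos hr] at hb1
  rw [abs_neg, abs_of_pos hr] at hb2
  cases σ with
  | onePoint =>
    have h := abs_integral_unifSphere_mul_inner_sub_le (f := f r) (hf1 r hr1) e
      (a := inner ℝ (gradient S.cost K) e) (b := c.phi0 (S.sublevel Kstar K0) * r * ‖e‖)
      fun v hv => by
        rw [(hS.hasFDerivAt_cost_scaled hr.ne' (hst r hr1 v (ball_subset_closedBall hv))).fderiv]
        exact hb1 v hv
    rw [← integral_const_mul] at h
    have heq : ∀ D, inner ℝ (gradEst .onePoint (fun K _ => S.cost K) r K D (0 : State n)) e =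
        (m * n : ℝ) * (f r D * inner ℝ D e) := fun D => by
      simp only [gradEst, hf, real_inner_smul_left]
      field_simp
    simp_rw [heq]
    exact h
  | twoPoint =>
    have h := abs_integral_unifSphere_mul_inner_sub_le (f := fun v => 1 / 2 * (f r v + f (-r) v))
      (fun v hv => contDiffAt_const.mul ((hf1 r hr1 v hv).add (hf1 (-r) hr2 v hv))) e
      (a := inner ℝ (gradient S.cost K) e) (b := c.phi0 (S.sublevel Kstar K0) * r * ‖e‖)
      fun v hv => by
        have h1 := hS.hasFDerivAt_cost_scaled hr.ne' (hst r hr1 v (ball_subset_closedBall hv))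
        have h2 := hS.hasFDerivAt_cost_scaled (neg_ne_zero.2 hr.ne')
          (hst (-r) hr2 v (ball_subset_closedBall hv))
        rw [((h1.fun_add h2).const_mul (1 / 2 : ℝ)).fderiv, smul_apply, add_apply, smul_eq_mul]
        have h3 := abs_le.1 (hb1 v hv)
        have h4 := abs_le.1 (hb2 v hv)
        exact abs_le.2 ⟨by linarith [h3.1, h4.1], by linarith [h3.2, h4.2]⟩
    rw [← integral_const_mul] at h
    have heq : ∀ D, inner ℝ (gradEst .twoPoint (fun K _ => S.cost K) r K D (0 : State n)) e =
        (m * n : ℝ) * (1 / 2 * (f r D + f (-r) D) * inner ℝ D e) := fun D => by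
      simp only [gradEst, hf, real_inner_smul_left, neg_smul, ← sub_eq_add_neg]
      field_simp
      ring
    simp_rw [heq]
    exact h

/-- The mean over the initial state replaces `𝒥(·; x₀)` by `𝒥`; the latter does not depend on the
state, for which `0` is put. -/
theorem Standing.integral_gradEst (hS : S.Standing Cm) (hc : c.Admissible S Kstar K0)
    (hK : K ∈ S.sublevel Kstar K0) {r : ℝ} (hr : 0 < r) (hrρ : r ≤ c.rho0 (S.sublevel Kstar K0))
    (σ : Setting) {D : Policy m n} (hD : ‖D‖ = 1) (e : Policy m n) :
    ∫ x, inner ℝ (gradEst σ S.costFrom r K D x) e ∂S.D =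
      inner ℝ (gradEst σ (fun K _ => S.cost K) r K D 0) e := by
  have h1 : K + r • D ∈ S.stab :=
    hc.mem_stab hK (norm_add_smul_sub_le K (by rwa [abs_of_pos hr]) hD.le)
  have h2 : K - r • D ∈ S.stab := by
    have := norm_add_smul_sub_le K (s := -r) (ρ := c.rho0 (S.sublevel Kstar K0)) (by rwa [abs_neg, abs_of_pos hr]) hD.le
    rw [neg_smul, ← sub_eq_add_neg] at this
    exact hc.mem_stab hK this
  cases σ <;> simp only [gradEst, real_inner_smul_left]
  · rw [integral_mul_const, integral_mul_const]
    rfl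
  · rw [integral_mul_const, integral_mul_const,
      integral_sub (hS.integrable_costFrom h1) (hS.integrable_costFrom h2)]
    rfl

theorem Standing.cost_le_of_mem_sublevel (hS : S.Standing Cm) (hK : K ∈ S.sublevel Kstar K0) :
    S.cost K ≤ 10 * S.cost K0 := by
  have h1 := hK.2
  have h2 : 0 ≤ S.cost Kstar := hS.cost_nonneg Kstar
  simp only [gap] at h1
  linarith

theorem Standing.ae_norm_gradEst_le (hS : S.Standing Cm) (hc : c.Admissible S Kstar K0)
    (hK : K ∈ S.sublevel Kstar K0) {ε r : ℝ} (hr : 0 < r) {σ : Setting}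
    (hrad : c.RadiusCond S Kstar K0 σ ε r) :
    ∀ᵐ x ∂S.D, ∀ D : Policy m n, ‖D‖ = 1 →
      ‖gradEst σ S.costFrom r K D x‖ ≤ c.estBound S Kstar K0 σ Cm r := by
  obtain ⟨-, -, hrρ, hσ⟩ := hrad
  filter_upwards [hS.bounded, hc.costFrom_lip' hK] with x hx hlip D hD
  have hKD := norm_add_smul_sub_le K (s := r) (ρ := c.rho0 (S.sublevel Kstar K0)) (by rwa [abs_of_pos hr]) hD.le
  have hKD' := norm_add_smul_sub_le K (s := -r) (ρ := c.rho0 (S.sublevel Kstar K0)) (by rwa [abs_neg, abs_of_pos hr]) hD.le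
  rw [neg_smul, ← sub_eq_add_neg] at hKD'
  cases σ with
  | onePoint =>
    simp only at hσ
    have hlam := hc.lam0_pos hK
    rw [le_div_iff₀ hlam] at hσ
    have h1 := hS.costFrom_le (hc.mem_stab hK hKD) x
    have h2 := (abs_le.1 (hc.cost_lip' hK hKD)).2
    rw [add_sub_cancel_left, norm_smul, hD, Real.norm_eq_abs, abs_of_pos hr] at h2
    have h3 := hS.cost_le_of_mem_sublevel hK
    have h4 : S.cost (K + r • D) ≤ 20 * S.cost K0 := by linarith
    have h5 := hS.cost_nonneg (K + r • D)
    have hCm := hS.Cm_pos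
    simp only [gradEst, LocalConstants.estBound]
    rw [norm_smul, hD, mul_one, Real.norm_eq_abs,
      abs_of_nonneg (mul_nonneg (hS.costFrom_nonneg _ _) (by positivity)), ← mul_div_assoc]
    gcongr
    calc _ ≤ Cm * (20 * S.cost K0) := h1.trans (by gcongr)
      _ = _ := by ring
  | twoPoint =>
    have h1 := hlip _ _ hKD hKD'
    have h2 : ‖K + r • D - (K - r • D)‖ = 2 * r := by
      have : K + r • D - (K - r • D) = (2 * r) • D := by module
      rw [this, norm_smul, hD, Real.norm_eq_abs, abs_of_pos (by positivity), mul_one]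
    rw [h2] at h1
    simp only [gradEst, LocalConstants.estBound]
    rw [norm_smul, hD, mul_one, norm_mul, Real.norm_eq_abs, Real.norm_eq_abs,
      abs_of_nonneg (by positivity : 0 ≤ (m * n : ℝ) / (2 * r))]
    calc _ ≤ c.lamT0 (S.sublevel Kstar K0) * (2 * r) * ((m * n : ℝ) / (2 * r)) := by gcongr
      _ = _ := by field_simp

theorem Standing.measurable_gradEst_costFrom (hS : S.Standing Cm) (σ : Setting) (r : ℝ)
    (K : Policy m n) :
    Measurable fun z : State n × Policy m n => gradEst σ S.costFrom r K z.2 z.1 :=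
  (measurable_gradEst σ hS.measurable_costFrom_uncurry r).comp
    (g := fun q : Policy m n × (State n × Policy m n) => gradEst σ S.costFrom r q.1 q.2.2 q.2.1)
    (f := fun z : State n × Policy m n => (K, z)) measurable_prodMk_left

theorem ae_prod_of_ae {p : State n × Policy m n → Prop} [SFinite S.D]
    [Nontrivial (Policy m n)] (h : ∀ᵐ x ∂S.D, ∀ D : Policy m n, ‖D‖ = 1 → p (x, D)) :
    ∀ᵐ z ∂(S.D.prod (unifSphere m n)), p z := by
  have := isProbabilityMeasure_unifSphere (m := m) (n := n)
  filter_upwards [Measure.quasiMeasurePreserving_fst.ae h,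
    Measure.quasiMeasurePreserving_snd.ae (ae_norm_eq_one_unifSphere (m := m) (n := n))] with z h1 h2
  exact h1 z.2 h2

/-- The bias of the exact gradient estimate is at most `φ₀ r`. -/
theorem Standing.abs_integral_gradEst_sub_le (hS : S.Standing Cm) [Nontrivial (Policy m n)]
    (hc : c.Admissible S Kstar K0) (hK : K ∈ S.sublevel Kstar K0) {ε r : ℝ} (hr : 0 < r)
    {σ : Setting} (hrad : c.RadiusCond S Kstar K0 σ ε r) (e : Policy m n) :
    |∫ z, inner ℝ (gradEst σ S.costFrom r K z.2 z.1) e ∂(S.D.prod (unifSphere m n)) -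
      inner ℝ (gradient S.cost K) e| ≤ c.phi0 (S.sublevel Kstar K0) * r * ‖e‖ := by
  have := isProbabilityMeasure_unifSphere (m := m) (n := n)
  have := hS.prob
  have hint : Integrable (fun z : State n × Policy m n =>
      inner ℝ (gradEst σ S.costFrom r K z.2 z.1) e) (S.D.prod (unifSphere m n)) := by
    have hm := hS.measurable_gradEst_costFrom σ r K
    refine Integrable.of_bound (by fun_prop : Measurable _).aestronglyMeasurable
      (c.estBound S Kstar K0 σ Cm r * ‖e‖) ?_
    refine ae_prod_of_ae ?_
    filter_upwards [hS.ae_norm_gradEst_le hc hK hr hrad] with x hx D hD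
    refine (norm_inner_le_norm _ _).trans ?_
    gcongr
    exact hx D hD
  rw [integral_prod_symm _ hint]
  have h1 : ∫ D, ∫ x, inner ℝ (gradEst σ S.costFrom r K D x) e ∂S.D ∂(unifSphere m n) =
      ∫ D, inner ℝ (gradEst σ (fun K _ => S.cost K) r K D 0) e ∂(unifSphere m n) := by
    refine integral_congr_ae ?_
    filter_upwards [ae_norm_eq_one_unifSphere] with D hD
    exact hS.integral_gradEst hc hK hr hrad.2.2.1 σ hD e
  rw [h1]
  exact hS.abs_integral_cost_estimate_sub_le hc hK hr hrad.2.2.1 σ e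

/-- For the two-point estimate the Poincaré inequality on the sphere gains a factor of order `d`
over the square of the almost sure bound. -/
theorem lintegral_gradEst_twoPoint_sq_le [Nontrivial (Policy m n)]
    (hc : c.Admissible S Kstar K0) (hK : K ∈ S.sublevel Kstar K0) {r : ℝ} (hr : 0 < r)
    (hrρ : r ≤ c.rho0 (S.sublevel Kstar K0)) :
    ∀ᵐ x ∂S.D, ∫⁻ D, ENNReal.ofReal (‖gradEst .twoPoint S.costFrom r K D x‖ ^ 2) ∂(unifSphere m n) ≤
      ENNReal.ofReal (2 * (m * n : ℝ) * c.lamT0 (S.sublevel Kstar K0) ^ 2) := by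
  have hr1 : |r| ≤ c.rho0 (S.sublevel Kstar K0) := by rwa [abs_of_pos hr]
  have hr2 : |-r| ≤ c.rho0 (S.sublevel Kstar K0) := by rwa [abs_neg]
  set l := c.lamT0 (S.sublevel Kstar K0)
  have hl : 0 < l := hc.lamT0_pos hK
  filter_upwards [hc.costFrom_lip' hK] with x hlip
  set f : Policy m n → ℝ := fun v => (S.costFrom (K + r • v) x - S.costFrom (K + (-r) • v) x) / (2 * r)
    with hf
  have hLip : ∀ v w : Policy m n, ‖v‖ ≤ 1 → ‖w‖ ≤ 1 → ‖f v - f w‖ ≤ l * ‖v - w‖ := by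
    intro v w hv hw
    have h1 := hlip _ _ (norm_add_smul_sub_le K hr1 hv) (norm_add_smul_sub_le K hr1 hw)
    have h2 := hlip _ _ (norm_add_smul_sub_le K hr2 hv) (norm_add_smul_sub_le K hr2 hw)
    rw [add_sub_add_left_eq_sub, ← smul_sub, norm_smul, Real.norm_eq_abs, abs_of_pos hr] at h1
    rw [add_sub_add_left_eq_sub, ← smul_sub, norm_smul, Real.norm_eq_abs, abs_neg,
      abs_of_pos hr] at h2
    rw [hf, Real.norm_eq_abs, ← sub_div, abs_div, abs_of_pos (by positivity : 0 < 2 * r),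
      div_le_iff₀ (by positivity)]
    rw [abs_le] at *
    constructor <;> linarith [h1.1, h1.2, h2.1, h2.2]
  have hcd : ∀ v ∈ closedBall (0 : Policy m n) 1, ContDiffAt ℝ 1 f v := by
    intro v hv
    have hv' := mem_closedBall_zero_iff.1 hv
    have h1 : ContDiffAt ℝ 1 (fun K => S.costFrom K x) (K + r • v) :=
      (contDiffAt_costFrom (hc.mem_stab hK (norm_add_smul_sub_le K hr1 hv')) x).of_le le_top
    have h2 : ContDiffAt ℝ 1 (fun K => S.costFrom K x) (K + (-r) • v) :=
      (contDiffAt_costFrom (hc.mem_stab hK (norm_add_smul_sub_le K hr2 hv')) x).of_le le_top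
    exact ((h1.comp v (f := fun v : Policy m n => K + r • v) (by fun_prop)).sub
      (h2.comp v (f := fun v : Policy m n => K + (-r) • v) (by fun_prop))).div_const _
  have hodd : ∀ v, f (-v) = - f v := by
    intro v
    simp only [hf, smul_neg, neg_smul, neg_neg]
    ring
  have hb : ∀ u : Policy m n, ‖u‖ = 1 → |f u| ≤ l := by
    intro u hu
    have h1 := hLip u (-u) hu.le (by rw [norm_neg, hu])
    have h2 : ‖u - -u‖ = 2 := by
      have : u - -u = (2 : ℝ) • u := by module
      rw [this, norm_smul, hu]
      norm_num
    rw [hodd, h2, sub_neg_eq_add, ← two_mul, norm_mul, Real.norm_eq_abs, Real.norm_eq_abs, abs_two]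
      at h1
    linarith
  -- Inside the ball the bound on the derivative is the Lipschitz bound; it passes to the sphere.
  have hb' : ∀ u : Policy m n, ‖u‖ = 1 → ‖fderiv ℝ f u‖ ≤ l := by
    intro u hu
    have hu1 : u ∈ closure (ball (0 : Policy m n) 1) := by
      rw [closure_ball _ one_ne_zero]
      simp [hu]
    have hcont : ContinuousAt (fun v => ‖fderiv ℝ f v‖) u :=
      ((hcd u (by simp [hu])).fderiv_right (m := 0) (by simp)).continuousAt.norm
    refine ContinuousWithinAt.closure_le hu1 hcont.continuousWithinAt
      continuousWithinAt_const fun v hv => ?_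
    refine norm_fderiv_le_of_lip' ℝ hl.le ?_
    filter_upwards [isOpen_ball.mem_nhds hv] with w hw
    exact hLip w v (mem_ball_zero_iff.1 hw).le (mem_ball_zero_iff.1 hv).le
  have key := lintegral_unifSphere_sq_le hcd hodd hb hb'
  have h1 : ∫⁻ D, ENNReal.ofReal (‖gradEst .twoPoint S.costFrom r K D x‖ ^ 2) ∂(unifSphere m n) =
      (m * n : ENNReal) * ((m * n : ENNReal) * ∫⁻ D, ENNReal.ofReal (f D ^ 2) ∂(unifSphere m n)) := by
    have hmn : (m * n : ENNReal) = ENNReal.ofReal (m * n : ℝ) := by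
      rw [ENNReal.ofReal_mul (by positivity), ENNReal.ofReal_natCast, ENNReal.ofReal_natCast]
    rw [← mul_assoc, ← lintegral_const_mul' _ _ (by rw [hmn]; finiteness)]
    refine lintegral_congr_ae ?_
    filter_upwards [ae_norm_eq_one_unifSphere] with D hD
    rw [hmn, ← ENNReal.ofReal_mul (by positivity), ← ENNReal.ofReal_mul (by positivity)]
    congr 1
    simp only [gradEst, hf]
    rw [norm_smul, hD, mul_one, Real.norm_eq_abs, sq_abs, neg_smul, ← sub_eq_add_neg]
    field_simp
  rw [h1]
  calc _ ≤ (m * n : ENNReal) * ENNReal.ofReal (2 * l ^ 2) := by gcongr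
    _ = _ := by
      rw [← ENNReal.ofReal_natCast, ← ENNReal.ofReal_natCast, ← ENNReal.ofReal_mul (by positivity),
        ← ENNReal.ofReal_mul (by positivity)]
      congr 1
      ring

theorem Standing.lintegral_gradEst_sq_le (hS : S.Standing Cm) [Nontrivial (Policy m n)]
    (hc : c.Admissible S Kstar K0) (hK : K ∈ S.sublevel Kstar K0) {ε r : ℝ} (hr : 0 < r)
    {σ : Setting} (hrad : c.RadiusCond S Kstar K0 σ ε r) :
    ∫⁻ z, ENNReal.ofReal (‖gradEst σ S.costFrom r K z.2 z.1‖ ^ 2) ∂(S.D.prod (unifSphere m n)) ≤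
      ENNReal.ofReal (c.estVar S Kstar K0 σ Cm r) := by
  have := isProbabilityMeasure_unifSphere (m := m) (n := n)
  have := hS.prob
  cases σ with
  | onePoint =>
    have h : ∀ᵐ z ∂(S.D.prod (unifSphere m n)),
        ENNReal.ofReal (‖gradEst .onePoint S.costFrom r K z.2 z.1‖ ^ 2) ≤
          ENNReal.ofReal (c.estVar S Kstar K0 .onePoint Cm r) := by
      refine ae_prod_of_ae ?_
      filter_upwards [hS.ae_norm_gradEst_le hc hK hr hrad] with x hx D hD
      refine ENNReal.ofReal_le_ofReal ?_
      exact pow_le_pow_left₀ (norm_nonneg _) (hx D hD) 2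
    refine (lintegral_mono_ae h).trans_eq ?_
    simp
  | twoPoint =>
    have hm := hS.measurable_gradEst_costFrom .twoPoint r K
    rw [lintegral_prod _ (hm.norm.pow_const 2).ennreal_ofReal.aemeasurable]
    refine (lintegral_mono_ae
      (lintegral_gradEst_twoPoint_sq_le hc hK hr hrad.2.2.1)).trans_eq ?_
    simp [LocalConstants.estVar]

end LQR

namespace LQR

/-! ### The expected decrease of the cost in one iteration -/

variable {m n : ℕ} {S : LQR m n} {Cm : ℝ} {Kstar K0 K : Policy m n} {c : LocalConstants m n}

/-- The quadratic upper bound on the cost around a policy of the sublevel set. -/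
theorem Standing.cost_add_le (hS : S.Standing Cm) (hc : c.Admissible S Kstar K0)
    (hK : K ∈ S.sublevel Kstar K0) {V : Policy m n} (hV : ‖V‖ ≤ c.rho0 (S.sublevel Kstar K0)) :
    S.cost (K + V) ≤ S.cost K + inner ℝ (gradient S.cost K) V +
      c.phi0 (S.sublevel Kstar K0) / 2 * ‖V‖ ^ 2 := by
  set φ := c.phi0 (S.sublevel Kstar K0)
  have hφ : 0 < φ := hc.phi0_pos hK
  have hnear : ∀ t ∈ Set.Icc (0 : ℝ) 1, ‖K + t • V - K‖ ≤ t * ‖V‖ ∧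
      ‖K + t • V - K‖ ≤ c.rho0 (S.sublevel Kstar K0) := by
    intro t ht
    have h1 : ‖K + t • V - K‖ ≤ t * ‖V‖ := by
      rw [add_sub_cancel_left, norm_smul, Real.norm_eq_abs, abs_of_nonneg ht.1]
    exact ⟨h1, h1.trans ((mul_le_of_le_one_left (norm_nonneg _) ht.2).trans hV)⟩
  set h : ℝ → ℝ := fun t => t * inner ℝ (gradient S.cost K) V + φ / 2 * ‖V‖ ^ 2 * t ^ 2 -
    S.cost (K + t • V) with hh
  have hder : ∀ t ∈ Set.Icc (0 : ℝ) 1, HasDerivAt h (inner ℝ (gradient S.cost K) V +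
      φ * ‖V‖ ^ 2 * t - inner ℝ (gradient S.cost (K + t • V)) V) t := by
    intro t ht
    have hst := hc.mem_stab hK (hnear t ht).2
    have h1 : HasDerivAt (fun t : ℝ => K + t • V) V t := by
      simpa using ((hasDerivAt_id t).smul_const V).const_add K
    have h2 := ((hS.contDiffAt_cost hst).differentiableAt (by simp)).hasFDerivAt.comp_hasDerivAt t h1
    have h3 := ((hasDerivAt_id t).mul_const (inner ℝ (gradient S.cost K) V)).add
      (((hasDerivAt_id t).pow 2).const_mul (φ / 2 * ‖V‖ ^ 2))
    rw [inner_gradient _ (K + t • V)]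
    refine (h3.sub h2).congr_deriv ?_
    simp
    ring
  have hmono : MonotoneOn h (Set.Icc 0 1) := by
    refine monotoneOn_of_deriv_nonneg (convex_Icc 0 1)
      (fun t ht => (hder t ht).continuousAt.continuousWithinAt)
      (fun t ht => (hder t (interior_subset ht)).differentiableAt.differentiableWithinAt) ?_
    intro t ht
    have ht := interior_subset ht
    rw [(hder t ht).deriv]
    have h1 := hc.grad_lip' hK (hnear t ht).2
    have h2 : inner ℝ (gradient S.cost (K + t • V) - gradient S.cost K) V ≤ φ * (t * ‖V‖) * ‖V‖ := by
      refine (real_inner_le_norm _ _).trans ?_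
      gcongr
      refine h1.trans ?_
      gcongr
      exact (hnear t ht).1
    rw [inner_sub_left] at h2
    linarith
  have := hmono (Set.left_mem_Icc.2 zero_le_one) (Set.right_mem_Icc.2 zero_le_one) zero_le_one
  simp only [hh, zero_mul, zero_smul, one_smul, add_zero] at this
  linarith

/-- There are policies arbitrarily close to an optimal one that are not optimal: otherwise the
optimal policies would form an open and closed set, hence everything. -/
theorem Standing.exists_near_optimal (hS : S.Standing Cm) (hopt : S.IsOptimal Kstar)
    (hgap : 0 < S.gap Kstar K0) {ρ : ℝ} (hρ : 0 < ρ) :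
    ∃ K1 ∈ S.sublevel Kstar K0, ∃ K ∈ S.sublevel Kstar K0, S.IsOptimal K1 ∧ ‖K - K1‖ ≤ ρ ∧
      S.cost Kstar < S.cost K := by
  by_contra! hcon
  set A : Set (Policy m n) := {K | K ∈ S.stab ∧ S.cost K ≤ S.cost Kstar} with hA
  have hAclosed : IsClosed A := (hS.isCompact_sublevel (S.cost Kstar)).isClosed
  have hAopen : IsOpen A := by
    rw [isOpen_iff_mem_nhds]
    intro K1 hK1
    have hopt1 : S.IsOptimal K1 := ⟨hK1.1, fun K hK => hK1.2.trans (hopt.2 K hK)⟩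
    have hlt : S.cost K1 < S.cost Kstar + 10 * S.gap Kstar K0 := by linarith [hK1.2]
    filter_upwards [S.isOpen_stab.mem_nhds hK1.1,
      (hS.contDiffAt_cost hK1.1).continuousAt.eventually_lt_const hlt,
      Metric.closedBall_mem_nhds K1 hρ] with K h1 h2 h3
    exact ⟨h1, hcon K1 ⟨hK1.1, by linarith⟩ K ⟨h1, by linarith⟩ hopt1
      (mem_closedBall_iff_norm.1 h3)⟩
  have huniv : A = Set.univ := IsClopen.eq_univ ⟨hAclosed, hAopen⟩ ⟨Kstar, hopt.1, le_rfl⟩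
  have : K0 ∈ A := huniv ▸ Set.mem_univ K0
  have h1 := this.2
  simp only [gap] at hgap
  linarith

/-- The Polyak-Lojasiewicz constant is at most twice the smoothness constant: a gradient step of
length `1 / φ₀` from a policy that is nearly optimal stays in the region of smoothness, and lowers
the cost by at least `‖∇𝒥‖² / (2 φ₀)`, but by no more than the gap. -/
theorem Standing.mu_le (hS : S.Standing Cm) (hc : c.Admissible S Kstar K0)
    (hopt : S.IsOptimal Kstar) (hK0 : K0 ∈ S.stab) (hgap : 0 < S.gap Kstar K0) :
    c.mu ≤ 2 * c.phi0 (S.sublevel Kstar K0) := by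
  have hφ := hc.phi0_pos (hopt.mem_sublevel hK0)
  set φ := c.phi0 (S.sublevel Kstar K0)
  obtain ⟨K1, hK1, K, hK, hopt1, hnear, hlt⟩ := hS.exists_near_optimal hopt hgap hc.rho0_pos
  have hg1 : gradient S.cost K1 = 0 := by
    have hmin : IsLocalMin S.cost K1 := by
      filter_upwards [S.isOpen_stab.mem_nhds hopt1.1] with K hK using hopt1.2 K hK
    rw [gradient, hmin.fderiv_eq_zero, map_zero]
  have hg := hc.grad_lip' hK1 hnear
  rw [hg1, sub_zero] at hg
  have hstep : ‖-(φ⁻¹ • gradient S.cost K)‖ ≤ c.rho0 (S.sublevel Kstar K0) := by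
    rw [norm_neg, norm_smul, norm_inv, Real.norm_eq_abs, abs_of_pos hφ, inv_mul_le_iff₀ hφ]
    exact hg.trans (by gcongr)
  have h1 := hS.cost_add_le hc hK hstep
  have h2 : S.cost Kstar ≤ S.cost (K + -(φ⁻¹ • gradient S.cost K)) :=
    hopt.2 _ (hc.mem_stab hK (by rwa [add_sub_cancel_left]))
  rw [inner_neg_right, real_inner_smul_right, real_inner_self_eq_norm_sq, norm_neg, norm_smul,
    norm_inv, Real.norm_eq_abs, abs_of_pos hφ, mul_pow] at h1
  have h3 := hc.pl K hK.1
  have h4 : φ / 2 * (φ⁻¹ ^ 2 * ‖gradient S.cost K‖ ^ 2) = 1 / 2 * (φ⁻¹ * ‖gradient S.cost K‖ ^ 2) := by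
    field_simp
  have h5 : φ⁻¹ * ‖gradient S.cost K‖ ^ 2 ≤ 2 * (S.cost K - S.cost Kstar) := by
    change _ ≤ S.cost K + -(φ⁻¹ * _) + φ / 2 * (φ⁻¹ ^ 2 * _) at h1
    linarith
  rw [inv_mul_le_iff₀ hφ] at h5
  have h6 : 0 < S.cost K - S.cost Kstar := sub_pos.2 hlt
  nlinarith

/-- The assumptions on the problem, the constants and the parameters under which the algorithm is
run. -/
structure RunAssumptions (S : LQR m n) (Cm : ℝ) (Kstar K0 : Policy m n) (c : LocalConstants m n)
    (σ : Setting) (ε r η M γ : ℝ) (T : ℕ) : Prop where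
  m_pos : 0 < m
  n_pos : 0 < n
  standing : S.Standing Cm
  isOptimal : S.IsOptimal Kstar
  mem_stab : K0 ∈ S.stab
  admissible : c.Admissible S Kstar K0
  r_pos : 0 < r
  decay : S.DecayConstants Kstar K0 r M γ
  eps_pos : 0 < ε
  log_lt : ε * Real.log (120 * S.gap Kstar K0 / ε) < 12 * S.gap Kstar K0
  radius : c.RadiusCond S Kstar K0 σ ε r
  eta_pos : 0 < η
  step : c.StepCond S Kstar K0 σ Cm ε r η
  rollout : ∀ᵐ x ∂S.D, S.rolloutBound c Kstar K0 ε r M γ x ≤ T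

namespace RunAssumptions

variable {σ : Setting} {ε r η M γ : ℝ} {T : ℕ}

theorem gap_pos (h : RunAssumptions S Cm Kstar K0 c σ ε r η M γ T) : 0 < S.gap Kstar K0 := by
  refine (h.isOptimal.gap_nonneg h.mem_stab).lt_of_ne fun h0 => ?_
  have := h.log_lt
  rw [← h0] at this
  simp at this

theorem K0_mem (h : RunAssumptions S Cm Kstar K0 c σ ε r η M γ T) : K0 ∈ S.sublevel Kstar K0 :=
  h.isOptimal.mem_sublevel h.mem_stab

theorem cost_K0_pos (h : RunAssumptions S Cm Kstar K0 c σ ε r η M γ T) : 0 < S.cost K0 := by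
  have h1 := h.gap_pos
  have h2 := h.standing.cost_nonneg Kstar
  simp only [gap] at h1
  linarith

theorem pertBound_pos (h : RunAssumptions S Cm Kstar K0 c σ ε r η M γ T) :
    0 < c.pertBound (S.sublevel Kstar K0) ε := by
  have := h.admissible.mu_pos
  have := h.admissible.theta0_pos h.K0_mem
  have := h.eps_pos
  exact lt_min (by positivity) (by positivity)

theorem pertBound_sq_le (h : RunAssumptions S Cm Kstar K0 c σ ε r η M γ T) :
    c.pertBound (S.sublevel Kstar K0) ε ^ 2 ≤ c.mu * ε / 120 := by
  have hμ := h.admissible.mu_pos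
  have hε := h.eps_pos
  calc c.pertBound (S.sublevel Kstar K0) ε ^ 2 ≤ (1 / 2 * √(c.mu * ε / 30)) ^ 2 :=
        pow_le_pow_left₀ h.pertBound_pos.le (min_le_right _ _) 2
    _ = _ := by
      rw [mul_pow, Real.sq_sqrt (by positivity)]
      ring

/-- The bias of the gradient estimate, from smoothing and from finite rollouts together. -/
theorem bias_sq_le (h : RunAssumptions S Cm Kstar K0 c σ ε r η M γ T) :
    (c.phi0 (S.sublevel Kstar K0) * r + c.pertBound (S.sublevel Kstar K0) ε) ^ 2 ≤
      c.mu * ε / 40 := by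
  have hμ := h.admissible.mu_pos
  have hε := h.eps_pos
  have hφ := h.admissible.phi0_pos h.K0_mem
  have hr := h.r_pos
  have h1 := h.pertBound_sq_le
  have h2 : (c.phi0 (S.sublevel Kstar K0) * r) ^ 2 ≤ c.mu * ε / 240 := by
    have h3 := h.radius.2.1
    calc _ ≤ (c.phi0 (S.sublevel Kstar K0) *
          (1 / (4 * c.phi0 (S.sublevel Kstar K0)) * √(c.mu * ε / 15))) ^ 2 := by gcongr
      _ = (1 / 4 * √(c.mu * ε / 15)) ^ 2 := by
        congr 1
        field_simp
      _ = _ := by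
        rw [mul_pow, Real.sq_sqrt (by positivity)]
        ring
  -- `(a + b)² ≤ (5/2) a² + (5/3) b²`, and `(5/2)/240 + (5/3)/120 < 1/40`
  nlinarith [sq_nonneg (3 * (c.phi0 (S.sublevel Kstar K0) * r) -
    2 * c.pertBound (S.sublevel Kstar K0) ε), mul_pos hμ hε]

theorem dim_pos (h : RunAssumptions S Cm Kstar K0 c σ ε r η M γ T) : (0 : ℝ) < m * n := by
  have := h.m_pos
  have := h.n_pos
  positivity

theorem eta_mul_le (h : RunAssumptions S Cm Kstar K0 c σ ε r η M γ T) :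
    η * (c.estBound S Kstar K0 σ Cm r + c.pertBound (S.sublevel Kstar K0) ε) ≤
      c.rho0 (S.sublevel Kstar K0) := by
  have hδ := h.pertBound_pos
  have hr := h.r_pos
  have hl := h.admissible.lamT0_pos h.K0_mem
  have hd := h.dim_pos
  have hJ := h.cost_K0_pos
  have hCm := h.standing.Cm_pos
  have hst := h.step
  cases σ with
  | onePoint =>
    have h1 := hst.2.2
    rw [le_div_iff₀ (by positivity)] at h1
    simp only [LocalConstants.estBound]
    refine le_of_mul_le_mul_right (le_trans (le_of_eq ?_) h1) hr
    field_simp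
  | twoPoint =>
    have h1 := hst.2.2
    rwa [le_div_iff₀ (by positivity)] at h1

theorem estVar_nonneg (h : RunAssumptions S Cm Kstar K0 c σ ε r η M γ T) :
    0 ≤ c.estVar S Kstar K0 σ Cm r := by
  have hd := h.dim_pos
  cases σ <;> simp only [LocalConstants.estVar] <;> positivity

theorem eta_mul_estVar_le (h : RunAssumptions S Cm Kstar K0 c σ ε r η M γ T) :
    c.phi0 (S.sublevel Kstar K0) * η * c.estVar S Kstar K0 σ Cm r ≤ c.mu * ε / 240 := by
  have hr := h.r_pos
  have hl := h.admissible.lamT0_pos h.K0_mem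
  have hφ := h.admissible.phi0_pos h.K0_mem
  have hd := h.dim_pos
  have hJ := h.cost_K0_pos
  have hCm := h.standing.Cm_pos
  have hμ := h.admissible.mu_pos
  have hε := h.eps_pos
  have hst := h.step
  set d : ℝ := m * n with hdd
  cases σ with
  | onePoint =>
    have h1 : _ ≤ _ / _ := hst.2.1
    simp only [LocalConstants.estVar, ← hdd]
    calc _ ≤ c.phi0 (S.sublevel Kstar K0) * (c.mu * r ^ 2 * ε /
          (480 * c.phi0 (S.sublevel Kstar K0) * (20 * Cm * S.cost K0 * d) ^ 2)) *
          (20 * Cm * S.cost K0 * d / r) ^ 2 := by gcongr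
      _ = c.mu * ε / 480 := by field_simp
      _ ≤ _ := by
        have : 0 < c.mu * ε := by positivity
        linarith
  | twoPoint =>
    have h1 : _ ≤ _ / _ := hst.2.1
    simp only [LocalConstants.estVar, ← hdd]
    calc _ ≤ c.phi0 (S.sublevel Kstar K0) * (c.mu * ε / (480 * c.phi0 (S.sublevel Kstar K0) *
          d * c.lamT0 (S.sublevel Kstar K0) ^ 2)) *
          (2 * d * c.lamT0 (S.sublevel Kstar K0) ^ 2) := by gcongr
      _ = _ := by
        field_simp
        norm_num

theorem phi0_mul_eta_le (h : RunAssumptions S Cm Kstar K0 c σ ε r η M γ T) :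
    c.phi0 (S.sublevel Kstar K0) * η ≤ 1 / 4 := by
  have hφ := h.admissible.phi0_pos h.K0_mem
  have h1 := h.step.1
  rw [le_div_iff₀ (by positivity)] at h1
  linarith

theorem eta_mul_mu_le (h : RunAssumptions S Cm Kstar K0 c σ ε r η M γ T) : η * c.mu ≤ 1 / 2 := by
  have h1 := h.standing.mu_le h.admissible h.isOptimal h.mem_stab h.gap_pos
  have h2 := h.phi0_mul_eta_le
  have h3 := mul_le_mul_of_nonneg_left h1 h.eta_pos.le
  linarith

/-- Almost surely, the exact estimate is bounded and the error from finite rollouts is small. -/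
theorem ae_gradEst (h : RunAssumptions S Cm Kstar K0 c σ ε r η M γ T)
    (hK : K ∈ S.sublevel Kstar K0) :
    ∀ᵐ z ∂(S.D.prod (unifSphere m n)),
      ‖gradEst σ S.costFrom r K z.2 z.1‖ ≤ c.estBound S Kstar K0 σ Cm r ∧
      ‖gradEst σ S.costFrom r K z.2 z.1 - gradEst σ (S.truncCost T) r K z.2 z.1‖ ≤
        c.pertBound (S.sublevel Kstar K0) ε := by
  have := h.standing.prob
  have := nontrivial_policy h.m_pos h.n_pos
  refine ae_prod_of_ae ?_
  filter_upwards [h.standing.ae_norm_gradEst_le h.admissible hK h.r_pos h.radius, h.rollout]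
    with x h1 h2 D hD
  exact ⟨h1 D hD, h.standing.norm_gradEst_sub_le_pertBound h.admissible h.eps_pos h.r_pos
    h.radius.2.2.1 h.decay hK hD h2 σ⟩

theorem norm_step_le (h : RunAssumptions S Cm Kstar K0 c σ ε r η M γ T) {z : State n × Policy m n}
    (hz : ‖gradEst σ S.costFrom r K z.2 z.1‖ ≤ c.estBound S Kstar K0 σ Cm r ∧
      ‖gradEst σ S.costFrom r K z.2 z.1 - gradEst σ (S.truncCost T) r K z.2 z.1‖ ≤
        c.pertBound (S.sublevel Kstar K0) ε) :
    ‖-(η • gradEst σ (S.truncCost T) r K z.2 z.1)‖ ≤ c.rho0 (S.sublevel Kstar K0) := by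
  rw [norm_neg, norm_smul, Real.norm_eq_abs, abs_of_pos h.eta_pos]
  refine le_trans ?_ h.eta_mul_le
  have := h.eta_pos
  gcongr
  have h1 := norm_sub_norm_le (gradEst σ (S.truncCost T) r K z.2 z.1)
    (gradEst σ S.costFrom r K z.2 z.1)
  rw [norm_sub_rev] at h1
  linarith [hz.1, hz.2]

theorem ae_step_mem_stab (h : RunAssumptions S Cm Kstar K0 c σ ε r η M γ T)
    (hK : K ∈ S.sublevel Kstar K0) :
    ∀ᵐ z ∂(S.D.prod (unifSphere m n)),
      K - η • gradEst σ (S.truncCost T) r K z.2 z.1 ∈ S.stab := by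
  filter_upwards [h.ae_gradEst hK] with z hz
  refine h.admissible.mem_stab hK ?_
  rw [sub_sub_cancel_left]
  exact h.norm_step_le hz

/-- The expected gap after one step from a policy of the sublevel set. -/
theorem lintegral_step_le (h : RunAssumptions S Cm Kstar K0 c σ ε r η M γ T)
    (hK : K ∈ S.sublevel Kstar K0) :
    ∫⁻ z, ENNReal.ofReal (S.cost (K - η • gradEst σ (S.truncCost T) r K z.2 z.1) - S.cost Kstar)
      ∂(S.D.prod (unifSphere m n)) ≤
    ENNReal.ofReal (S.cost K - S.cost Kstar - η * (‖gradient S.cost K‖ ^ 2 -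
      (c.phi0 (S.sublevel Kstar K0) * r + c.pertBound (S.sublevel Kstar K0) ε) *
        ‖gradient S.cost K‖) + η * c.mu * (ε / 160)) := by
  have hS := h.standing
  have hc := h.admissible
  have := hS.prob
  have := nontrivial_policy h.m_pos h.n_pos
  have := isProbabilityMeasure_unifSphere (m := m) (n := n)
  have hφ := hc.phi0_pos hK
  have hη := h.eta_pos
  have hδ := h.pertBound_pos
  set ν := S.D.prod (unifSphere m n)
  set φ := c.phi0 (S.sublevel Kstar K0)
  set δ := c.pertBound (S.sublevel Kstar K0) ε
  set g := gradient S.cost K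
  set G : State n × Policy m n → Policy m n := fun z => gradEst σ S.costFrom r K z.2 z.1
  set H : State n × Policy m n → Policy m n := fun z => gradEst σ (S.truncCost T) r K z.2 z.1
  have hGm : Measurable G := hS.measurable_gradEst_costFrom σ r K
  have hHm : Measurable H :=
    (measurable_gradEst σ (continuous_truncCost_uncurry T).measurable r).comp
      (g := fun q : Policy m n × (State n × Policy m n) => gradEst σ (S.truncCost T) r q.1 q.2.2 q.2.1)
      (f := fun z : State n × Policy m n => (K, z)) measurable_prodMk_left
  have hae : ∀ᵐ z ∂ν, ‖G z‖ ≤ c.estBound S Kstar K0 σ Cm r ∧ ‖G z - H z‖ ≤ δ := h.ae_gradEst hK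
  have hHb : ∀ᵐ z ∂ν, ‖H z‖ ≤ c.estBound S Kstar K0 σ Cm r + δ := by
    filter_upwards [hae] with z hz
    have h1 := norm_sub_norm_le (H z) (G z)
    rw [norm_sub_rev] at h1
    linarith [hz.1, hz.2]
  have hGi : Integrable G ν :=
    Integrable.of_bound hGm.aestronglyMeasurable _ (hae.mono fun z hz => hz.1)
  have hHi : Integrable H ν := Integrable.of_bound hHm.aestronglyMeasurable _ hHb
  have hG2 : Integrable (fun z => ‖G z‖ ^ 2) ν := by
    refine Integrable.of_bound (hGm.norm.pow_const 2).aestronglyMeasurable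
      (c.estBound S Kstar K0 σ Cm r ^ 2) (hae.mono fun z hz => ?_)
    rw [Real.norm_eq_abs, abs_of_nonneg (by positivity)]
    exact pow_le_pow_left₀ (norm_nonneg _) hz.1 2
  have hH2 : Integrable (fun z => ‖H z‖ ^ 2) ν := by
    refine Integrable.of_bound (hHm.norm.pow_const 2).aestronglyMeasurable
      ((c.estBound S Kstar K0 σ Cm r + δ) ^ 2) (hHb.mono fun z hz => ?_)
    rw [Real.norm_eq_abs, abs_of_nonneg (by positivity)]
    exact pow_le_pow_left₀ (norm_nonneg _) hz 2
  have hmean : ‖g‖ ^ 2 - (φ * r + δ) * ‖g‖ ≤ ∫ z, inner ℝ (H z) g ∂ν := by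
    have h1 := (abs_le.1 (hS.abs_integral_gradEst_sub_le hc hK h.r_pos h.radius g)).1
    rw [real_inner_self_eq_norm_sq] at h1
    have h2 : ∫ z, (inner ℝ (G z) g - inner ℝ (H z) g) ∂ν ≤ ∫ _, δ * ‖g‖ ∂ν := by
      refine integral_mono_ae ((hGi.inner_const g).sub (hHi.inner_const g)) (integrable_const _) ?_
      filter_upwards [hae] with z hz
      rw [← inner_sub_left]
      refine (real_inner_le_norm _ _).trans ?_
      gcongr
      exact hz.2
    rw [integral_sub (hGi.inner_const g) (hHi.inner_const g), integral_const, probReal_univ,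
      one_smul] at h2
    linarith
  have hsecond : ∫ z, ‖H z‖ ^ 2 ∂ν ≤ 2 * c.estVar S Kstar K0 σ Cm r + 2 * δ ^ 2 := by
    have h1 : ∫ z, ‖G z‖ ^ 2 ∂ν ≤ c.estVar S Kstar K0 σ Cm r := by
      rw [integral_eq_lintegral_of_nonneg_ae (Eventually.of_forall fun z => sq_nonneg _)
        hG2.aestronglyMeasurable]
      exact ENNReal.toReal_le_of_le_ofReal h.estVar_nonneg
        (hS.lintegral_gradEst_sq_le hc hK h.r_pos h.radius)
    have h2 : ∫ z, ‖H z‖ ^ 2 ∂ν ≤ ∫ z, (2 * ‖G z‖ ^ 2 + 2 * δ ^ 2) ∂ν := by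
      refine integral_mono_ae hH2 ((hG2.const_mul 2).add (integrable_const _)) ?_
      filter_upwards [hae] with z hz
      have h3 : ‖H z‖ ≤ ‖G z‖ + δ := by
        have h1 := norm_sub_norm_le (H z) (G z)
        rw [norm_sub_rev] at h1
        linarith [hz.2]
      have h4 := pow_le_pow_left₀ (norm_nonneg _) h3 2
      nlinarith [sq_nonneg (‖G z‖ - δ)]
    rw [integral_add (hG2.const_mul 2) (integrable_const _), integral_const, probReal_univ,
      one_smul, integral_const_mul] at h2
    linarith
  have hup : ∀ᵐ z ∂ν, S.cost (K - η • H z) - S.cost Kstar ≤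
      S.cost K - S.cost Kstar - η * inner ℝ (H z) g + φ / 2 * η ^ 2 * ‖H z‖ ^ 2 := by
    filter_upwards [hae] with z hz
    have h1 := hS.cost_add_le hc hK (h.norm_step_le hz)
    rw [← sub_eq_add_neg, inner_neg_right, real_inner_smul_right, norm_neg, norm_smul,
      Real.norm_eq_abs, mul_pow, sq_abs, real_inner_comm] at h1
    change S.cost (K - η • H z) ≤ S.cost K + -(η * inner ℝ (H z) g) + φ / 2 * (η ^ 2 * ‖H z‖ ^ 2)
      at h1
    linarith
  have hint1 : Integrable (fun z => S.cost K - S.cost Kstar - η * inner ℝ (H z) g) ν :=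
    (integrable_const _).sub ((hHi.inner_const g).const_mul η)
  have hint : Integrable (fun z =>
      S.cost K - S.cost Kstar - η * inner ℝ (H z) g + φ / 2 * η ^ 2 * ‖H z‖ ^ 2) ν :=
    hint1.add (hH2.const_mul _)
  refine (lintegral_mono_ae (hup.mono fun z hz => ENNReal.ofReal_le_ofReal hz)).trans ?_
  rw [← ofReal_integral_eq_lintegral_ofReal hint]
  · refine ENNReal.ofReal_le_ofReal ?_
    rw [integral_add hint1 (hH2.const_mul _), integral_sub (integrable_const _) ((hHi.inner_const g).const_mul η),
      integral_const, probReal_univ, one_smul, integral_const_mul, integral_const_mul]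
    have h1 := mul_le_mul_of_nonneg_left hmean hη.le
    have h2 : φ / 2 * η ^ 2 * ∫ z, ‖H z‖ ^ 2 ∂ν ≤
        φ / 2 * η ^ 2 * (2 * c.estVar S Kstar K0 σ Cm r + 2 * δ ^ 2) := by gcongr
    have h3 := mul_le_mul_of_nonneg_left h.eta_mul_estVar_le hη.le
    have h4 : φ * η * δ ^ 2 ≤ 1 / 4 * (c.mu * ε / 120) :=
      mul_le_mul h.phi0_mul_eta_le h.pertBound_sq_le (by positivity) (by norm_num)
    have h5 := mul_le_mul_of_nonneg_left h4 hη.le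
    change η * (φ * η * _) ≤ _ at h3
    linarith
  · filter_upwards [hup, h.ae_step_mem_stab hK] with z h1 h2
    exact (sub_nonneg.2 (h.isOptimal.2 _ h2)).trans h1

/-- In expectation the gap grows by at most `η μ ε / 80` per iteration. -/
theorem lintegral_step_le_add (h : RunAssumptions S Cm Kstar K0 c σ ε r η M γ T)
    (hK : K ∈ S.sublevel Kstar K0) :
    ∫⁻ z, ENNReal.ofReal (S.cost (K - η • gradEst σ (S.truncCost T) r K z.2 z.1) - S.cost Kstar)
      ∂(S.D.prod (unifSphere m n)) ≤
    ENNReal.ofReal (S.cost K - S.cost Kstar) + ENNReal.ofReal (η * c.mu * (ε / 80)) := by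
  have hη := h.eta_pos
  have hμ := h.admissible.mu_pos
  have hε := h.eps_pos
  refine (h.lintegral_step_le hK).trans ?_
  rw [← ENNReal.ofReal_add (sub_nonneg.2 (h.isOptimal.2 K hK.1)) (by positivity)]
  refine ENNReal.ofReal_le_ofReal ?_
  have h1 := h.bias_sq_le
  set B := c.phi0 (S.sublevel Kstar K0) * r + c.pertBound (S.sublevel Kstar K0) ε
  have h2 : -(c.mu * ε / 160) ≤ ‖gradient S.cost K‖ ^ 2 - B * ‖gradient S.cost K‖ := by
    nlinarith [sq_nonneg (2 * ‖gradient S.cost K‖ - B)]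
  have h3 := mul_le_mul_of_nonneg_left h2 hη.le
  linarith

/-- In expectation the gap contracts by the factor `1 - η μ / 2`, up to `η μ ε / 50`. -/
theorem lintegral_step_le_mul (h : RunAssumptions S Cm Kstar K0 c σ ε r η M γ T)
    (hK : K ∈ S.sublevel Kstar K0) :
    ∫⁻ z, ENNReal.ofReal (S.cost (K - η • gradEst σ (S.truncCost T) r K z.2 z.1) - S.cost Kstar)
      ∂(S.D.prod (unifSphere m n)) ≤
    ENNReal.ofReal (1 - η * c.mu / 2) * ENNReal.ofReal (S.cost K - S.cost Kstar) +
      ENNReal.ofReal (η * c.mu * (ε / 50)) := by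
  have hη := h.eta_pos
  have hμ := h.admissible.mu_pos
  have hε := h.eps_pos
  have hκ := h.eta_mul_mu_le
  have hgap := sub_nonneg.2 (h.isOptimal.2 K hK.1)
  have hq : 0 ≤ 1 - η * c.mu / 2 := by linarith
  refine (h.lintegral_step_le hK).trans ?_
  rw [← ENNReal.ofReal_mul hq, ← ENNReal.ofReal_add (by positivity) (by positivity)]
  refine ENNReal.ofReal_le_ofReal ?_
  have h1 := h.bias_sq_le
  set B := c.phi0 (S.sublevel Kstar K0) * r + c.pertBound (S.sublevel Kstar K0) ε
  have hpl := h.admissible.pl K hK.1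
  have h2 : 1 / 2 * (c.mu * (S.cost K - S.cost Kstar)) - c.mu * ε / 80 ≤
      ‖gradient S.cost K‖ ^ 2 - B * ‖gradient S.cost K‖ := by
    nlinarith [sq_nonneg (‖gradient S.cost K‖ - B)]
  have h3 := mul_le_mul_of_nonneg_left h2 hη.le
  have h4 : 0 < η * c.mu * ε := by positivity
  linarith

end RunAssumptions

end LQR

section Chain

open scoped ENNReal

/-! ### Stopped Markov chains with a drift condition -/

variable {Ω α β : Type*} [MeasurableSpace β] {F : α → β → α} {Z : ℕ → Ω → β} {K : ℕ → Ω → α}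
  {k0 : α} {V : α → ℝ≥0∞} {R : ℝ≥0∞}

/-- The `σ`-algebra generated by the noise before time `s`. -/
abbrev past (Z : ℕ → Ω → β) (s : ℕ) : MeasurableSpace Ω :=
  ⨆ i ∈ Set.Iio s, MeasurableSpace.comap (Z i) inferInstance

/-- The event that the chain `K` has satisfied `V ≤ R` up to time `s`. -/
def stay (V : α → ℝ≥0∞) (R : ℝ≥0∞) (K : ℕ → Ω → α) (s : ℕ) : Set Ω :=
  {ω | ∀ i ≤ s, V (K i ω) ≤ R}

theorem past_mono : Monotone (past Z) := fun _ _ hst =>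
  biSup_mono fun _ hi => lt_of_lt_of_le hi hst

theorem stay_succ_subset (s : ℕ) : stay V R K (s + 1) ⊆ stay V R K s :=
  fun _ h i hi => h i (hi.trans s.le_succ)

variable [MeasurableSpace α]

theorem measurable_chain (hF : Measurable (Function.uncurry F)) (hK0 : ∀ ω, K 0 ω = k0)
    (hK : ∀ s ω, K (s + 1) ω = F (K s ω) (Z s ω)) (s : ℕ) : Measurable[past Z s] (K s) := by
  induction s with
  | zero =>
    rw [show K 0 = fun _ => k0 from funext hK0]
    exact measurable_const
  | succ s ih =>
    have h1 : Measurable[past Z (s + 1)] (K s) := ih.mono (past_mono s.le_succ) le_rfl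
    have h2 : Measurable[past Z (s + 1)] (Z s) := by
      have h3 : MeasurableSpace.comap (Z s) inferInstance ≤ past Z (s + 1) :=
        le_biSup (fun i => MeasurableSpace.comap (Z i) inferInstance) (Set.mem_Iio.2 s.lt_succ_self)
      exact (comap_measurable (Z s)).mono h3 le_rfl
    rw [show K (s + 1) = fun ω => Function.uncurry F (K s ω, Z s ω) from funext (hK s)]
    exact hF.comp (h1.prodMk h2)

theorem measurableSet_stay (hV : Measurable V) (hF : Measurable (Function.uncurry F))
    (hK0 : ∀ ω, K 0 ω = k0) (hK : ∀ s ω, K (s + 1) ω = F (K s ω) (Z s ω)) (s : ℕ) :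
    MeasurableSet[past Z s] (stay V R K s) := by
  have : stay V R K s = ⋂ i ∈ Set.Iic s, {ω | V (K i ω) ≤ R} := by
    ext ω
    simp [stay]
  rw [this]
  refine MeasurableSet.biInter (Set.to_countable _) fun i hi => ?_
  exact (hV.comp ((measurable_chain hF hK0 hK i).mono (past_mono hi) le_rfl)) measurableSet_Iic

variable [MeasurableSpace Ω] {P : Measure Ω} {ν : Measure β}

theorem past_le (hZ : ∀ s, Measurable (Z s)) (s : ℕ) : past Z s ≤ ‹MeasurableSpace Ω› :=
  iSup₂_le fun i _ => (hZ i).comap_le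

/-- The noise at time `s` can be integrated out given the past. -/
theorem setLIntegral_stay [IsProbabilityMeasure P] (hV : Measurable V)
    (hF : Measurable (Function.uncurry F)) (hZ : ∀ s, Measurable (Z s))
    (hlaw : ∀ s, P.map (Z s) = ν) (hind : iIndepFun Z P) (hK0 : ∀ ω, K 0 ω = k0)
    (hK : ∀ s ω, K (s + 1) ω = F (K s ω) (Z s ω)) (s : ℕ) {φ : α → β → ℝ≥0∞}
    (hφ : Measurable (Function.uncurry φ)) :
    ∫⁻ ω in stay V R K s, φ (K s ω) (Z s ω) ∂P =
      ∫⁻ ω in stay V R K s, ∫⁻ z, φ (K s ω) z ∂ν ∂P := by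
  have hms := measurableSet_stay (R := R) hV hF hK0 hK s
  have hms' := past_le hZ s _ hms
  set Y : Ω → α × ℝ≥0∞ := fun ω => (K s ω, (stay V R K s).indicator (fun _ => 1) ω) with hY
  have hYm : Measurable[past Z s] Y :=
    (measurable_chain hF hK0 hK s).prodMk
      ((@measurable_const _ _ _ (past Z s) 1).indicator hms)
  have hYm' : Measurable Y := hYm.mono (past_le hZ s) le_rfl
  have hYZ : IndepFun Y (Z s) P := by
    have h1 := indep_iSup_of_disjoint (fun i => (hZ i).comap_le) hind
      (S := Set.Iio s) (T := {s}) (by simp)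
    rw [IndepFun_iff_Indep]
    refine indep_of_indep_of_le_left (indep_of_indep_of_le_right h1 ?_) hYm.comap_le
    exact le_biSup (fun i => MeasurableSpace.comap (Z i) inferInstance) (Set.mem_singleton s)
  have hprob : IsProbabilityMeasure ν := hlaw s ▸ Measure.isProbabilityMeasure_map (hZ s).aemeasurable
  have hmap : P.map (fun ω => (Y ω, Z s ω)) = (P.map Y).prod ν := by
    rw [(indepFun_iff_map_prod_eq_prod_map_map hYm'.aemeasurable (hZ s).aemeasurable).1 hYZ, hlaw]
  have hψ : Measurable fun q : (α × ℝ≥0∞) × β => q.1.2 * φ q.1.1 q.2 :=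
    (measurable_snd.comp measurable_fst).mul
      (hφ.comp ((measurable_fst.comp measurable_fst).prodMk measurable_snd))
  have h1 : ∫⁻ ω, (Y ω).2 * φ (Y ω).1 (Z s ω) ∂P = ∫⁻ ω, (Y ω).2 * ∫⁻ z, φ (Y ω).1 z ∂ν ∂P := by
    have := Measure.isProbabilityMeasure_map (μ := P) hYm'.aemeasurable
    have h2 := lintegral_map (μ := P) hψ (hYm'.prodMk (hZ s))
    rw [hmap, lintegral_prod _ hψ.aemeasurable, lintegral_map hψ.lintegral_prod_right' hYm'] at h2
    rw [← h2]
    refine lintegral_congr fun ω => lintegral_const_mul _ ?_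
    exact hφ.comp measurable_prodMk_left
  have h2 : ∀ f : Ω → ℝ≥0∞, ∫⁻ ω in stay V R K s, f ω ∂P = ∫⁻ ω, (Y ω).2 * f ω ∂P := by
    intro f
    rw [← lintegral_indicator hms']
    refine lintegral_congr fun ω => ?_
    by_cases hω : ω ∈ stay V R K s <;> simp [hY, hω]
  rw [h2, h2]
  exact h1

theorem setLIntegral_stay_succ_le [IsProbabilityMeasure P] (hV : Measurable V)
    (hF : Measurable (Function.uncurry F)) (hZ : ∀ s, Measurable (Z s))
    (hlaw : ∀ s, P.map (Z s) = ν) (hind : iIndepFun Z P) (hK0 : ∀ ω, K 0 ω = k0)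
    (hK : ∀ s ω, K (s + 1) ω = F (K s ω) (Z s ω)) {q a : ℝ≥0∞}
    (hstep : ∀ k, V k ≤ R → ∫⁻ z, V (F k z) ∂ν ≤ q * V k + a) (s : ℕ) :
    ∫⁻ ω in stay V R K s, V (K (s + 1) ω) ∂P ≤ q * ∫⁻ ω in stay V R K s, V (K s ω) ∂P + a := by
  have hms := past_le hZ s _ (measurableSet_stay (R := R) hV hF hK0 hK s)
  have hKm := (measurable_chain hF hK0 hK s).mono (past_le hZ s) le_rfl
  simp_rw [hK]
  rw [setLIntegral_stay hV hF hZ hlaw hind hK0 hK s (φ := fun k z => V (F k z)) (hV.comp hF)]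
  calc _ ≤ ∫⁻ ω in stay V R K s, (q * V (K s ω) + a) ∂P :=
        setLIntegral_mono' hms fun ω hω => hstep _ (hω s le_rfl)
    _ = q * ∫⁻ ω in stay V R K s, V (K s ω) ∂P + a * P (stay V R K s) := by
        rw [lintegral_add_right _ measurable_const, setLIntegral_const,
          lintegral_const_mul (f := fun ω => V (K s ω)) _ (hV.comp hKm)]
    _ ≤ _ := by
        gcongr
        exact mul_le_of_le_one_right' prob_le_one

/-- If `V` grows by at most `a` per step in expectation, the chain leaves `{V ≤ R}` before time `s`
with probability at most `(V k₀ + s a) / R`: on leaving, at least `R` of the expectation is used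
up. -/
theorem mul_measure_stay_compl_le [IsProbabilityMeasure P] (hV : Measurable V)
    (hF : Measurable (Function.uncurry F)) (hZ : ∀ s, Measurable (Z s))
    (hlaw : ∀ s, P.map (Z s) = ν) (hind : iIndepFun Z P) (hK0 : ∀ ω, K 0 ω = k0)
    (hK : ∀ s ω, K (s + 1) ω = F (K s ω) (Z s ω)) (hk0 : V k0 ≤ R) {a : ℝ≥0∞}
    (hstep : ∀ k, V k ≤ R → ∫⁻ z, V (F k z) ∂ν ≤ V k + a) (s : ℕ) :
    R * P (stay V R K s)ᶜ ≤ V k0 + s * a := by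
  have hms := fun s => past_le hZ s _ (measurableSet_stay (R := R) hV hF hK0 hK s)
  have key : ∀ s : ℕ, ∫⁻ ω in stay V R K s, V (K s ω) ∂P + R * P (stay V R K s)ᶜ ≤
      V k0 + s * a := by
    intro s
    induction s with
    | zero =>
      have h0 : stay V R K 0 = Set.univ := Set.eq_univ_of_forall fun ω i hi => by
        rw [Nat.le_zero.1 hi, hK0]
        exact hk0
      simp [h0, hK0]
    | succ s ih =>
      have h1 := setLIntegral_stay_succ_le hV hF hZ hlaw hind hK0 hK (q := 1) (a := a)
        (fun k hk => by rw [one_mul]; exact hstep k hk) s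
      rw [one_mul] at h1
      have hsub := stay_succ_subset (V := V) (R := R) (K := K) s
      set A := stay V R K s
      set A' := stay V R K (s + 1)
      have h2 : ∫⁻ ω in A', V (K (s + 1) ω) ∂P + ∫⁻ ω in A \ A', V (K (s + 1) ω) ∂P =
          ∫⁻ ω in A, V (K (s + 1) ω) ∂P := by
        have := lintegral_inter_add_sdiff (μ := P) (fun ω => V (K (s + 1) ω)) A (hms (s + 1))
        rwa [Set.inter_eq_right.2 hsub] at this
      have h3 : R * P (A \ A') ≤ ∫⁻ ω in A \ A', V (K (s + 1) ω) ∂P := by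
        rw [← setLIntegral_const]
        refine setLIntegral_mono' ((hms s).diff (hms (s + 1))) fun ω hω => ?_
        by_contra! hlt
        refine hω.2 fun i hi => ?_
        rcases hi.lt_or_eq with h | rfl
        · exact hω.1 i (Nat.lt_succ_iff.1 h)
        · exact hlt.le
      have h4 : P A'ᶜ ≤ P Aᶜ + P (A \ A') := by
        refine (measure_mono fun ω hω => ?_).trans (measure_union_le _ _)
        by_cases h : ω ∈ A
        · exact Or.inr ⟨h, hω⟩
        · exact Or.inl h
      calc ∫⁻ ω in A', V (K (s + 1) ω) ∂P + R * P A'ᶜ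
          ≤ ∫⁻ ω in A', V (K (s + 1) ω) ∂P + (R * P Aᶜ + R * P (A \ A')) := by
            rw [← mul_add]
            gcongr
        _ ≤ ∫⁻ ω in A', V (K (s + 1) ω) ∂P +
            (R * P Aᶜ + ∫⁻ ω in A \ A', V (K (s + 1) ω) ∂P) := by gcongr
        _ = ∫⁻ ω in A, V (K (s + 1) ω) ∂P + R * P Aᶜ := by
            rw [← h2]
            ring
        _ ≤ ∫⁻ ω in A, V (K s ω) ∂P + a + R * P Aᶜ := by gcongr
        _ = ∫⁻ ω in A, V (K s ω) ∂P + R * P Aᶜ + a := by ring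
        _ ≤ V k0 + s * a + a := by gcongr
        _ = _ := by
            push_cast
            ring
  exact le_add_self.trans (key s)

/-- Geometric decay of the expectation of `V` on the event that the chain has not left
`{V ≤ R}`. -/
theorem setLIntegral_stay_le [IsProbabilityMeasure P] (hV : Measurable V)
    (hF : Measurable (Function.uncurry F)) (hZ : ∀ s, Measurable (Z s))
    (hlaw : ∀ s, P.map (Z s) = ν) (hind : iIndepFun Z P) (hK0 : ∀ ω, K 0 ω = k0)
    (hK : ∀ s ω, K (s + 1) ω = F (K s ω) (Z s ω)) {q a b : ℝ≥0∞}
    (hstep : ∀ k, V k ≤ R → ∫⁻ z, V (F k z) ∂ν ≤ q * V k + a) (hb : q * b + a ≤ b) (s : ℕ) :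
    ∫⁻ ω in stay V R K s, V (K s ω) ∂P ≤ q ^ s * V k0 + b := by
  induction s with
  | zero =>
    simp_rw [hK0]
    rw [setLIntegral_const, pow_zero, one_mul]
    exact (mul_le_of_le_one_right' prob_le_one).trans le_self_add
  | succ s ih =>
    calc ∫⁻ ω in stay V R K (s + 1), V (K (s + 1) ω) ∂P
        ≤ ∫⁻ ω in stay V R K s, V (K (s + 1) ω) ∂P := lintegral_mono_set (stay_succ_subset s)
      _ ≤ q * ∫⁻ ω in stay V R K s, V (K s ω) ∂P + a :=
          setLIntegral_stay_succ_le hV hF hZ hlaw hind hK0 hK hstep s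
      _ ≤ q * (q ^ s * V k0 + b) + a := by gcongr
      _ = q ^ (s + 1) * V k0 + (q * b + a) := by ring
      _ ≤ _ := by gcongr

end Chain

namespace LQR

open scoped ENNReal

/-! ### The last iterate -/

variable {m n : ℕ} {S : LQR m n} {Cm : ℝ} {Kstar K0 : Policy m n} {c : LocalConstants m n}

open Classical in
/-- The gap `𝒥(K) - 𝒥(K*)`, infinite for a policy that is not stabilizing. -/
def extGap (S : LQR m n) (Kstar K : Policy m n) : ℝ≥0∞ :=
  if K ∈ S.stab then ENNReal.ofReal (S.cost K - S.cost Kstar) else ⊤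

theorem extGap_of_mem {K : Policy m n} (hK : K ∈ S.stab) :
    S.extGap Kstar K = ENNReal.ofReal (S.cost K - S.cost Kstar) := if_pos hK

theorem extGap_le_iff {K : Policy m n} {R : ℝ} (hR : 0 ≤ R) :
    S.extGap Kstar K ≤ ENNReal.ofReal R ↔ K ∈ S.stab ∧ S.cost K - S.cost Kstar ≤ R := by
  by_cases hK : K ∈ S.stab
  · rw [extGap_of_mem hK, ENNReal.ofReal_le_ofReal_iff hR]
    exact (and_iff_right hK).symm
  · simp [extGap, hK]

theorem extGap_lt_iff {K : Policy m n} {R : ℝ} (hR : 0 < R) :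
    S.extGap Kstar K < ENNReal.ofReal R ↔ K ∈ S.stab ∧ S.cost K - S.cost Kstar < R := by
  by_cases hK : K ∈ S.stab
  · rw [extGap_of_mem hK, ENNReal.ofReal_lt_ofReal_iff hR]
    exact (and_iff_right hK).symm
  · simp [extGap, hK]

theorem Standing.measurable_extGap (hS : S.Standing Cm) : Measurable (S.extGap Kstar) :=
  Measurable.ite S.isOpen_stab.measurableSet (hS.measurable_cost.sub_const _).ennreal_ofReal
    measurable_const

namespace RunAssumptions

variable {σ : Setting} {ε r η M γ : ℝ} {T : ℕ}

theorem extGap_K0 (h : RunAssumptions S Cm Kstar K0 c σ ε r η M γ T) :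
    S.extGap Kstar K0 = ENNReal.ofReal (S.gap Kstar K0) := extGap_of_mem h.mem_stab

theorem lintegral_extGap_step (h : RunAssumptions S Cm Kstar K0 c σ ε r η M γ T) {K : Policy m n}
    (hK : K ∈ S.sublevel Kstar K0) :
    ∫⁻ z, S.extGap Kstar (K - η • gradEst σ (S.truncCost T) r K z.2 z.1)
      ∂(S.D.prod (unifSphere m n)) =
    ∫⁻ z, ENNReal.ofReal (S.cost (K - η • gradEst σ (S.truncCost T) r K z.2 z.1) - S.cost Kstar)
      ∂(S.D.prod (unifSphere m n)) :=
  lintegral_congr_ae ((h.ae_step_mem_stab hK).mono fun _ hz => extGap_of_mem hz)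

section Iteration

variable {Ω : Type*} [MeasurableSpace Ω] {P : Measure Ω} [IsProbabilityMeasure P]
  {Z : ℕ → Ω → State n × Policy m n} {K : ℕ → Ω → Policy m n}

theorem measurable_step :
    Measurable (Function.uncurry fun (K : Policy m n) (z : State n × Policy m n) =>
      K - η • gradEst σ (S.truncCost T) r K z.2 z.1) := by
  have := measurable_gradEst σ (continuous_truncCost_uncurry (S := S) T).measurable r
  exact measurable_fst.sub (this.const_smul η)

/-- The probability that the iterates leave the sublevel set before time `s`. -/
theorem mul_measureReal_stay_compl_le (h : RunAssumptions S Cm Kstar K0 c σ ε r η M γ T)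
    (hZ : ∀ s, Measurable (Z s)) (hlaw : ∀ s, P.map (Z s) = S.D.prod (unifSphere m n))
    (hind : iIndepFun Z P) (hK0 : ∀ ω, K 0 ω = K0)
    (hK : ∀ s ω, K (s + 1) ω =
      K s ω - η • gradEst σ (S.truncCost T) r (K s ω) (Z s ω).2 (Z s ω).1) (s : ℕ) :
    10 * S.gap Kstar K0 *
      P.real (stay (S.extGap Kstar) (ENNReal.ofReal (10 * S.gap Kstar K0)) K s)ᶜ ≤
      S.gap Kstar K0 + s * (η * c.mu * (ε / 80)) := by
  have hΔ := h.gap_pos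
  have hη := h.eta_pos
  have hμ := h.admissible.mu_pos
  have hε := h.eps_pos
  have key := mul_measure_stay_compl_le (R := ENNReal.ofReal (10 * S.gap Kstar K0))
    h.standing.measurable_extGap measurable_step hZ hlaw hind hK0 hK
    ((extGap_le_iff (by positivity)).2 h.K0_mem)
    (a := ENNReal.ofReal (η * c.mu * (ε / 80))) (fun k hk => by
      have hk' : k ∈ S.sublevel Kstar K0 := (extGap_le_iff (by positivity)).1 hk
      rw [h.lintegral_extGap_step hk', extGap_of_mem hk'.1]
      exact h.lintegral_step_le_add hk') s
  rw [h.extGap_K0, ← ENNReal.ofReal_natCast s, ← ENNReal.ofReal_mul (by positivity),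
    ← ENNReal.ofReal_add hΔ.le (by positivity), ← ofReal_measureReal,
    ← ENNReal.ofReal_mul (by positivity), ENNReal.ofReal_le_ofReal_iff (by positivity)] at key
  exact key

/-- Markov's inequality for the gap of the iterate at time `s`, on the event that the iterates have
not left the sublevel set. -/
theorem mul_measureReal_stay_inter_le (h : RunAssumptions S Cm Kstar K0 c σ ε r η M γ T)
    (hZ : ∀ s, Measurable (Z s)) (hlaw : ∀ s, P.map (Z s) = S.D.prod (unifSphere m n))
    (hind : iIndepFun Z P) (hK0 : ∀ ω, K 0 ω = K0)
    (hK : ∀ s ω, K (s + 1) ω =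
      K s ω - η • gradEst σ (S.truncCost T) r (K s ω) (Z s ω).2 (Z s ω).1) (s : ℕ) :
    ε * P.real (stay (S.extGap Kstar) (ENNReal.ofReal (10 * S.gap Kstar K0)) K s ∩
      {ω | ENNReal.ofReal ε ≤ S.extGap Kstar (K s ω)}) ≤
      (1 - η * c.mu / 2) ^ s * S.gap Kstar K0 + ε / 25 := by
  have hΔ := h.gap_pos
  have hη := h.eta_pos
  have hμ := h.admissible.mu_pos
  have hε := h.eps_pos
  have hκ := h.eta_mul_mu_le
  have hq : 0 ≤ 1 - η * c.mu / 2 := by linarith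
  have hVm := h.standing.measurable_extGap (Kstar := Kstar)
  have hKm := (measurable_chain measurable_step hK0 hK s).mono (past_le hZ s) le_rfl
  have key := setLIntegral_stay_le (R := ENNReal.ofReal (10 * S.gap Kstar K0))
    hVm measurable_step hZ hlaw hind hK0 hK (q := ENNReal.ofReal (1 - η * c.mu / 2))
    (a := ENNReal.ofReal (η * c.mu * (ε / 50))) (b := ENNReal.ofReal (ε / 25)) (fun k hk => by
      have hk' : k ∈ S.sublevel Kstar K0 := (extGap_le_iff (by positivity)).1 hk
      rw [h.lintegral_extGap_step hk', extGap_of_mem hk'.1]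
      exact h.lintegral_step_le_mul hk')
    (by
      rw [← ENNReal.ofReal_mul hq, ← ENNReal.ofReal_add (by positivity) (by positivity)]
      refine ENNReal.ofReal_le_ofReal (le_of_eq ?_)
      ring) s
  rw [h.extGap_K0, ← ENNReal.ofReal_pow hq, ← ENNReal.ofReal_mul (by positivity),
    ← ENNReal.ofReal_add (mul_nonneg (by positivity) hΔ.le) (by positivity)] at key
  set A := stay (S.extGap Kstar) (ENNReal.ofReal (10 * S.gap Kstar K0)) K s
  have hM := mul_meas_ge_le_lintegral (μ := P.restrict A) (hVm.comp hKm) (ENNReal.ofReal ε)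
  have hset : MeasurableSet {ω | ENNReal.ofReal ε ≤ S.extGap Kstar (K s ω)} :=
    (hVm.comp hKm) measurableSet_Ici
  have h1 := hM.trans key
  simp only [Function.comp_apply] at h1
  rw [Measure.restrict_apply hset, Set.inter_comm, ← ofReal_measureReal,
    ← ENNReal.ofReal_mul hε.le, ENNReal.ofReal_le_ofReal_iff
      (add_nonneg (mul_nonneg (by positivity) hΔ.le) (by positivity))] at h1
  exact h1

/-- The failure probability splits into leaving the sublevel set early and a large gap at the end;
if `ε` is not below the level of the sublevel set, only the first is needed. -/
theorem measureReal_failure_le (h : RunAssumptions S Cm Kstar K0 c σ ε r η M γ T)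
    (hZ : ∀ s, Measurable (Z s)) (hlaw : ∀ s, P.map (Z s) = S.D.prod (unifSphere m n))
    (hind : iIndepFun Z P) (hK0 : ∀ ω, K 0 ω = K0)
    (hK : ∀ s ω, K (s + 1) ω =
      K s ω - η • gradEst σ (S.truncCost T) r (K s ω) (Z s ω).2 (Z s ω).1) :
    P.real {ω | ENNReal.ofReal ε ≤ S.extGap Kstar (K (S.iterNum Kstar K0 c.mu ε η) ω)} ≤ 1 / 4 := by
  have hΔ := h.gap_pos
  have hη := h.eta_pos
  have hμ := h.admissible.mu_pos
  have hε := h.eps_pos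
  have hκ := h.eta_mul_mu_le
  have hlog := h.log_lt
  set Δ := S.gap Kstar K0
  set ℓ := Real.log (120 * Δ / ε) with hℓ
  set N := S.iterNum Kstar K0 c.mu ε η with hN
  set κ := η * c.mu
  have hκ0 : 0 < κ := mul_pos hη hμ
  set A := stay (S.extGap Kstar) (ENNReal.ofReal (10 * Δ)) K N
  have hstay : ∀ ω ∈ A, S.extGap Kstar (K N ω) ≤ ENNReal.ofReal (10 * Δ) := fun ω hω => hω N le_rfl
  rcases le_or_gt ℓ 0 with hℓ0 | hℓ0
  · -- no iteration is made, and the initial gap is already small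
    have hN0 : N = 0 := by
      refine Nat.ceil_eq_zero.2 (mul_nonpos_of_nonneg_of_nonpos ?_ hℓ0)
      exact (div_pos (by norm_num) hκ0).le
    have h1 : 120 * Δ / ε ≤ 1 := by
      by_contra! h2
      exact absurd (Real.log_pos h2) (not_lt.2 hℓ0)
    rw [div_le_one hε] at h1
    have h2 : {ω | ENNReal.ofReal ε ≤ S.extGap Kstar (K N ω)} = ∅ := by
      refine Set.eq_empty_of_forall_notMem fun ω hω => ?_
      have h3 : ENNReal.ofReal ε ≤ S.extGap Kstar (K N ω) := hω
      rw [hN0, hK0, h.extGap_K0, ENNReal.ofReal_le_ofReal_iff hΔ.le] at h3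
      linarith
    rw [h2]
    norm_num
  have hεΔ : ε < 120 * Δ := by
    by_contra! h1
    refine absurd (Real.log_nonpos (by positivity) ((div_le_one hε).2 h1)) (not_le.2 hℓ0)
  have hN1 : (N : ℝ) < 4 / κ * ℓ + 1 := Nat.ceil_lt_add_one (by positivity)
  have hN2 : 4 / κ * ℓ ≤ N := Nat.le_ceil _
  have hleave : 10 * Δ * P.real Aᶜ ≤ Δ + N * (κ * (ε / 80)) :=
    h.mul_measureReal_stay_compl_le hZ hlaw hind hK0 hK N
  have hNc : N * (κ * (ε / 80)) ≤ 6 / 10 * Δ + ε / 160 := by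
    calc N * (κ * (ε / 80)) ≤ (4 / κ * ℓ + 1) * (κ * (ε / 80)) := by gcongr
      _ = ε * ℓ / 20 + κ * ε / 80 := by
        field_simp
        ring
      _ ≤ _ := by
        have := mul_le_mul_of_nonneg_right hκ hε.le
        linarith
  rcases lt_or_ge (10 * Δ) ε with hcase | hcase
  · have hsub : {ω | ENNReal.ofReal ε ≤ S.extGap Kstar (K N ω)} ⊆ Aᶜ := by
      intro ω hω hA
      have h1 := le_trans (show ENNReal.ofReal ε ≤ _ from hω) (hstay ω hA)
      rw [ENNReal.ofReal_le_ofReal_iff (by positivity)] at h1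
      linarith
    refine (measureReal_mono hsub).trans ?_
    by_contra! hlt
    have := mul_lt_mul_of_pos_left hlt hΔ
    linarith
  · have hsub : {ω | ENNReal.ofReal ε ≤ S.extGap Kstar (K N ω)} ⊆
        Aᶜ ∪ A ∩ {ω | ENNReal.ofReal ε ≤ S.extGap Kstar (K N ω)} := by
      intro ω hω
      by_cases hA : ω ∈ A
      · exact Or.inr ⟨hA, hω⟩
      · exact Or.inl hA
    refine (measureReal_mono hsub).trans ((measureReal_union_le _ _).trans ?_)
    have h1 : P.real Aᶜ ≤ 1 / 5 := by
      by_contra! hlt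
      have := mul_lt_mul_of_pos_left hlt hΔ
      linarith
    have hlarge : ε * P.real (A ∩ {ω | ENNReal.ofReal ε ≤ S.extGap Kstar (K N ω)}) ≤
        (1 - κ / 2) ^ N * Δ + ε / 25 :=
      h.mul_measureReal_stay_inter_le hZ hlaw hind hK0 hK N
    have hpow : (1 - κ / 2) ^ N ≤ ε / (120 * Δ) := by
      have h2 : 1 - κ / 2 ≤ Real.exp (-(κ / 2)) := by linarith [Real.add_one_le_exp (-(κ / 2))]
      calc (1 - κ / 2) ^ N ≤ Real.exp (-(κ / 2)) ^ N := by
            gcongr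
            linarith
        _ = Real.exp (-(κ / 2 * N)) := by
            rw [← Real.exp_nat_mul]
            congr 1
            ring
        _ ≤ Real.exp (-ℓ) := by
            have h3 := mul_le_mul_of_nonneg_left hN2 (by positivity : 0 ≤ κ / 2)
            have h4 : κ / 2 * (4 / κ * ℓ) = 2 * ℓ := by
              field_simp
              norm_num
            refine Real.exp_le_exp.2 ?_
            linarith
        _ = _ := by
            rw [Real.exp_neg, Real.exp_log (by positivity), inv_div]
    have h2 : (1 - κ / 2) ^ N * Δ ≤ ε / 120 := by
      calc _ ≤ ε / (120 * Δ) * Δ := by gcongr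
        _ = _ := by field_simp
    have h3 : P.real (A ∩ {ω | ENNReal.ofReal ε ≤ S.extGap Kstar (K N ω)}) ≤ 1 / 20 := by
      by_contra! hlt
      have := mul_lt_mul_of_pos_left hlt hε
      linarith
    linarith

/-- With probability at least `3 / 4` the last iterate is stabilizing and `ε`-optimal. -/
theorem three_fourths_le_measure (h : RunAssumptions S Cm Kstar K0 c σ ε r η M γ T)
    (hZ : ∀ s, Measurable (Z s)) (hlaw : ∀ s, P.map (Z s) = S.D.prod (unifSphere m n))
    (hind : iIndepFun Z P) (hK0 : ∀ ω, K 0 ω = K0)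
    (hK : ∀ s ω, K (s + 1) ω =
      K s ω - η • gradEst σ (S.truncCost T) r (K s ω) (Z s ω).2 (Z s ω).1) :
    3 / 4 ≤ P {ω | K (S.iterNum Kstar K0 c.mu ε η) ω ∈ S.stab ∧
      S.cost (K (S.iterNum Kstar K0 c.mu ε η) ω) - S.cost Kstar < ε} := by
  set N := S.iterNum Kstar K0 c.mu ε η
  have hKm := (measurable_chain measurable_step hK0 hK N).mono (past_le hZ N) le_rfl
  have hm : MeasurableSet {ω | ENNReal.ofReal ε ≤ S.extGap Kstar (K N ω)} :=
    (h.standing.measurable_extGap.comp hKm) measurableSet_Ici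
  have heq : {ω | K N ω ∈ S.stab ∧ S.cost (K N ω) - S.cost Kstar < ε} =
      {ω | ENNReal.ofReal ε ≤ S.extGap Kstar (K N ω)}ᶜ := by
    ext ω
    rw [Set.mem_compl_iff, Set.mem_ofPred_eq, Set.mem_ofPred_eq, not_le, extGap_lt_iff h.eps_pos]
  have h1 := h.measureReal_failure_le hZ hlaw hind hK0 hK
  rw [heq, ← ofReal_measureReal, probReal_compl_eq_one_sub hm]
  have h2 : (3 / 4 : ℝ≥0∞) = ENNReal.ofReal (3 / 4) := by
    rw [ENNReal.ofReal_div_of_pos (by norm_num), ENNReal.ofReal_ofNat, ENNReal.ofReal_ofNat]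
  rw [h2]
  exact ENNReal.ofReal_le_ofReal (by linarith)

end Iteration

end RunAssumptions

end LQR

end

theorem corollary1 {m n : ℕ} (hm : 0 < m) (hn : 0 < n) (S : LQR m n) (Cm : ℝ)
    (hS : S.Standing Cm) :
    -- the optimal policy exists
    ∃ Kstar : Policy m n, S.IsOptimal Kstar ∧ ∀ K0 ∈ S.stab,
    -- the scalars that the parameter choices refer to exist, and the rest holds for all of them
    (∃ c : LocalConstants m n, c.Admissible S Kstar K0) ∧
    ∀ c : LocalConstants m n, c.Admissible S Kstar K0 →
    ∀ r : ℝ, 0 < r → r ≤ c.rho0 (S.sublevel Kstar K0) →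
    (∃ M γ : ℝ, S.DecayConstants Kstar K0 r M γ) ∧
    ∀ M γ : ℝ, S.DecayConstants Kstar K0 r M γ →
    ∀ (σ : Setting) (ε η : ℝ), 0 < ε →
    ε * Real.log (120 * S.gap Kstar K0 / ε) < 12 * S.gap Kstar K0 →
    c.RadiusCond S Kstar K0 σ ε r →
    0 < η → c.StepCond S Kstar K0 σ Cm ε r η →
    ∀ Tδ : ℕ, (∀ᵐ x ∂S.D, S.rolloutBound c Kstar K0 ε r M γ x ≤ Tδ) →
    -- independent samples of the initial state and of the direction
    ∀ (Ω : Type*) [MeasurableSpace Ω] (P : Measure Ω) [IsProbabilityMeasure P]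
      (X : ℕ → Ω → State n) (D : ℕ → Ω → Policy m n),
    (∀ s, Measurable (X s)) → (∀ s, Measurable (D s)) →
    (∀ s, P.map (fun ω => (X s ω, D s ω)) = S.D.prod (unifSphere m n)) →
    iIndepFun (fun s ω => (X s ω, D s ω)) P →
    -- the algorithm, run with the finite-horizon cost
    ∀ K : ℕ → Ω → Policy m n, (∀ ω, K 0 ω = K0) →
    (∀ s ω, K (s + 1) ω =
      K s ω - η • gradEst σ (S.truncCost Tδ) r (K s ω) (D s ω) (X s ω)) →
    -- the truncation error is a perturbation of the exact estimate
    (∃ E : ℕ → Ω → Policy m n,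
      (∀ s ω, K (s + 1) ω =
        K s ω - η • gradEst σ S.costFrom r (K s ω) (D s ω) (X s ω) + η • E s ω) ∧
      ∀ᵐ ω ∂P, ∀ s, K s ω ∈ S.sublevel Kstar K0 →
        ‖E s ω‖ ≤ c.pertBound (S.sublevel Kstar K0) ε) ∧
    3 / 4 ≤ P {ω | K (S.iterNum Kstar K0 c.mu ε η) ω ∈ S.stab ∧
      S.cost (K (S.iterNum Kstar K0 c.mu ε η) ω) - S.cost Kstar < ε} := by
  obtain ⟨Kstar, hopt⟩ := hS.exists_isOptimal
  refine ⟨Kstar, hopt, fun K0 hK0 => ⟨hS.exists_admissible hn hopt hK0, ?_⟩⟩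
  intro c hc r hr hrρ
  refine ⟨hS.exists_decayConstants hc hrρ, ?_⟩
  intro M γ hdec σ ε η hε hlog hrad hη hstep T hT Ω _ P _ X D hX hD hlaw hind K hKz hKs
  have h : LQR.RunAssumptions S Cm Kstar K0 c σ ε r η M γ T :=
    ⟨hm, hn, hS, hopt, hK0, hc, hr, hdec, hε, hlog, hrad, hη, hstep, hT⟩
  have hZ : ∀ s, Measurable fun ω => (X s ω, D s ω) := fun s => (hX s).prodMk (hD s)
  refine ⟨⟨fun s ω => gradEst σ S.costFrom r (K s ω) (D s ω) (X s ω) -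
    gradEst σ (S.truncCost T) r (K s ω) (D s ω) (X s ω), fun s ω => ?_, ?_⟩, ?_⟩
  · rw [hKs, smul_sub]
    abel
  · have := hS.prob
    have := nontrivial_policy hm hn
    refine ae_all_iff.2 fun s => ?_
    have hz : ∀ᵐ z ∂(S.D.prod (unifSphere m n)), ∀ k ∈ S.sublevel Kstar K0,
        ‖gradEst σ S.costFrom r k z.2 z.1 - gradEst σ (S.truncCost T) r k z.2 z.1‖ ≤
          c.pertBound (S.sublevel Kstar K0) ε := by
      refine LQR.ae_prod_of_ae ?_
      filter_upwards [hT] with x hx d hd k hk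
      exact hS.norm_gradEst_sub_le_pertBound hc hε hr hrρ hdec hk hd hx σ
    rw [← hlaw s] at hz
    filter_upwards [ae_of_ae_map (hZ s).aemeasurable hz] with ω hω hk
    exact hω _ hk
  · exact h.three_fourths_le_measure hZ hlaw hind hKz hKs
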